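/- **Communication lower bound for PaLD, and communication-optimality of the blocked algorithms.** *Cohesion.* Let $D=(d_{xy})$ be a distance matrix on $n$ points $[n]$: $d_{xy}=d_{yx}$, $d_{xx}=0$, $d_{xy}>0$ for $x\ne y$. Put $u_{xy}=|\{z: d_{xz}\le d_{xy}\text{ or }d_{yz}\le d_{xy}\}|$, and $$g_{xyz}=\frac{\mathbb 1[d_{xz}\le d_{yz}]\cdot \mathbb 1[d_{xz}\le d_{xy}]}{u_{xy}},\qquad c_{xz}=\frac1{n-1}\sum_{y}g_{xyz}\quad(x\neq z).$$ *3NL.* A computation is three-nested-loops (3NL) if it includes computing $\mathrm{Mem}(\mathbf c(i,j))=f_{ij}(\{g_{ijk}(\mathrm{Mem}(\mathbf a(i,k)),\mathrm{Mem}(\mathbf b(k,j)))\}_{k\in S_{ij}})$ for all $(i,j)\in S_c$, where $\mathbf a,\mathbf b,\mathbf c$ are one-to-one maps of index sets $S_a,S_b,S_c\subseteq[n]\times[n]$ into slow memory and $f_{ij},g_{ijk}$ depend nontrivially on each of these arguments ($g_{ijk}$ may have further arguments). *Two-level model.* Fast memory has $M$ words, slow memory is unbounded. An execution is a finite sequence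 of instructions: read a word from slow into fast memory, write a word from fast to slow memory (each moves one word), copy within fast memory, or overwrite a fast cell by an arbitrary function of the values in fast cells (both free). Initially slow memory holds $D$ explicitly and zeros elsewhere, and fast memory holds no input. The bandwidth cost $W$ is the number of words moved. A *PaLD execution* on $D$ is one (it may depend on $D$ arbitrarily) that evaluates all $g_{xyz}$ with $x,y,z$ distinct, in any order, which requires that for each such triplet there is a moment at which copies of the compared distances $d_{xy},d_{yz},d_{xz}$ are in fast memory together, and that ends with the values $c_{xz}$, $x\ne z$, in slow memory, up to a common normalization factor. *Blocked algorithms.* The points are cut into consecutive blocks of size $b$ (the last may be smaller). * Pairwise, with the largest $b$ such that $2b^2+4b\le M$ (so $b\approx\sqrt{M/2}$): for all blocks $\mathcal X\le\mathcal Y$, read $D_{\mathcal X,\mathcal Y}$ and set $U_{\mathcal X,\mathcal Y}=0$ in fast memory. For each point $z$, read $D_{\mathcal X,z},D_{\mathcal Y,z}$ and, for $x<y$ in $\mathcal X\times\mathcal Y$, add $1$ to $u_{xy}$ if $d_{xz}<d_{xy}$ or $d_{yz}<d_{xy}$. Then for each $z$ read $D_{\mathcal X,z},D_{\mathcal Y,z},C_{\mathcal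 X,z},C_{\mathcal Y,z}$, under the same condition add $1/u_{xy}$ to $c_{xz}$ if $d_{xz}<d_{yz}$ and to $c_{yz}$ otherwise, and write $C_{\mathcal X,z},C_{\mathcal Y,z}$ back. * Triplet, with block sizes $\lfloor\sqrt{M/6}\rfloor$ and $\lfloor\sqrt{M/12}\rfloor$ in its two passes: initialize $u_{xy}=2$ in slow memory for $x<y$. Both passes run over blocks $\mathcal X\le\mathcal Y\le\mathcal Z$ and the triplets $x<y<z$ in $\mathcal X\times\mathcal Y\times\mathcal Z$; the blocks of the pair $\mathcal X,\mathcal Y$ stay in fast memory while $\mathcal Z$ varies, and those of $\mathcal X,\mathcal Z$ and $\mathcal Y,\mathcal Z$ are read for each $\mathcal Z$; updated blocks are written back. The first pass reads blocks of $D,U$ and, if $p,q$ is the closest pair of $\{x,y,z\}$ and $r$ the third point, adds $1$ to the focus sizes of the pairs $p,r$ and $q,r$. The second pass reads blocks of $D$, $U$, $C$ (both triangles) and adds $1/u_{pr}$ to $c_{pq}$ and $1/u_{qr}$ to $c_{qp}$. Here the closest pair is $x,y$ if $d_{xy}<d_{xz}$ and $d_{xy}<d_{yz}$; otherwise $x,z$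 if $d_{xz}<d_{yz}$; otherwise $y,z$. **Theorem.** 1. For every $n$, the cohesion computation is 3NL when the distance matrix is stored explicitly, with $\sum_{(i,j)\in S_c}|S_{ij}|=n(n-1)(n-2)$ operations: take $S_a=S_b=S_c=\{(i,j):i\ne j\}$, $S_{xz}=[n]\setminus\{x,z\}$, $\mathbf a(x,y),\mathbf b(y,z),\mathbf c(x,z)$ the locations of $d_{xy},d_{yz},c_{xz}$, $g_{xyz}$ as above with further arguments $d_{xz},u_{xy}$, and $f_{xz}$ the sum divided by $n-1$. 2. There is a constant $c>0$ such that for all $n\ge3$, all $M$ and every matrix $D$, every PaLD execution has $W\ge c\,n^3/\sqrt M$. 3. For $M\ge12$ and every distance matrix with $d_{xy}\ne d_{xz}$ for all distinct $x,y,z$, both blocked algorithms are PaLD executions in a fast memory of $M$ words; they end with $(n-1)c_{xz}$ for all $x\ne z$. 4. There is a constant $K$ such that for $12\le M\le n^2$ both blocked algorithms have $W\le K\,n^3/\sqrt M$. 5. There is a constant $K$ such that for all $n\ge3$, $M\ge12$, both blocked algorithms move at most $K$ times as many words as any PaLD execution for the same $n$ and $M$. So both are communication-optimal up to constant factors. 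-/

import Mathlib

noncomputable section

namespace PaLD

/-! ## Cohesion -/

/-- Pairwise distances (or dissimilarities) of `n` points; no triangle inequality is needed. -/
structure IsDistance {n : ℕ} (D : Fin n → Fin n → ℝ) : Prop where
  symm : ∀ x y, D x y = D y x
  self : ∀ x, D x x = 0
  pos : ∀ x y, x ≠ y → 0 < D x y

/-- No ties among the three distances of a triplet of distinct points. -/
def TieFree {n : ℕ} (D : Fin n → Fin n → ℝ) : Prop :=
  ∀ x y z, x ≠ y → x ≠ z → y ≠ z → D x y ≠ D x z

/-- The size `u_xy` of the local focus `{z | d_xz ≤ d_xy or d_yz ≤ d_xy}`. -/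
def focusSize {n : ℕ} (D : Fin n → Fin n → ℝ) (x y : Fin n) : ℝ :=
  ((Finset.univ.filter fun z => D x z ≤ D x y ∨ D y z ≤ D x y).card : ℝ)

/-- `gVal d_xy d_yz (d_xz, u_xy)` is the value
`g_xyz = 1[d_xz ≤ d_yz] * 1[d_xz ≤ d_xy] / u_xy`. -/
def gVal (dxy dyz : ℝ) (o : ℝ × ℝ) : ℝ :=
  (if o.1 ≤ dyz then 1 else 0) * (if o.1 ≤ dxy then 1 else 0) / o.2

/-- The cohesion `c_xz = (1 / (n - 1)) * ∑ y, g_xyz`. -/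
def cohesion {n : ℕ} (D : Fin n → Fin n → ℝ) (x z : Fin n) : ℝ :=
  1 / ((n : ℝ) - 1) * ∑ y, gVal (D x y) (D y z) (D x z, focusSize D x y)

/-! ## Three-nested-loops computations -/

/-- The data of a three-nested-loops computation on slow memory locations `L`:
`Mem(c(i,j)) = f_ij ({g_ijk (Mem(a(i,k)), Mem(b(k,j)))} for k ∈ S_ij)` for `(i,j) ∈ S_c`.
The functions `g_ijk` may have further arguments, of type `O`. -/
structure ThreeNL (n : ℕ) (L O : Type) where
  Sa : Finset (Fin n × Fin n)
  Sb : Finset (Fin n × Fin n)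
  Sc : Finset (Fin n × Fin n)
  S : Fin n → Fin n → Finset (Fin n)
  a : Fin n × Fin n → L
  b : Fin n × Fin n → L
  c : Fin n × Fin n → L
  f : (i j : Fin n) → ({k // k ∈ S i j} → ℝ) → ℝ
  g : (i j k : Fin n) → ℝ → ℝ → O → ℝ

/-- The index sets fit together, the mappings `a`, `b`, `c` are one-to-one, and `f_ij`, `g_ijk`
depend nontrivially on each of their arguments. -/
structure ThreeNL.IsThreeNL {n : ℕ} {L O : Type} (T : ThreeNL n L O) : Prop where
  index : ∀ i j k, (i, j) ∈ T.Sc → k ∈ T.S i j → (i, k) ∈ T.Sa ∧ (k, j) ∈ T.Sb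
  inj_a : Set.InjOn T.a T.Sa
  inj_b : Set.InjOn T.b T.Sb
  inj_c : Set.InjOn T.c T.Sc
  g_left : ∀ i j k, (i, j) ∈ T.Sc → k ∈ T.S i j →
    ∃ p p' q o, T.g i j k p q o ≠ T.g i j k p' q o
  g_right : ∀ i j k, (i, j) ∈ T.Sc → k ∈ T.S i j →
    ∃ p q q' o, T.g i j k p q o ≠ T.g i j k p q' o
  f_each : ∀ i j, (i, j) ∈ T.Sc → ∀ k : {k // k ∈ T.S i j},
    ∃ v v', (∀ l, l ≠ k → v l = v' l) ∧ T.f i j v ≠ T.f i j v'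

/-- The memory contents `mem` satisfy the defining equations, when the further arguments of
`g_ijk` are `o i j k`. -/
def ThreeNL.Computes {n : ℕ} {L O : Type} (T : ThreeNL n L O) (mem : L → ℝ)
    (o : Fin n → Fin n → Fin n → O) : Prop :=
  ∀ i j, (i, j) ∈ T.Sc → mem (T.c (i, j)) =
    T.f i j fun k => T.g i j k (mem (T.a (i, k))) (mem (T.b (k, j))) (o i j k)

/-- The number of three-nested-loops operations, `∑ |S_ij|` over `(i,j) ∈ S_c`. -/
def ThreeNL.numOps {n : ℕ} {L O : Type} (T : ThreeNL n L O) : ℕ :=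
  ∑ p ∈ T.Sc, (T.S p.1 p.2).card

/-! ## Slow memory and the three-nested-loops structure of PaLD -/

/-- Addresses in slow memory: the distance matrix, the cohesion matrix, and unbounded
auxiliary space. -/
inductive Addr (n : ℕ) : Type where
  | dist (x y : Fin n)
  | coh (x z : Fin n)
  | aux (i j : ℕ)

/-- PaLD with `i = x`, `j = z`, `k = y`: `c(x,z)` is the location of `c_xz`, `a(x,y)` and `b(y,z)`
are those of `d_xy` and `d_yz`, and `g_xyz` has the further arguments `d_xz` and `u_xy`. -/
def paldThreeNL (n : ℕ) : ThreeNL n (Addr n) (ℝ × ℝ) where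
  Sa := Finset.univ.filter fun p => p.1 ≠ p.2
  Sb := Finset.univ.filter fun p => p.1 ≠ p.2
  Sc := Finset.univ.filter fun p => p.1 ≠ p.2
  S := fun x z => Finset.univ.filter fun y => y ≠ x ∧ y ≠ z
  a := fun p => Addr.dist p.1 p.2
  b := fun p => Addr.dist p.1 p.2
  c := fun p => Addr.coh p.1 p.2
  f := fun _ _ v => 1 / ((n : ℝ) - 1) * ∑ y, v y
  g := fun _ _ _ => gVal

/-! ## The two-level memory model -/

/-- A machine word: a real value, and a mark that records of which input distance, if any, the
word is a copy (`some s(x, y)` for copies of `d_xy = d_yx`). The mark is bookkeeping only: no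
instruction can inspect it. -/
structure Word (n : ℕ) : Type where
  val : ℝ
  mark : Option (Sym2 (Fin n))

/-- Contents of slow memory and of fast memory (of whose cells only `0, …, M - 1` are available). -/
structure State (n : ℕ) : Type where
  slow : Addr n → Word n
  fast : ℕ → Word n

/-- The instructions: move a word from slow to fast memory, move a word from fast to slow memory,
copy within fast memory, and compute: overwrite a cell of fast memory by an arbitrary function of
the values in some cells of fast memory. -/
inductive Instr (n : ℕ) : Type where
  | read (a : Addr n) (r : ℕ)
  | write (r : ℕ) (a : Addr n)
  | copy (src dst : ℕ)
  | op (k : ℕ) (src : Fin k → ℕ) (φ : (Fin k → ℝ) → ℝ) (dst : ℕ)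

open Classical in
def Instr.exec {n : ℕ} (s : State n) : Instr n → State n
  | .read a r => { s with fast := Function.update s.fast r (s.slow a) }
  | .write r a => { s with slow := Function.update s.slow a (s.fast r) }
  | .copy src dst => { s with fast := Function.update s.fast dst (s.fast src) }
  | .op _ src φ dst =>
      { s with fast := Function.update s.fast dst ⟨φ fun i => (s.fast (src i)).val, none⟩ }

/-- The instruction refers only to the `M` cells `0, …, M - 1` of fast memory. -/
def Instr.FitsIn {n : ℕ} (M : ℕ) : Instr n → Prop
  | .read _ r => r < M
  | .write r _ => r < M
  | .copy src dst => src < M ∧ dst < M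
  | .op _ src _ dst => (∀ i, src i < M) ∧ dst < M

def Instr.cost {n : ℕ} : Instr n → ℕ
  | .read _ _ => 1
  | .write _ _ => 1
  | .copy _ _ => 0
  | .op _ _ _ _ => 0

/-- The bandwidth cost: the number of words moved between slow and fast memory. -/
def wordsMoved {n : ℕ} (P : List (Instr n)) : ℕ := (P.map Instr.cost).sum

/-- Initially slow memory holds the distance matrix, stored explicitly, and zeros elsewhere;
fast memory holds no input. -/
def initial {n : ℕ} (D : Fin n → Fin n → ℝ) : State n where
  slow := fun a => match a with
    | .dist x y => ⟨D x y, some s(x, y)⟩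
    | .coh _ _ => ⟨0, none⟩
    | .aux _ _ => ⟨0, none⟩
  fast := fun _ => ⟨0, none⟩

def exec {n : ℕ} (D : Fin n → Fin n → ℝ) (P : List (Instr n)) : State n :=
  P.foldl Instr.exec (initial D)

/-- A copy of `d_xy` resides in fast memory. -/
def State.Holds {n : ℕ} (s : State n) (M : ℕ) (x y : Fin n) : Prop :=
  ∃ r, r < M ∧ (s.fast r).mark = some s(x, y)

/-- `P` is the sequence of instructions that a PaLD algorithm executes on the input `D` with a fast
memory of `M` words. The algorithm evaluates all `g_xyz`, in any order and for any way of splitting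
the evaluation into instructions; as it computes on operands in fast memory only, there is a moment
at which the distances `d_xy`, `d_yz`, `d_xz` compared in `g_xyz` reside there together. In the end
the cohesions `c_xz` of all pairs `x ≠ z`, up to the normalization `κ`, are in slow memory.
The sequence may depend on `D` in any way, so control flow is unrestricted. -/
structure IsRun {n : ℕ} (M : ℕ) (D : Fin n → Fin n → ℝ) (κ : ℝ) (P : List (Instr n)) : Prop where
  fits : ∀ I ∈ P, I.FitsIn M
  evaluates : ∀ x y z : Fin n, x ≠ y → x ≠ z → y ≠ z → ∃ t ≤ P.length,
    (exec D (P.take t)).Holds M x y ∧ (exec D (P.take t)).Holds M y z ∧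
      (exec D (P.take t)).Holds M x z
  output : ∀ x z : Fin n, x ≠ z →
    ((exec D P).slow (Addr.coh x z)).val = κ * cohesion D x z

/-! ## Blocks of points

The points are cut into consecutive blocks of size `b` (the last one may be smaller). -/

def numBlocks (n b : ℕ) : ℕ := (n + b - 1) / b

/-- The points of block `X`. -/
def blk (n b X : ℕ) : List (Fin n) := (List.finRange n).filter fun x => x.val / b = X

/-- The pairs `x < y` with `x` in block `X` and `y` in block `Y`. -/
def pairsOf (n b X Y : ℕ) : List (Fin n × Fin n) :=
  (blk n b X ×ˢ blk n b Y).filter fun p => p.1 < p.2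

/-- The triplets `x < y < z` with `x`, `y`, `z` in the blocks `X`, `Y`, `Z`. -/
def triplesOf (n b X Y Z : ℕ) : List (Fin n × Fin n × Fin n) :=
  (blk n b X ×ˢ blk n b Y ×ˢ blk n b Z).filter fun p => p.1 < p.2.1 ∧ p.2.1 < p.2.2

/-- The fast memory cell for the entry `(x, y)` of the `b × b` block with number `k`. -/
def cell {n : ℕ} (b k : ℕ) (x y : Fin n) : ℕ := (k * b + x.val % b) * b + y.val % b

/-- The fast memory cell for the entry `x` of the vector of length `b` with number `k`; the vectors
lie behind two `b × b` blocks. -/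
def vec {n : ℕ} (b k : ℕ) (x : Fin n) : ℕ := 2 * b * b + k * b + x.val % b

/-! ## The blocked pairwise algorithm -/

/-- `1` if `z` is in the local focus of `x` and `y` (strict comparisons), else `0`. -/
def inFocus (dxy dxz dyz : ℝ) : ℝ := if dxz < dxy ∨ dyz < dxy then 1 else 0

/-- `1` if `z` is closer to `x` than to `y`, else `0`. -/
def closer (dxz dyz : ℝ) : ℝ := if dxz < dyz then 1 else 0

/-- Read `A x z` for the points `x` of block `X`, and `A y z` for the points `y` of block `Y`, into
the vectors `kX` and `kY`; for `X = Y` there is only one vector. -/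
def readVecs {n : ℕ} (A : Fin n → Fin n → Addr n) (b kX kY X Y : ℕ) (z : Fin n) :
    List (Instr n) :=
  ((blk n b X).map fun x => .read (A x z) (vec b kX x)) ++
    if X = Y then [] else (blk n b Y).map fun y => .read (A y z) (vec b kY y)

def writeVecs {n : ℕ} (A : Fin n → Fin n → Addr n) (b kX kY X Y : ℕ) (z : Fin n) :
    List (Instr n) :=
  ((blk n b X).map fun x => .write (vec b kX x) (A x z)) ++
    if X = Y then [] else (blk n b Y).map fun y => .write (vec b kY y) (A y z)

/-- The work on the pair of blocks `X`, `Y`. In fast memory, block `0` is `D_XY`, block `1` is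
`U_XY`; the vectors `0`, `1`, `2`, `3` are `D_Xz`, `D_Yz`, `C_Xz`, `C_Yz`. -/
def pairwiseBlock (n b X Y : ℕ) : List (Instr n) :=
  let sY := if X = Y then 0 else 1
  ((pairsOf n b X Y).map fun p => .read (.dist p.1 p.2) (cell b 0 p.1 p.2)) ++
  ((pairsOf n b X Y).map fun p => .op 0 ![] (fun _ => 0) (cell b 1 p.1 p.2)) ++
  ((List.finRange n).flatMap fun z =>
    readVecs .dist b 0 1 X Y z ++
    (pairsOf n b X Y).map fun p =>
      .op 4 ![cell b 1 p.1 p.2, cell b 0 p.1 p.2, vec b 0 p.1, vec b sY p.2]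
        (fun v => v 0 + inFocus (v 1) (v 2) (v 3)) (cell b 1 p.1 p.2)) ++
  ((List.finRange n).flatMap fun z =>
    readVecs .dist b 0 1 X Y z ++
    readVecs .coh b 2 3 X Y z ++
    ((pairsOf n b X Y).flatMap fun p =>
      [.op 5 ![vec b 2 p.1, cell b 1 p.1 p.2, cell b 0 p.1 p.2, vec b 0 p.1, vec b sY p.2]
        (fun v => v 0 + inFocus (v 2) (v 3) (v 4) * closer (v 3) (v 4) * (1 / v 1))
        (vec b 2 p.1),
       .op 5 ![vec b (2 + sY) p.2, cell b 1 p.1 p.2, cell b 0 p.1 p.2, vec b 0 p.1, vec b sY p.2]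
        (fun v => v 0 + inFocus (v 2) (v 3) (v 4) * (1 - closer (v 3) (v 4)) * (1 / v 1))
        (vec b (2 + sY) p.2)]) ++
    writeVecs .coh b 2 3 X Y z)

/-- The blocked pairwise algorithm with block size `b`. -/
def pairwise (n b : ℕ) : List (Instr n) :=
  (List.range (numBlocks n b)).flatMap fun X =>
    (List.range (numBlocks n b)).flatMap fun Y =>
      if X ≤ Y then pairwiseBlock n b X Y else []

/-! ## The blocked triplet algorithm -/

/-- Masks that single out the closest pair of a triplet: `x, y`, or `x, z`, or `y, z`. -/
def rMask (dxy dxz dyz : ℝ) : ℝ := if dxy < dxz ∧ dxy < dyz then 1 else 0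

def sMask (dxy dxz dyz : ℝ) : ℝ := (1 - rMask dxy dxz dyz) * if dxz < dyz then 1 else 0

def tMask (dxy dxz dyz : ℝ) : ℝ := (1 - rMask dxy dxz dyz) * (1 - sMask dxy dxz dyz)

def readBlock {n : ℕ} (A : Fin n → Fin n → Addr n) (b k X Y : ℕ) : List (Instr n) :=
  (pairsOf n b X Y).map fun p => .read (A p.1 p.2) (cell b k p.1 p.2)

def writeBlock {n : ℕ} (A : Fin n → Fin n → Addr n) (b k X Y : ℕ) : List (Instr n) :=
  (pairsOf n b X Y).map fun p => .write (cell b k p.1 p.2) (A p.1 p.2)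

/-- The location of `u_xy` in slow memory. -/
def focusAddr {n : ℕ} (x y : Fin n) : Addr n := .aux x.val y.val

/-- The location of `c_yx`, for blocks of the lower triangle of the cohesion matrix. -/
def cohT {n : ℕ} (x y : Fin n) : Addr n := .coh y x

/-- Slots in fast memory of the blocks `XZ` and `YZ`; the block `XY` has slot `0`. Coinciding
blocks share a slot. -/
def slotXZ (Y Z : ℕ) : ℕ := if Y = Z then 0 else 1

def slotYZ (X Y Z : ℕ) : ℕ := if X = Y then slotXZ Y Z else 2

/-- `U = triu(2 * ones(n), 1)`. -/
def focusInit (n : ℕ) : List (Instr n) :=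
  .op 0 ![] (fun _ => 2) 0 ::
    ((List.finRange n ×ˢ List.finRange n).filter fun p => p.1 < p.2).map
      fun p => .write 0 (focusAddr p.1 p.2)

/-- `φ` of the entry in block `k` and of `d_xy`, `d_xz`, `d_yz` (blocks `0`, `i`, `j`) is added. -/
def addU {n : ℕ} (b i j k : ℕ) (x y z p q : Fin n) (φ : ℝ → ℝ → ℝ → ℝ) : Instr n :=
  .op 4 ![cell b k p q, cell b 0 x y, cell b i x z, cell b j y z]
    (fun v => v 0 + φ (v 1) (v 2) (v 3)) (cell b k p q)

/-- The cell `c` is increased by `φ d_xy d_xz d_yz / u`, with `u` in the cell `w`. -/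
def addC {n : ℕ} (b i j : ℕ) (x y z : Fin n) (c w : ℕ) (φ : ℝ → ℝ → ℝ → ℝ) : Instr n :=
  .op 5 ![c, w, cell b 0 x y, cell b i x z, cell b j y z]
    (fun v => v 0 + φ (v 2) (v 3) (v 4) * (1 / v 1)) c

/-- First pass, blocks `X`, `Y`, `Z`: blocks `0, 1, 2` of fast memory are for `D`, `3, 4, 5` are
for `U`. The blocks `D_XY` and `U_XY` are already in fast memory. -/
def focusStep (n b X Y Z : ℕ) : List (Instr n) :=
  let i := slotXZ Y Z
  let j := slotYZ X Y Z
  (if Y = Z then [] else readBlock .dist b 1 X Z ++ readBlock focusAddr b 4 X Z) ++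
  (if X = Y then [] else readBlock .dist b 2 Y Z ++ readBlock focusAddr b 5 Y Z) ++
  ((triplesOf n b X Y Z).flatMap fun (x, y, z) =>
    [addU b i j 3 x y z x y fun p q w => sMask p q w + tMask p q w,
     addU b i j (3 + i) x y z x z fun p q w => rMask p q w + tMask p q w,
     addU b i j (3 + j) x y z y z fun p q w => rMask p q w + sMask p q w]) ++
  (if Y = Z then [] else writeBlock focusAddr b 4 X Z) ++
  (if X = Y then [] else writeBlock focusAddr b 5 Y Z)

/-- First pass: the local focus sizes `u_xy`, for `x < y`. -/
def focusPass (n b : ℕ) : List (Instr n) :=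
  (List.range (numBlocks n b)).flatMap fun X =>
    (List.range (numBlocks n b)).flatMap fun Y =>
      if X ≤ Y then
        readBlock .dist b 0 X Y ++ readBlock focusAddr b 3 X Y ++
        ((List.range (numBlocks n b)).flatMap fun Z =>
          if Y ≤ Z then focusStep n b X Y Z else []) ++
        writeBlock focusAddr b 3 X Y
      else []

/-- Second pass, blocks `X`, `Y`, `Z`: in addition, blocks `6, 7, 8` are for the upper and blocks
`9, 10, 11` for the lower triangle of `C`. -/
def cohesionStep (n b X Y Z : ℕ) : List (Instr n) :=
  let i := slotXZ Y Z
  let j := slotYZ X Y Z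
  (if Y = Z then [] else readBlock .dist b 1 X Z ++ readBlock focusAddr b 4 X Z ++
    readBlock .coh b 7 X Z ++ readBlock cohT b 10 X Z) ++
  (if X = Y then [] else readBlock .dist b 2 Y Z ++ readBlock focusAddr b 5 Y Z ++
    readBlock .coh b 8 Y Z ++ readBlock cohT b 11 Y Z) ++
  ((triplesOf n b X Y Z).flatMap fun (x, y, z) =>
    let uxy := cell b 3 x y
    let uxz := cell b (3 + i) x z
    let uyz := cell b (3 + j) y z
    [addC b i j x y z (cell b 6 x y) uxz rMask,
     addC b i j x y z (cell b 9 x y) uyz rMask,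
     addC b i j x y z (cell b (6 + i) x z) uxy sMask,
     addC b i j x y z (cell b (9 + i) x z) uyz sMask,
     addC b i j x y z (cell b (6 + j) y z) uxy tMask,
     addC b i j x y z (cell b (9 + j) y z) uxz tMask]) ++
  (if Y = Z then [] else writeBlock .coh b 7 X Z ++ writeBlock cohT b 10 X Z) ++
  (if X = Y then [] else writeBlock .coh b 8 Y Z ++ writeBlock cohT b 11 Y Z)

/-- Second pass: the cohesion matrix. -/
def cohesionPass (n b : ℕ) : List (Instr n) :=
  (List.range (numBlocks n b)).flatMap fun X =>
    (List.range (numBlocks n b)).flatMap fun Y =>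
      if X ≤ Y then
        readBlock .dist b 0 X Y ++ readBlock focusAddr b 3 X Y ++
        readBlock .coh b 6 X Y ++ readBlock cohT b 9 X Y ++
        ((List.range (numBlocks n b)).flatMap fun Z =>
          if Y ≤ Z then cohesionStep n b X Y Z else []) ++
        writeBlock .coh b 6 X Y ++ writeBlock cohT b 9 X Y
      else []

/-- The blocked triplet algorithm with block sizes `b₁` and `b₂` for the two passes. -/
def triplet (n b₁ b₂ : ℕ) : List (Instr n) :=
  focusInit n ++ focusPass n b₁ ++ cohesionPass n b₂

/-! ## Block sizes for a fast memory of `M` words -/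

/-- The largest `b` with `2 * b ^ 2 + 4 * b ≤ M`; to leading order, `√(M / 2)`. -/
def pairwiseSize (M : ℕ) : ℕ := Nat.sqrt (M / 2 + 1) - 1

/-- The blocked pairwise algorithm for a fast memory of `M` words. -/
def pairwiseFor (n M : ℕ) : List (Instr n) := pairwise n (pairwiseSize M)

/-- The blocked triplet algorithm for a fast memory of `M` words: block sizes `√(M / 6)` and
`√(M / 12)`, rounded down. -/
def tripletFor (n M : ℕ) : List (Instr n) := triplet n (Nat.sqrt (M / 6)) (Nat.sqrt (M / 12))

end PaLD

end

namespace PaLD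

/-! ### The three-nested-loops structure -/

/-! Lower bound. A triplet is evaluated only when its three distances are together in fast memory,
so the question is how many triangles a few reads can produce. Cut the execution according to `W t /
M` (rounded down), where `W t` counts the words moved up to time `t`. At most `M` distances are
present at the first moment of a segment and fewer than `M` words move during it, so it sees a set
`E` of at most `2 M` distances (`card_biUnion_segment_le`). Regard `E` as the edges of a graph: it
has at most `4 M` ordered edges, and by Cauchy-Schwarz the square of the number of ordered triangles
is at most the cube of that (`sq_card_triangles_le`). Thus a segment serves at most `8 M √M`
triples, and with at most `W / M + 1` segments, `n (n - 1) (n - 2) ≤ 8 (W + M) √M`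
(`IsRun.triples_le`). This gives the claim if `W ≥ M`. If `W < M`, every distance must still be read
once (`IsRun.pairs_le`), which forces `n ≤ 2 √M`, and then `n²` already dominates `n³ / √M`.

Cost. Let `m = min b n` and let `N` be the number of blocks; then `N m ≤ 2 n`. The pairwise
algorithm moves `O(n m)` words for each of `N²` pairs of blocks, the triplet algorithm `O(m²)` words
for each of `N³` triples of blocks and `O(n²)` for initialization; either way `O(n³ / m)`. Since `b`
is of order `√M`, this is `O(n³ / √M + n²)` (`wordsMoved_blocked_le`), and both terms are lower
bounds for any execution.

Correctness. The invariant `Caches` describes fast memory as a cache of slow memory, which may be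
stale on a given set of addresses. All updates have the form "add a value that does not depend on
the accumulated entries", so however the loops are nested, the final contents are the initial ones
plus a sum over blocks (`Caches.accumulate`, `Caches.loop`). Such sums regroup into sums over `x <
y` or `x < y < z` (`sum_blocks_pairs`, `sum_blocks_triples`). Without ties, the strict comparisons
and masks then reproduce the definitions of focus size and cohesion (`sum_pairContrib`,
`sum_focusUpdate`, `sum_cohesionUpdate`). The same invariant yields the moments at which the three
distances of a triplet are together. -/

theorem gVal_self_left {n : ℕ} {D : Fin n → Fin n → ℝ} (hD : IsDistance D) {x z : Fin n}
    (hxz : x ≠ z) (w : ℝ) (u : ℝ) : gVal (D x x) w (D x z, u) = 0 := by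
  have := hD.pos x z hxz
  simp [gVal, hD.self, this.not_ge]

theorem gVal_self_right {n : ℕ} {D : Fin n → Fin n → ℝ} (hD : IsDistance D) {x z : Fin n}
    (hxz : x ≠ z) (w : ℝ) (u : ℝ) : gVal w (D z z) (D x z, u) = 0 := by
  have := hD.pos x z hxz
  simp [gVal, hD.self, this.not_ge]

theorem paldThreeNL_isThreeNL (n : ℕ) : (paldThreeNL n).IsThreeNL where
  index i j k hij hk := by
    simp only [paldThreeNL, Finset.mem_filter, Finset.mem_univ, true_and] at hij hk ⊢
    exact ⟨hk.1.symm, hk.2⟩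
  inj_a := by
    rintro ⟨x, y⟩ _ ⟨x', y'⟩ _ h
    simpa [paldThreeNL] using h
  inj_b := by
    rintro ⟨x, y⟩ _ ⟨x', y'⟩ _ h
    simpa [paldThreeNL] using h
  inj_c := by
    rintro ⟨x, y⟩ _ ⟨x', y'⟩ _ h
    simpa [paldThreeNL] using h
  -- With all remaining data equal to `1`, raising the distance in question from `0` to `1` turns an
  -- indicator on.
  g_left i j k _ _ := ⟨0, 1, 1, (1, 1), by norm_num [paldThreeNL, gVal]⟩
  g_right i j k _ _ := ⟨1, 0, 1, (1, 1), by norm_num [paldThreeNL, gVal]⟩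
  f_each i j hij k := by
    classical
    -- For `n = 1` the factor `1 / 0 = 0` would make `f` constant; the two distinct indices exclude
    -- this.
    have hn : (n : ℝ) - 1 ≠ 0 := by
      have hij' : i ≠ j := by simpa [paldThreeNL] using hij
      intro h
      have h1 : n = 1 := by exact_mod_cast sub_eq_zero.mp h
      subst h1
      exact hij' (Subsingleton.elim _ _)
    refine ⟨0, Pi.single k 1, fun l hl => by simp [Pi.single_eq_of_ne hl], ?_⟩
    change ¬ (1 / ((n : ℝ) - 1) * ∑ _y, (0 : ℝ) = 1 / ((n : ℝ) - 1) * ∑ y, Pi.single k (1 : ℝ) y)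
    rw [Finset.sum_pi_single']
    simp [hn.symm]

theorem card_offDiag_filter (n : ℕ) :
    (Finset.univ.filter fun p : Fin n × Fin n => p.1 ≠ p.2).card = n * (n - 1) := by
  have : (Finset.univ.filter fun p : Fin n × Fin n => p.1 ≠ p.2) =
      (Finset.univ : Finset (Fin n)).offDiag := by ext; simp
  rw [this, Finset.offDiag_card]
  simp [Nat.mul_sub]

theorem card_filter_ne_ne {n : ℕ} {x z : Fin n} (h : x ≠ z) :
    (Finset.univ.filter fun y : Fin n => y ≠ x ∧ y ≠ z).card = n - 2 := by
  have : (Finset.univ.filter fun y : Fin n => y ≠ x ∧ y ≠ z) = ({x, z} : Finset (Fin n))ᶜ := by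
    ext; simp
  rw [this, Finset.card_compl, Finset.card_pair h, Fintype.card_fin]

theorem paldThreeNL_numOps (n : ℕ) : (paldThreeNL n).numOps = n * (n - 1) * (n - 2) := by
  unfold ThreeNL.numOps
  rw [Finset.sum_congr rfl (g := fun _ => n - 2), Finset.sum_const, smul_eq_mul]
  · congr 1
    exact card_offDiag_filter n
  · intro p hp
    have hp' : p.1 ≠ p.2 := by simpa [paldThreeNL] using hp
    exact card_filter_ne_ne hp'

/-- The loops skip `y = x` and `y = z`, over which the definition of cohesion also sums. Both terms
vanish because `d_xx = d_zz = 0 < d_xz`. -/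
theorem paldThreeNL_computes_iff {n : ℕ} {D : Fin n → Fin n → ℝ} (hD : IsDistance D)
    {mem : Addr n → ℝ} (hmem : ∀ x y, mem (.dist x y) = D x y) :
    (paldThreeNL n).Computes mem (fun x z y => (D x z, focusSize D x y)) ↔
      ∀ x z, x ≠ z → mem (.coh x z) = cohesion D x z := by
  unfold ThreeNL.Computes
  refine forall_congr' fun x => forall_congr' fun z => ?_
  have hSc : (x, z) ∈ (paldThreeNL n).Sc ↔ x ≠ z := by simp [paldThreeNL]
  rw [hSc]
  refine forall_congr' fun hxz => ?_
  have key : (∑ y : {y // y ∈ (paldThreeNL n).S x z},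
      gVal (D x y) (D y z) (D x z, focusSize D x y)) =
      ∑ y, gVal (D x y) (D y z) (D x z, focusSize D x y) := by
    rw [Finset.sum_coe_sort ((paldThreeNL n).S x z)
      (fun y => gVal (D x y) (D y z) (D x z, focusSize D x y))]
    refine Finset.sum_subset (Finset.subset_univ _) fun y _ hy => ?_
    have hy' : y = x ∨ y = z := by
      by_contra h
      push Not at h
      exact hy (by simpa [paldThreeNL] using h)
    rcases hy' with rfl | rfl
    · exact gVal_self_left hD hxz _ _
    · exact gVal_self_right hD hxz _ _
  rw [cohesion, ← key]
  simp only [paldThreeNL, hmem]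
  exact Iff.rfl

/-! ### The lower bound -/

/-! ### Few pairs span few triangles -/

section Triangles

variable {V : Type*} [Fintype V] [DecidableEq V]

/-- The ordered pairs whose unordered pair lies in `E`. -/
def orderedPairs (E : Finset (Sym2 V)) : Finset (V × V) :=
  Finset.univ.filter fun p => s(p.1, p.2) ∈ E

/-- The ordered triples whose three pairs lie in `E`. -/
def triangles (E : Finset (Sym2 V)) : Finset (V × V × V) :=
  Finset.univ.filter fun t => s(t.1, t.2.1) ∈ E ∧ s(t.2.1, t.2.2) ∈ E ∧ s(t.1, t.2.2) ∈ E

theorem card_orderedPairs_le (E : Finset (Sym2 V)) : (orderedPairs E).card ≤ 2 * E.card := by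
  refine Finset.card_le_mul_card_image_of_maps_to (f := fun p : V × V => s(p.1, p.2))
    (fun p hp => by simpa [orderedPairs] using hp) 2 ?_
  intro e _
  induction e using Sym2.ind with
  | _ x y =>
    refine (Finset.card_le_card (t := {(x, y), (y, x)}) ?_).trans Finset.card_le_two
    rintro ⟨p, q⟩ hp
    simpa using (Finset.mem_filter.mp hp).2

/-- A triangle is an ordered edge `(x, y)` with a common neighbour, so its count is a sum of `|d x ∩
d y|` over `O`. Cauchy-Schwarz leaves the sum of squares; bounding one factor by `|d x|`, the other
by `|d y|`, and summing over all pairs `(x, y)` gives the square of `∑ |d x| = |O|`. -/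
theorem sq_card_triangles_le (E : Finset (Sym2 V)) :
    (triangles E).card ^ 2 ≤ (orderedPairs E).card ^ 3 := by
  set O := orderedPairs E with hO
  let d : V → Finset V := fun x => Finset.univ.filter fun z => s(x, z) ∈ E
  have hd : ∑ x, (d x).card = O.card := by
    rw [← Finset.card_sigma]
    refine Finset.card_bij (fun a _ => (a.1, a.2)) ?_ ?_ ?_
    · rintro ⟨x, z⟩ h
      simpa [d, hO, orderedPairs] using h
    · rintro ⟨x, z⟩ _ ⟨x', z'⟩ _ h
      simpa using h
    · rintro ⟨x, z⟩ h
      exact ⟨⟨x, z⟩, by simpa [d, hO, orderedPairs] using h, rfl⟩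
  have h1 : (triangles E).card ≤ ∑ p ∈ O, (d p.1 ∩ d p.2).card := by
    rw [← Finset.card_sigma]
    refine Finset.card_le_card_of_injOn (fun t => ⟨(t.1, t.2.1), t.2.2⟩) ?_ ?_
    · rintro ⟨x, y, z⟩ h
      have h' := (Finset.mem_filter.mp h).2
      simp only [Finset.mem_coe, Finset.mem_sigma]
      simp_all [d, orderedPairs]
    · rintro ⟨x, y, z⟩ _ ⟨x', y', z'⟩ _ h
      simp only [Sigma.mk.injEq, Prod.mk.injEq, heq_eq_eq] at h
      simp_all
  have h2 : ∑ p ∈ O, (d p.1 ∩ d p.2).card ^ 2 ≤ O.card ^ 2 := by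
    calc ∑ p ∈ O, (d p.1 ∩ d p.2).card ^ 2
        ≤ ∑ p ∈ O, (d p.1).card * (d p.2).card := by
          refine Finset.sum_le_sum fun p _ => ?_
          rw [sq]
          exact Nat.mul_le_mul (Finset.card_le_card Finset.inter_subset_left)
            (Finset.card_le_card Finset.inter_subset_right)
      _ ≤ ∑ p : V × V, (d p.1).card * (d p.2).card :=
          Finset.sum_le_sum_of_subset (Finset.subset_univ _)
      _ = O.card ^ 2 := by
          rw [Fintype.sum_prod_type, ← hd, sq, Finset.sum_mul_sum]
  calc (triangles E).card ^ 2 ≤ (∑ p ∈ O, (d p.1 ∩ d p.2).card) ^ 2 := Nat.pow_le_pow_left h1 2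
    _ ≤ O.card * ∑ p ∈ O, (d p.1 ∩ d p.2).card ^ 2 := sq_sum_le_card_mul_sum_sq
    _ ≤ O.card * O.card ^ 2 := Nat.mul_le_mul_left _ h2
    _ = O.card ^ 3 := by ring

end Triangles

/-! ### How many distances a segment of the execution can see -/

section Segments

variable {α : Type*} [DecidableEq α]

/-- What appears in a window was there at its start or was paid for by an increase of `W`.
Monotonicity makes the truncated subtractions honest. -/
theorem card_biUnion_window_le {H : ℕ → Finset α} {W : ℕ → ℕ} (hW : Monotone W)
    (hH : ∀ t, ∃ A : Finset α, A.card ≤ W (t + 1) - W t ∧ H (t + 1) ⊆ H t ∪ A) (t₀ d : ℕ) :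
    ((Finset.range (d + 1)).biUnion fun s => H (t₀ + s)).card ≤
      (H t₀).card + (W (t₀ + d) - W t₀) := by
  induction d with
  | zero => simp
  | succ d ih =>
    obtain ⟨A, hA, hsub⟩ := hH (t₀ + d)
    have h1 : ((Finset.range (d + 1 + 1)).biUnion fun s => H (t₀ + s)) ⊆
        ((Finset.range (d + 1)).biUnion fun s => H (t₀ + s)) ∪ A := by
      rw [Finset.range_add_one, Finset.biUnion_insert]
      refine Finset.union_subset (hsub.trans ?_) Finset.subset_union_left
      refine Finset.union_subset_union_left ?_
      exact Finset.subset_biUnion_of_mem (fun s => H (t₀ + s)) (by simp)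
    have h2 := (Finset.card_le_card h1).trans (Finset.card_union_le _ _)
    have h3 := hW (Nat.le_add_right t₀ d)
    have h4 := hW (Nat.le_succ (t₀ + d))
    simp only [Nat.succ_eq_add_one, ← add_assoc] at h4 ⊢
    omega

/-- Between the first and the last moment with the same quotient `W t / M`, the counter `W` grows by
less than `M`; the other `M` pairs are those present at the first moment. -/
theorem card_biUnion_segment_le {H : ℕ → Finset α} {W : ℕ → ℕ} (hW : Monotone W)
    (hH : ∀ t, ∃ A : Finset α, A.card ≤ W (t + 1) - W t ∧ H (t + 1) ⊆ H t ∪ A)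
    {M : ℕ} (hM : 0 < M) (hHM : ∀ t, (H t).card ≤ M) (L j : ℕ) :
    (((Finset.range (L + 1)).filter fun t => W t / M = j).biUnion H).card ≤ 2 * M := by
  set S := (Finset.range (L + 1)).filter fun t => W t / M = j with hS
  rcases S.eq_empty_or_nonempty with h | h
  · simp [h]
  · have hmin := S.min'_mem h
    have hmax := S.max'_mem h
    set t₀ := S.min' h
    set t₁ := S.max' h
    have h01 : t₀ ≤ t₁ := S.min'_le _ hmax
    have hsub : S.biUnion H ⊆ (Finset.range (t₁ - t₀ + 1)).biUnion fun s => H (t₀ + s) := by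
      intro a ha
      obtain ⟨t, ht, hat⟩ := Finset.mem_biUnion.mp ha
      have hl : t₀ ≤ t := S.min'_le _ ht
      have hu : t ≤ t₁ := S.le_max' _ ht
      refine Finset.mem_biUnion.mpr ⟨t - t₀, Finset.mem_range.mpr (by omega), ?_⟩
      rwa [Nat.add_sub_cancel' hl]
    refine (Finset.card_le_card hsub).trans ((card_biUnion_window_le hW hH _ _).trans ?_)
    rw [Nat.add_sub_cancel' h01]
    have e0 : W t₀ / M = j := (Finset.mem_filter.mp hmin).2
    have e1 : W t₁ / M = j := (Finset.mem_filter.mp hmax).2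
    have a0 := Nat.div_add_mod (W t₀) M
    have a1 := Nat.div_add_mod (W t₁) M
    have b1 := Nat.mod_lt (W t₁) hM
    rw [e0] at a0
    rw [e1] at a1
    have := hHM t₀
    omega

end Segments

/-- The distances of which there are copies in fast memory. -/
def State.held {n : ℕ} (M : ℕ) (s : State n) : Finset (Sym2 (Fin n)) :=
  ((Finset.range M).image fun r => (s.fast r).mark).eraseNone

theorem State.mem_held {n : ℕ} {M : ℕ} {s : State n} {e : Sym2 (Fin n)} :
    e ∈ s.held M ↔ ∃ r < M, (s.fast r).mark = some e := by
  simp [State.held]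

theorem State.card_held_le {n : ℕ} (M : ℕ) (s : State n) : (s.held M).card ≤ M := by
  refine (Finset.card_eraseNone_le _).trans (Finset.card_image_le.trans ?_)
  simp

theorem held_initial {n : ℕ} (M : ℕ) (D : Fin n → Fin n → ℝ) : (initial D).held M = ∅ := by
  ext e
  simp [State.mem_held, initial]

/-- Only a read can bring in a distance, and at most one. A copy duplicates a distance that is
already held in the available cells, and a computed word carries no mark. -/
theorem exists_held_exec {n : ℕ} {M : ℕ} (s : State n) {I : Instr n} (hI : I.FitsIn M) :
    ∃ A : Finset (Sym2 (Fin n)), A.card ≤ I.cost ∧ (I.exec s).held M ⊆ s.held M ∪ A := by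
  cases I with
  | read a r =>
    refine ⟨(s.slow a).mark.toFinset, ?_, fun e he => ?_⟩
    · cases (s.slow a).mark <;> simp [Instr.cost]
    · obtain ⟨q, hq, h⟩ := State.mem_held.mp he
      by_cases hqr : q = r
      · subst hqr
        simp [Instr.exec] at h
        simp [h]
      · simp [Instr.exec, hqr] at h
        exact Finset.mem_union_left _ (State.mem_held.mpr ⟨q, hq, h⟩)
  | write r a => exact ⟨∅, by simp, fun e he => by simpa [State.mem_held, Instr.exec] using he⟩
  | copy src dst =>
    refine ⟨∅, by simp, fun e he => ?_⟩
    obtain ⟨q, hq, h⟩ := State.mem_held.mp he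
    by_cases hqr : q = dst
    · subst hqr
      simp [Instr.exec] at h
      exact Finset.mem_union_left _ (State.mem_held.mpr ⟨src, hI.1, h⟩)
    · simp [Instr.exec, hqr] at h
      exact Finset.mem_union_left _ (State.mem_held.mpr ⟨q, hq, h⟩)
  | op k src φ dst =>
    refine ⟨∅, by simp, fun e he => ?_⟩
    obtain ⟨q, hq, h⟩ := State.mem_held.mp he
    by_cases hqr : q = dst
    · subst hqr
      simp [Instr.exec] at h
    · simp [Instr.exec, hqr] at h
      exact Finset.mem_union_left _ (State.mem_held.mpr ⟨q, hq, h⟩)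

theorem wordsMoved_append {n : ℕ} (P Q : List (Instr n)) :
    wordsMoved (P ++ Q) = wordsMoved P + wordsMoved Q := by simp [wordsMoved]

theorem wordsMoved_take_mono {n : ℕ} (P : List (Instr n)) :
    Monotone fun t => wordsMoved (P.take t) := by
  refine monotone_nat_of_le_succ fun t => ?_
  rw [List.take_add_one, wordsMoved_append]
  exact Nat.le_add_right _ _

theorem exists_held_take_succ {n : ℕ} {M : ℕ} {D : Fin n → Fin n → ℝ} {P : List (Instr n)}
    (hP : ∀ I ∈ P, I.FitsIn M) (t : ℕ) :
    ∃ A : Finset (Sym2 (Fin n)),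
      A.card ≤ wordsMoved (P.take (t + 1)) - wordsMoved (P.take t) ∧
      (exec D (P.take (t + 1))).held M ⊆ (exec D (P.take t)).held M ∪ A := by
  rw [List.take_add_one, wordsMoved_append, Nat.add_sub_cancel_left]
  rcases h : P[t]? with _ | I
  -- Beyond the end of `P` both prefixes coincide.
  · exact ⟨∅, by simp⟩
  · obtain ⟨A, hA, hsub⟩ := exists_held_exec (exec D (P.take t))
      (hP I (List.mem_of_getElem? h))
    refine ⟨A, by simpa [wordsMoved] using hA, ?_⟩
    simpa [exec] using hsub

/-- Every distance has to be read at least once. -/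
theorem IsRun.pairs_le {n M : ℕ} {D : Fin n → Fin n → ℝ} {κ : ℝ} {P : List (Instr n)}
    (hn : 3 ≤ n) (h : IsRun M D κ P) : n * (n - 1) ≤ 2 * wordsMoved P := by
  have hcard := card_biUnion_window_le (H := fun t => (exec D (P.take t)).held M)
    (wordsMoved_take_mono P) (exists_held_take_succ (D := D) h.fits) 0 P.length
  set E := (Finset.range (P.length + 1)).biUnion fun s => (exec D (P.take (0 + s))).held M with hE
  -- Fast memory starts without input, so every distance ever held is paid for by a moved word.
  have h0 : ((exec D (P.take 0)).held M).card = 0 := by simp [exec, held_initial]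
  simp only [zero_add, List.take_length, List.take_zero] at hcard h0
  rw [← card_offDiag_filter]
  refine (Finset.card_le_card ?_).trans ((card_orderedPairs_le E).trans ?_)
  · rintro ⟨x, y⟩ hxy
    have hxy' : x ≠ y := by simpa using hxy
    -- Evaluation is demanded for triplets only; a third point exists as `3 ≤ n`.
    obtain ⟨z, hz⟩ : ((({x, y} : Finset (Fin n)))ᶜ).Nonempty := by
      rw [← Finset.card_pos, Finset.card_compl, Finset.card_pair hxy', Fintype.card_fin]
      omega
    simp only [Finset.mem_compl, Finset.mem_insert, Finset.mem_singleton, not_or] at hz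
    obtain ⟨t, ht, h1, -, -⟩ := h.evaluates x y z hxy' (Ne.symm hz.1) (Ne.symm hz.2)
    simp only [orderedPairs, Finset.mem_filter, Finset.mem_univ, true_and, hE, Finset.mem_biUnion]
    exact ⟨t, by simpa [Nat.lt_succ_iff] using ht,
      by rw [zero_add]; exact State.mem_held.mpr h1⟩
  · omega

/-- Each triplet is assigned to the segment of a moment at which its distances are together; there
are at most `W / M + 1` segments. The additive `M` pays for the last, incomplete one. -/
theorem IsRun.triples_le {n M : ℕ} {D : Fin n → Fin n → ℝ} {κ : ℝ} {P : List (Instr n)}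
    (hM : 0 < M) (h : IsRun M D κ P) :
    (n * (n - 1) * (n - 2) : ℕ) ≤ 8 * ((wordsMoved P : ℝ) + M) * √(M : ℝ) := by
  classical
  let H : ℕ → Finset (Sym2 (Fin n)) := fun t => (exec D (P.take t)).held M
  let W : ℕ → ℕ := fun t => wordsMoved (P.take t)
  let E : ℕ → Finset (Sym2 (Fin n)) := fun j =>
    ((Finset.range (P.length + 1)).filter fun t => W t / M = j).biUnion H
  have hE : ∀ j, (E j).card ≤ 2 * M := card_biUnion_segment_le (wordsMoved_take_mono P)
    (exists_held_take_succ h.fits) hM (fun t => State.card_held_le _ _) P.length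
  -- At most `2 * M` unordered pairs make `4 * M` ordered ones, and `(4 M) ^ (3 / 2) = 8 M √M`.
  have hT : ∀ j, ((triangles (E j)).card : ℝ) ≤ 8 * M * √(M : ℝ) := by
    intro j
    have h1 : (triangles (E j)).card ^ 2 ≤ (4 * M) ^ 3 :=
      (sq_card_triangles_le _).trans (Nat.pow_le_pow_left
        ((card_orderedPairs_le _).trans (by have := hE j; omega)) 3)
    refine abs_le_of_sq_le_sq' ?_ (by positivity) |>.2
    have h2 : ((triangles (E j)).card : ℝ) ^ 2 ≤ (4 * M) ^ 3 := by exact_mod_cast h1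
    have h3 : (8 * M * √(M : ℝ)) ^ 2 = (4 * (M : ℝ)) ^ 3 := by
      rw [mul_pow, Real.sq_sqrt (Nat.cast_nonneg M)]; ring
    rw [h3]
    exact h2
  have hcover : n * (n - 1) * (n - 2) ≤
      ((Finset.range (wordsMoved P / M + 1)).biUnion fun j => triangles (E j)).card := by
    -- The operations of the three nested loops are the ordered triplets, so their known number
    -- counts the triangles to be covered.
    rw [← paldThreeNL_numOps, ThreeNL.numOps, ← Finset.card_sigma]
    refine Finset.card_le_card_of_injOn (fun t => (t.1.1, t.2, t.1.2)) ?_ ?_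
    · rintro ⟨⟨x, z⟩, y⟩ hxyz
      have h' : x ≠ z ∧ y ≠ x ∧ y ≠ z := by simpa [paldThreeNL] using hxyz
      obtain ⟨t, ht, h1, h2, h3⟩ := h.evaluates x y z h'.2.1.symm h'.1 h'.2.2
      have hWt : W t ≤ wordsMoved P := by
        have := wordsMoved_take_mono P ht
        simpa using this
      have hHE : H t ⊆ E (W t / M) := Finset.subset_biUnion_of_mem H
        (by simpa [Nat.lt_succ_iff] using ht)
      simp only [Finset.mem_coe, Finset.mem_biUnion, Finset.mem_range, triangles,
        Finset.mem_filter, Finset.mem_univ, true_and]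
      exact ⟨W t / M, Nat.lt_succ_of_le (Nat.div_le_div_right hWt),
        hHE (State.mem_held.mpr h1), hHE (State.mem_held.mpr h2), hHE (State.mem_held.mpr h3)⟩
    · rintro ⟨⟨x, z⟩, y⟩ _ ⟨⟨x', z'⟩, y'⟩ _ heq
      simp only [Prod.mk.injEq] at heq
      obtain ⟨rfl, rfl, rfl⟩ := heq
      rfl
  have hMR : (0 : ℝ) < M := by exact_mod_cast hM
  calc ((n * (n - 1) * (n - 2) : ℕ) : ℝ)
      ≤ ∑ j ∈ Finset.range (wordsMoved P / M + 1), ((triangles (E j)).card : ℝ) := by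
        exact_mod_cast hcover.trans Finset.card_biUnion_le
    _ ≤ ∑ _j ∈ Finset.range (wordsMoved P / M + 1), 8 * M * √(M : ℝ) :=
        Finset.sum_le_sum fun j _ => hT j
    _ = 8 * (((wordsMoved P / M : ℕ) + 1) * M) * √(M : ℝ) := by
        rw [Finset.sum_const, Finset.card_range, nsmul_eq_mul]; push_cast; ring
    _ ≤ 8 * ((wordsMoved P : ℝ) + M) * √(M : ℝ) := by
        have : ((wordsMoved P / M : ℕ) : ℝ) * M ≤ wordsMoved P := by
          exact_mod_cast Nat.div_mul_le_self _ _
        gcongr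
        linarith

/-- From `n (n - 1) ≤ 2 W`; the constant `3` is the worst case `n = 3`. -/
theorem IsRun.sq_le {n M : ℕ} {D : Fin n → Fin n → ℝ} {κ : ℝ} {P : List (Instr n)}
    (hn : 3 ≤ n) (h : IsRun M D κ P) : (n : ℝ) ^ 2 ≤ 3 * wordsMoved P := by
  obtain ⟨m, rfl⟩ : ∃ m, n = m + 3 := ⟨n - 3, by omega⟩
  have h1 : ((m + 3) * (m + 2) : ℝ) ≤ 2 * wordsMoved P := by exact_mod_cast h.pairs_le hn
  push_cast
  have : (0 : ℝ) ≤ m := Nat.cast_nonneg m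
  nlinarith

/-- The communication lower bound. -/
theorem IsRun.lower_bound {n M : ℕ} {D : Fin n → Fin n → ℝ} {κ : ℝ} {P : List (Instr n)}
    (hn : 3 ≤ n) (h : IsRun M D κ P) :
    1 / 72 * ((n : ℝ) ^ 3 / √(M : ℝ)) ≤ wordsMoved P := by
  -- For `M = 0` the left-hand side is zero, since division by `√0` gives `0`.
  rcases Nat.eq_zero_or_pos M with rfl | hM
  · simp
  have hMR : (0 : ℝ) < M := by exact_mod_cast hM
  have hs : 0 < √(M : ℝ) := Real.sqrt_pos.mpr hMR
  rw [← mul_div_assoc, div_le_iff₀ hs]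
  -- If at least `M` words move, the additive `M` in the segment bound is absorbed; otherwise the
  -- whole input is small compared with fast memory.
  rcases le_or_gt M (wordsMoved P) with hle | hlt
  · have h1 := h.triples_le hM
    have hle' : (M : ℝ) ≤ wordsMoved P := by exact_mod_cast hle
    have h2 : 8 * ((wordsMoved P : ℝ) + M) * √(M : ℝ) ≤ 16 * (wordsMoved P * √(M : ℝ)) := by
      nlinarith
    -- Equality holds at `n = 3`. Together with `h1` and `h2` this gives the constant `2 / (9 * 16)
    -- = 1 / 72`.
    have h3 : 2 * (n : ℝ) ^ 3 ≤ 9 * (n * (n - 1) * (n - 2) : ℕ) := by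
      obtain ⟨m, rfl⟩ : ∃ m, n = m + 3 := ⟨n - 3, by omega⟩
      have h4 : m + 3 - 1 = m + 2 := rfl
      have h5 : m + 3 - 2 = m + 1 := rfl
      rw [h4, h5]
      have : (0 : ℝ) ≤ m := Nat.cast_nonneg m
      push_cast
      nlinarith [mul_nonneg this this, mul_nonneg this (mul_nonneg this this)]
    linarith
  · have h1 := h.sq_le hn
    have hlt' : (wordsMoved P : ℝ) ≤ M := by exact_mod_cast hlt.le
    -- Here `n² ≤ 3 W ≤ 3 M`.
    have h2 : (n : ℝ) ≤ 2 * √(M : ℝ) := by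
      refine abs_le_of_sq_le_sq' ?_ (by positivity) |>.2
      rw [mul_pow, Real.sq_sqrt hMR.le]
      linarith
    have h3 : (n : ℝ) ^ 3 ≤ (3 * wordsMoved P) * (2 * √(M : ℝ)) := by
      rw [pow_succ]
      exact mul_le_mul h1 h2 (by positivity) (by positivity)
    have h4 : 0 ≤ (wordsMoved P : ℝ) * √(M : ℝ) := by positivity
    linarith

/-! ### Blocks -/

theorem mem_blk {n b X : ℕ} {x : Fin n} : x ∈ blk n b X ↔ x.val / b = X := by simp [blk]

theorem nodup_blk (n b X : ℕ) : (blk n b X).Nodup := (List.nodup_finRange n).filter _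

theorem mem_pairsOf {n b X Y : ℕ} {p : Fin n × Fin n} :
    p ∈ pairsOf n b X Y ↔ (p.1.val / b = X ∧ p.2.val / b = Y) ∧ p.1 < p.2 := by
  obtain ⟨x, y⟩ := p
  simp [pairsOf, mem_blk]

theorem mem_triplesOf {n b X Y Z : ℕ} {t : Fin n × Fin n × Fin n} :
    t ∈ triplesOf n b X Y Z ↔ (t.1.val / b = X ∧ t.2.1.val / b = Y ∧ t.2.2.val / b = Z) ∧
      t.1 < t.2.1 ∧ t.2.1 < t.2.2 := by
  obtain ⟨x, y, z⟩ := t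
  simp [triplesOf, mem_blk]

/-- Points of one block differ in their remainders modulo `b`. The bound by `n` matters when blocks
are larger than the point set. -/
theorem length_blk_le {n b : ℕ} (hb : 0 < b) (X : ℕ) : (blk n b X).length ≤ min b n := by
  refine le_min ?_ ?_
  · rw [← List.toFinset_card_of_nodup (nodup_blk n b X)]
    conv_rhs => rw [← Finset.card_range b]
    refine Finset.card_le_card_of_injOn (fun x => x.val % b) ?_ ?_
    · intro x _
      simpa using Nat.mod_lt _ hb
    · intro x hx y hy hxy
      have hx' : x.val / b = X := mem_blk.mp (List.mem_toFinset.mp hx)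
      have hy' : y.val / b = X := mem_blk.mp (List.mem_toFinset.mp hy)
      have := Nat.div_add_mod x.val b
      have := Nat.div_add_mod y.val b
      simp only at hxy
      ext
      simp_all
  · exact (List.length_filter_le _ _).trans (by simp)

theorem length_pairsOf_le {n b : ℕ} (hb : 0 < b) (X Y : ℕ) :
    (pairsOf n b X Y).length ≤ min b n ^ 2 := by
  refine (List.length_filter_le _ _).trans ?_
  rw [List.length_product, sq]
  exact Nat.mul_le_mul (length_blk_le hb X) (length_blk_le hb Y)

/-- Rounding up the number of blocks costs at most a factor two; for `b > n` there is at most one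
block. -/
theorem numBlocks_mul_le {n b : ℕ} (hb : 0 < b) : numBlocks n b * min b n ≤ 2 * n := by
  unfold numBlocks
  rcases le_or_gt b n with h | h
  · rw [min_eq_left h]
    exact (Nat.div_mul_le_self _ _).trans (by omega)
  · rw [min_eq_right h.le]
    have : (n + b - 1) / b < 2 := (Nat.div_lt_iff_lt_mul hb).mpr (by omega)
    exact Nat.mul_le_mul_right _ (by omega)

theorem div_lt_numBlocks {n b : ℕ} (hb : 0 < b) (x : Fin n) : x.val / b < numBlocks n b := by
  unfold numBlocks
  rw [Nat.div_lt_iff_lt_mul hb]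
  have h1 := Nat.div_add_mod (n + b - 1) b
  have h2 := Nat.mod_lt (n + b - 1) hb
  have h3 := x.isLt
  rw [mul_comm] at h1
  omega

theorem cell_lt {n b k K : ℕ} (hb : 0 < b) (hk : k < K) (x y : Fin n) :
    cell b k x y < K * b * b := by
  have h1 := Nat.mod_lt x.val hb
  have h2 := Nat.mod_lt y.val hb
  unfold cell
  calc (k * b + x.val % b) * b + y.val % b < (k * b + x.val % b + 1) * b := by
        rw [add_mul _ 1]; omega
    _ ≤ (K * b) * b := by
        refine Nat.mul_le_mul_right _ ?_
        calc k * b + x.val % b + 1 ≤ (k + 1) * b := by rw [add_mul]; omega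
          _ ≤ K * b := Nat.mul_le_mul_right _ hk

theorem vec_lt {n b k K : ℕ} (hb : 0 < b) (hk : k < K) (x : Fin n) :
    vec b k x < 2 * b * b + K * b := by
  have h1 := Nat.mod_lt x.val hb
  have h2 : (k + 1) * b ≤ K * b := Nat.mul_le_mul_right _ hk
  unfold vec
  rw [add_mul] at h2
  omega

/-! ### The generic triplet pass -/

/-- The location of the entry `(x, y)` of `D`, `U`, the upper and the lower triangle of `C`. -/
def kindAddr {n : ℕ} : ℕ → Fin n → Fin n → Addr n
  | 0 => .dist
  | 1 => focusAddr
  | 2 => .coh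
  | _ => cohT

/-- Read the blocks `X`, `Y` of the given kinds into the slot `s` of each kind. -/
def readKinds (n b : ℕ) (R : List ℕ) (s X Y : ℕ) : List (Instr n) :=
  R.flatMap fun k => readBlock (kindAddr k) b (3 * k + s) X Y

def writeKinds (n b : ℕ) (W : List ℕ) (s X Y : ℕ) : List (Instr n) :=
  W.flatMap fun k => writeBlock (kindAddr k) b (3 * k + s) X Y

def tripleStep (n b : ℕ) (R W : List ℕ) (ops : ℕ → ℕ → ℕ → List (Instr n)) (X Y Z : ℕ) :
    List (Instr n) :=
  (if Y = Z then [] else readKinds n b R 1 X Z) ++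
  (if X = Y then [] else readKinds n b R 2 Y Z) ++ ops X Y Z ++
  (if Y = Z then [] else writeKinds n b W 1 X Z) ++
  (if X = Y then [] else writeKinds n b W 2 Y Z)

def triplePair (n b : ℕ) (R W : List ℕ) (ops : ℕ → ℕ → ℕ → List (Instr n)) (X Y : ℕ) :
    List (Instr n) :=
  readKinds n b R 0 X Y ++
  ((List.range (numBlocks n b)).flatMap fun Z =>
    if Y ≤ Z then tripleStep n b R W ops X Y Z else []) ++
  writeKinds n b W 0 X Y

def triplePass (n b : ℕ) (R W : List ℕ) (ops : ℕ → ℕ → ℕ → List (Instr n)) : List (Instr n) :=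
  (List.range (numBlocks n b)).flatMap fun X =>
    (List.range (numBlocks n b)).flatMap fun Y =>
      if X ≤ Y then triplePair n b R W ops X Y else []

/-- The pairs of a triplet that index the updated entries. -/
def triplePart {n : ℕ} (m : ℕ) (t : Fin n × Fin n × Fin n) : Fin n × Fin n :=
  match m with
  | 0 => (t.1, t.2.1)
  | 1 => (t.1, t.2.2)
  | _ => (t.2.1, t.2.2)

/-- The slots of the pairs of a triplet. -/
def partSlot (X Y Z m : ℕ) : ℕ :=
  match m with
  | 0 => 0
  | 1 => slotXZ Y Z
  | _ => slotYZ X Y Z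

noncomputable def focusMask (m : ℕ) (p q w : ℝ) : ℝ :=
  match m with
  | 0 => sMask p q w + tMask p q w
  | 1 => rMask p q w + tMask p q w
  | _ => rMask p q w + sMask p q w

/-- The update of the focus size of the pair `m` of the triplet `t`. -/
noncomputable def focusInstr {n : ℕ} (b X Y Z : ℕ) (e : ℕ × Fin n × Fin n × Fin n) : Instr n :=
  addU b (partSlot X Y Z 1) (partSlot X Y Z 2) (3 * 1 + partSlot X Y Z e.1) e.2.1 e.2.2.1 e.2.2.2
    (triplePart e.1 e.2).1 (triplePart e.1 e.2).2 (focusMask e.1)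

noncomputable def focusOps (n b X Y Z : ℕ) : List (Instr n) :=
  ((triplesOf n b X Y Z).flatMap fun t => [(0, t), (1, t), (2, t)]).map (focusInstr b X Y Z)

/-- Both passes fit one scheme, in which kind `k` of data occupies the blocks `3 k`, `3 k + 1`, `3 k
+ 2` of fast memory. Cost, contents and memory use are then established once for the scheme. -/
theorem focusPass_eq (n b : ℕ) :
    focusPass n b = triplePass n b [0, 1] [1] (focusOps n b) := by
  simp only [focusPass, triplePass, triplePair, readKinds, writeKinds, tripleStep, focusStep,
    focusOps, List.flatMap_cons, List.flatMap_nil, List.append_nil, List.append_assoc,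
    List.map_flatMap, List.map_cons, List.map_nil]
  rfl

noncomputable def cohesionMask (m : ℕ) (p q w : ℝ) : ℝ :=
  match m with
  | 0 => rMask p q w
  | 1 => sMask p q w
  | _ => tMask p q w

/-- For the closest pair `m` of a triplet, the pair whose focus size divides the update of the
upper (`k = 2`) or lower (`k = 3`) triangle. -/
def otherPart (k m : ℕ) : ℕ :=
  match m with
  | 0 => if k = 2 then 1 else 2
  | 1 => if k = 2 then 0 else 2
  | _ => if k = 2 then 0 else 1

noncomputable def cohesionInstr {n : ℕ} (b X Y Z : ℕ) (e : (ℕ × ℕ) × Fin n × Fin n × Fin n) :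
    Instr n :=
  addC b (partSlot X Y Z 1) (partSlot X Y Z 2) e.2.1 e.2.2.1 e.2.2.2
    (cell b (3 * e.1.1 + partSlot X Y Z e.1.2) (triplePart e.1.2 e.2).1 (triplePart e.1.2 e.2).2)
    (cell b (3 * 1 + partSlot X Y Z (otherPart e.1.1 e.1.2))
      (triplePart (otherPart e.1.1 e.1.2) e.2).1 (triplePart (otherPart e.1.1 e.1.2) e.2).2)
    (cohesionMask e.1.2)

noncomputable def cohesionOps (n b X Y Z : ℕ) : List (Instr n) :=
  ((triplesOf n b X Y Z).flatMap fun t =>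
    [((2, 0), t), ((3, 0), t), ((2, 1), t), ((3, 1), t), ((2, 2), t), ((3, 2), t)]).map
    (cohesionInstr b X Y Z)

theorem cohesionPass_eq (n b : ℕ) :
    cohesionPass n b = triplePass n b [0, 1, 2, 3] [2, 3] (cohesionOps n b) := by
  simp only [cohesionPass, triplePass, triplePair, readKinds, writeKinds, tripleStep, cohesionStep,
    cohesionOps, List.flatMap_cons, List.flatMap_nil, List.append_nil, List.append_assoc,
    List.map_flatMap, List.map_cons, List.map_nil]
  rfl

/-! ### The bandwidth cost of the blocked algorithms -/

theorem wordsMoved_nil {n : ℕ} : wordsMoved ([] : List (Instr n)) = 0 := rfl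

theorem Instr.cost_le_one {n : ℕ} (I : Instr n) : I.cost ≤ 1 := by cases I <;> simp [Instr.cost]

theorem wordsMoved_map_le {n : ℕ} {ε : Type*} (l : List ε) (I : ε → Instr n) :
    wordsMoved (l.map I) ≤ l.length := by
  induction l with
  | nil => simp [wordsMoved]
  | cons a l ih =>
    have := (I a).cost_le_one
    simp only [wordsMoved, List.map_cons, List.sum_cons, List.length_cons] at ih ⊢
    omega

theorem wordsMoved_eq_zero {n : ℕ} {P : List (Instr n)} (h : ∀ I ∈ P, I.cost = 0) :
    wordsMoved P = 0 := by
  simpa [wordsMoved, List.sum_eq_zero_iff] using h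

theorem wordsMoved_flatMap_le {n : ℕ} {ε : Type*} {l : List ε} {g : ε → List (Instr n)} {B : ℕ}
    (h : ∀ x ∈ l, wordsMoved (g x) ≤ B) : wordsMoved (l.flatMap g) ≤ l.length * B := by
  induction l with
  | nil => simp [wordsMoved]
  | cons a l ih =>
    rw [List.flatMap_cons, wordsMoved_append, List.length_cons, add_mul, one_mul, add_comm]
    exact Nat.add_le_add (ih fun x hx => h x (List.mem_cons_of_mem _ hx)) (h a List.mem_cons_self)

theorem wordsMoved_readVecs_le {n b : ℕ} (hb : 0 < b) (A : Fin n → Fin n → Addr n)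
    (kX kY X Y : ℕ) (z : Fin n) : wordsMoved (readVecs A b kX kY X Y z) ≤ 2 * min b n := by
  have h1 := (wordsMoved_map_le (blk n b X) fun x => .read (A x z) (vec b kX x)).trans
    (length_blk_le hb X)
  have h2 := (wordsMoved_map_le (blk n b Y) fun y => .read (A y z) (vec b kY y)).trans
    (length_blk_le hb Y)
  rw [readVecs, wordsMoved_append]
  split_ifs
  · rw [wordsMoved_nil]; omega
  · omega

theorem wordsMoved_writeVecs_le {n b : ℕ} (hb : 0 < b) (A : Fin n → Fin n → Addr n)
    (kX kY X Y : ℕ) (z : Fin n) : wordsMoved (writeVecs A b kX kY X Y z) ≤ 2 * min b n := by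
  have h1 := (wordsMoved_map_le (blk n b X) fun x => .write (vec b kX x) (A x z)).trans
    (length_blk_le hb X)
  have h2 := (wordsMoved_map_le (blk n b Y) fun y => .write (vec b kY y) (A y z)).trans
    (length_blk_le hb Y)
  rw [writeVecs, wordsMoved_append]
  split_ifs
  · rw [wordsMoved_nil]; omega
  · omega

/-- The `9` is `1` for the block of `D`, `2` for the two vectors per point of the first loop, and
`6` for the four read and two written vectors per point of the second. -/
theorem wordsMoved_pairwiseBlock_le {n b : ℕ} (hb : 0 < b) (X Y : ℕ) :
    wordsMoved (pairwiseBlock n b X Y) ≤ 9 * (n * min b n) := by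
  have hm : min b n ^ 2 ≤ n * min b n := by
    rw [sq]; exact Nat.mul_le_mul_right _ (min_le_right _ _)
  simp only [pairwiseBlock, wordsMoved_append]
  refine (Nat.add_le_add (Nat.add_le_add (Nat.add_le_add
    ((wordsMoved_map_le _ _).trans (length_pairsOf_le hb X Y))
    (wordsMoved_eq_zero (List.forall_mem_map.mpr fun _ _ => rfl)).le)
    (wordsMoved_flatMap_le (B := 2 * min b n) fun z _ => ?_))
    (wordsMoved_flatMap_le (B := 6 * min b n) fun z _ => ?_)).trans ?_
  · rw [wordsMoved_append, wordsMoved_eq_zero (P := List.map _ (pairsOf n b X Y))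
      (List.forall_mem_map.mpr fun _ _ => rfl), add_zero]
    exact wordsMoved_readVecs_le hb _ _ _ _ _ _
  · simp only [wordsMoved_append]
    rw [wordsMoved_eq_zero (P := List.flatMap _ _) (by
      intro I hI
      simp only [List.mem_flatMap, List.mem_cons, List.not_mem_nil, or_false] at hI
      obtain ⟨p, _, rfl | rfl⟩ := hI <;> rfl)]
    have h1 := wordsMoved_readVecs_le hb Addr.dist 0 1 X Y z
    have h2 := wordsMoved_readVecs_le hb Addr.coh 2 3 X Y z
    have h3 := wordsMoved_writeVecs_le hb Addr.coh 2 3 X Y z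
    omega
  · rw [List.length_finRange]
    nlinarith

/-- Multiplying by the effective block size avoids a division: each of the two block counts combines
with one factor `min b n` into at most `2 * n`, and `9 * 2 * 2 = 36`. -/
theorem wordsMoved_pairwise_mul_le {n b : ℕ} (hb : 0 < b) :
    wordsMoved (pairwise n b) * min b n ≤ 36 * n ^ 3 := by
  have h : wordsMoved (pairwise n b) ≤
      numBlocks n b * (numBlocks n b * (9 * (n * min b n))) := by
    have h1 : wordsMoved (pairwise n b) ≤ (List.range (numBlocks n b)).length *
        ((List.range (numBlocks n b)).length * (9 * (n * min b n))) := by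
      refine wordsMoved_flatMap_le fun X _ => wordsMoved_flatMap_le fun Y _ => ?_
      split_ifs
      · exact wordsMoved_pairwiseBlock_le hb X Y
      · simp [wordsMoved]
    simpa using h1
  have hN := numBlocks_mul_le (n := n) hb
  calc wordsMoved (pairwise n b) * min b n
      ≤ numBlocks n b * (numBlocks n b * (9 * (n * min b n))) * min b n :=
        Nat.mul_le_mul_right _ h
    _ = 9 * n * ((numBlocks n b * min b n) * (numBlocks n b * min b n)) := by ring
    _ ≤ 9 * n * ((2 * n) * (2 * n)) := Nat.mul_le_mul_left _ (Nat.mul_le_mul hN hN)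
    _ = 36 * n ^ 3 := by ring

theorem wordsMoved_readKinds_le {n b : ℕ} (hb : 0 < b) (R : List ℕ) (s X Y : ℕ) :
    wordsMoved (readKinds n b R s X Y) ≤ R.length * min b n ^ 2 :=
  wordsMoved_flatMap_le fun _ _ => (wordsMoved_map_le _ _).trans (length_pairsOf_le hb X Y)

theorem wordsMoved_writeKinds_le {n b : ℕ} (hb : 0 < b) (W : List ℕ) (s X Y : ℕ) :
    wordsMoved (writeKinds n b W s X Y) ≤ W.length * min b n ^ 2 :=
  wordsMoved_flatMap_le fun _ _ => (wordsMoved_map_le _ _).trans (length_pairsOf_le hb X Y)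

theorem wordsMoved_tripleStep_le {n b : ℕ} (hb : 0 < b) (R W : List ℕ)
    {ops : ℕ → ℕ → ℕ → List (Instr n)} {X Y Z : ℕ} (hops : ∀ I ∈ ops X Y Z, I.cost = 0) :
    wordsMoved (tripleStep n b R W ops X Y Z) ≤ 2 * (R.length + W.length) * min b n ^ 2 := by
  have hite : ∀ (c : Prop) [Decidable c] (P : List (Instr n)),
      wordsMoved (if c then [] else P) ≤ wordsMoved P := by
    intro c _ P
    split_ifs <;> simp [wordsMoved]
  simp only [tripleStep, wordsMoved_append, wordsMoved_eq_zero hops]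
  have h1 := (hite (Y = Z) _).trans (wordsMoved_readKinds_le (n := n) hb R 1 X Z)
  have h2 := (hite (X = Y) _).trans (wordsMoved_readKinds_le (n := n) hb R 2 Y Z)
  have h3 := (hite (Y = Z) _).trans (wordsMoved_writeKinds_le (n := n) hb W 1 X Z)
  have h4 := (hite (X = Y) _).trans (wordsMoved_writeKinds_le (n := n) hb W 2 Y Z)
  linarith

/-- Per pair of blocks one block of each kind is moved, and per triple of blocks two. With `N m ≤ 2
n` and `m ≤ n` this gives `4 n² (n + 4 n)` for each kind read or written. -/
theorem wordsMoved_triplePass_mul_le {n b : ℕ} (hb : 0 < b) (R W : List ℕ)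
    {ops : ℕ → ℕ → ℕ → List (Instr n)} (hops : ∀ X Y Z, ∀ I ∈ ops X Y Z, I.cost = 0) :
    wordsMoved (triplePass n b R W ops) * min b n ≤ 20 * (R.length + W.length) * n ^ 3 := by
  set q := R.length + W.length
  set m := min b n with hm
  set N := numBlocks n b with hNdef
  have hpair : ∀ X Y, wordsMoved (triplePair n b R W ops X Y) ≤
      q * m ^ 2 + N * (2 * q * m ^ 2) := by
    intro X Y
    have h1 := wordsMoved_readKinds_le (n := n) hb R 0 X Y
    have h2 := wordsMoved_writeKinds_le (n := n) hb W 0 X Y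
    have h3 : wordsMoved ((List.range N).flatMap fun Z =>
        if Y ≤ Z then tripleStep n b R W ops X Y Z else []) ≤
        (List.range N).length * (2 * q * m ^ 2) := by
      refine wordsMoved_flatMap_le fun Z _ => ?_
      split_ifs
      · exact wordsMoved_tripleStep_le hb R W (hops X Y Z)
      · simp [wordsMoved]
    rw [List.length_range] at h3
    simp only [triplePair, wordsMoved_append, ← hNdef, ← hm] at h1 h2 h3 ⊢
    have h4 : q * m ^ 2 = R.length * m ^ 2 + W.length * m ^ 2 := add_mul _ _ _
    omega
  have h : wordsMoved (triplePass n b R W ops) ≤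
      N * (N * (q * m ^ 2 + N * (2 * q * m ^ 2))) := by
    have h1 : wordsMoved (triplePass n b R W ops) ≤ (List.range N).length *
        ((List.range N).length * (q * m ^ 2 + N * (2 * q * m ^ 2))) := by
      refine wordsMoved_flatMap_le fun X _ => wordsMoved_flatMap_le fun Y _ => ?_
      split_ifs
      · exact hpair X Y
      · simp [wordsMoved]
    simpa using h1
  have hN : N * m ≤ 2 * n := numBlocks_mul_le hb
  have hmn : m ≤ n := min_le_right _ _
  calc wordsMoved (triplePass n b R W ops) * m
      ≤ N * (N * (q * m ^ 2 + N * (2 * q * m ^ 2))) * m := Nat.mul_le_mul_right _ h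
    _ = q * ((N * m) * (N * m)) * (m + 2 * (N * m)) := by ring
    _ ≤ q * ((2 * n) * (2 * n)) * (n + 2 * (2 * n)) := by gcongr
    _ = 20 * q * n ^ 3 := by ring

theorem cost_focusOps {n b X Y Z : ℕ} : ∀ I ∈ focusOps n b X Y Z, I.cost = 0 := by
  intro I hI
  obtain ⟨e, -, rfl⟩ := List.mem_map.mp hI
  rfl

theorem cost_cohesionOps {n b X Y Z : ℕ} : ∀ I ∈ cohesionOps n b X Y Z, I.cost = 0 := by
  intro I hI
  obtain ⟨e, -, rfl⟩ := List.mem_map.mp hI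
  rfl

theorem wordsMoved_focusInit_le (n : ℕ) : wordsMoved (focusInit n) ≤ n ^ 2 := by
  rw [focusInit, ← List.singleton_append, wordsMoved_append,
    wordsMoved_eq_zero (P := [_]) (by simp [Instr.cost]), zero_add]
  refine (wordsMoved_map_le _ _).trans ((List.length_filter_le _ _).trans ?_)
  rw [List.length_product, List.length_finRange, sq]

/-- The passes read and write `3` and `6` kinds in all, so `20 * 3 + 20 * 6`, and one more for the
initialization. -/
theorem wordsMoved_triplet_mul_le {n b₁ b₂ : ℕ} (h₁ : 0 < b₁) (h₂ : 0 < b₂) :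
    wordsMoved (triplet n b₁ b₂) * min (min b₁ b₂) n ≤ 181 * n ^ 3 := by
  rw [triplet, wordsMoved_append, wordsMoved_append, focusPass_eq, cohesionPass_eq, add_mul,
    add_mul]
  have e1 := wordsMoved_triplePass_mul_le h₁ [0, 1] [1]
    (fun X Y Z => cost_focusOps (n := n) (b := b₁) (X := X) (Y := Y) (Z := Z))
  have e2 := wordsMoved_triplePass_mul_le h₂ [0, 1, 2, 3] [2, 3]
    (fun X Y Z => cost_cohesionOps (n := n) (b := b₂) (X := X) (Y := Y) (Z := Z))
  have e0 : wordsMoved (focusInit n) * min (min b₁ b₂) n ≤ n ^ 2 * n :=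
    Nat.mul_le_mul (wordsMoved_focusInit_le n) (min_le_right _ _)
  have m1 : min (min b₁ b₂) n ≤ min b₁ n := min_le_min_right _ (min_le_left _ _)
  have m2 : min (min b₁ b₂) n ≤ min b₂ n := min_le_min_right _ (min_le_right _ _)
  have e1' := (Nat.mul_le_mul_left _ m1).trans e1
  have e2' := (Nat.mul_le_mul_left _ m2).trans e2
  simp only [List.length_cons, List.length_nil] at e1' e2'
  have : n ^ 2 * n = n ^ 3 := by ring
  linarith

/-- The constant `48` is not sharp here; it is the one needed for the triplet block sizes. -/
theorem le_mul_sq_pairwiseSize {M : ℕ} (hM : 12 ≤ M) :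
    0 < pairwiseSize M ∧ M ≤ 48 * pairwiseSize M ^ 2 := by
  have h1 : 2 ≤ Nat.sqrt (M / 2 + 1) := Nat.le_sqrt.mpr (by omega)
  have h2 := Nat.lt_succ_sqrt (M / 2 + 1)
  unfold pairwiseSize
  obtain ⟨s, hs⟩ : ∃ s, Nat.sqrt (M / 2 + 1) = s + 2 := ⟨_, (Nat.sub_add_cancel h1).symm⟩
  rw [hs] at h2 ⊢
  refine ⟨by omega, ?_⟩
  have h3 : M ≤ 2 * (M / 2) + 1 := by omega
  simp only [Nat.succ_eq_add_one] at h2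
  have : s + 2 - 1 = s + 1 := rfl
  rw [this]
  nlinarith

theorem le_mul_sq_sqrt_div {M c : ℕ} (hc : 0 < c) (h12 : c ≤ 12) (hM : 12 ≤ M) :
    0 < Nat.sqrt (M / c) ∧ M ≤ 48 * Nat.sqrt (M / c) ^ 2 := by
  have h0 : 1 ≤ M / c := (Nat.le_div_iff_mul_le hc).mpr (by omega)
  have h1 : 1 ≤ Nat.sqrt (M / c) := Nat.le_sqrt.mpr (by omega)
  have h2 := Nat.lt_succ_sqrt (M / c)
  refine ⟨h1, ?_⟩
  have h3 : M < c * (M / c + 1) := by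
    have := Nat.div_add_mod M c
    have := Nat.mod_lt M hc
    rw [mul_add, mul_one]
    omega
  set s := Nat.sqrt (M / c)
  simp only [Nat.succ_eq_add_one] at h2
  -- Since `M / c + 1 ≤ (s + 1) ^ 2` and `s + 1 ≤ 2 * s`. With `c ≤ 12` this yields `48 = 12 * 4`.
  have h4 : M / c + 1 ≤ 4 * s ^ 2 := by nlinarith
  have h5 : c * (M / c + 1) ≤ 12 * (4 * s ^ 2) := Nat.mul_le_mul h12 h4
  omega

/-- A cost bound in terms of the block size, as a bound in terms of the size of fast memory. -/
theorem cost_bound_of_block {n M b w C : ℕ} (hM : 0 < M) (hn : 0 < n) (hb : M ≤ 48 * b ^ 2)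
    (hw : w * min b n ≤ C * n ^ 3) :
    (w : ℝ) ≤ C * (7 * ((n : ℝ) ^ 3 / √(M : ℝ)) + (n : ℝ) ^ 2) := by
  have hMR : (0 : ℝ) < M := by exact_mod_cast hM
  have hnR : (0 : ℝ) < n := by exact_mod_cast hn
  have hs : 0 < √(M : ℝ) := Real.sqrt_pos.mpr hMR
  have hwR : (w : ℝ) * (min b n : ℕ) ≤ C * (n : ℝ) ^ 3 := by exact_mod_cast hw
  rcases le_total b n with h | h
  · rw [min_eq_left h] at hwR
    -- Because `48 ≤ 7 ^ 2`.
    have hb7 : √(M : ℝ) ≤ 7 * b := by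
      refine Real.sqrt_le_iff.mpr ⟨by positivity, ?_⟩
      have : (M : ℝ) ≤ 48 * (b : ℝ) ^ 2 := by exact_mod_cast hb
      nlinarith [sq_nonneg (b : ℝ)]
    have h1 : (w : ℝ) ≤ C * (7 * ((n : ℝ) ^ 3 / √(M : ℝ))) := by
      rw [← mul_div_assoc, ← mul_div_assoc, le_div_iff₀ hs]
      have : (w : ℝ) * √(M : ℝ) ≤ w * (7 * b) := by gcongr
      linarith
    have h2 : (0 : ℝ) ≤ C * (n : ℝ) ^ 2 := by positivity
    linarith
  · rw [min_eq_right h] at hwR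
    have h1 : (w : ℝ) ≤ C * (n : ℝ) ^ 2 := by
      have : (w : ℝ) * n ≤ (C * (n : ℝ) ^ 2) * n := by linarith [hwR]
      exact le_of_mul_le_mul_right this hnR
    have h2 : (0 : ℝ) ≤ C * (7 * ((n : ℝ) ^ 3 / √(M : ℝ))) := by positivity
    linarith

theorem wordsMoved_blocked_le {n M : ℕ} (hn : 0 < n) (hM : 12 ≤ M) :
    (wordsMoved (pairwiseFor n M) : ℝ) ≤
        181 * (7 * ((n : ℝ) ^ 3 / √(M : ℝ)) + (n : ℝ) ^ 2) ∧
      (wordsMoved (tripletFor n M) : ℝ) ≤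
        181 * (7 * ((n : ℝ) ^ 3 / √(M : ℝ)) + (n : ℝ) ^ 2) := by
  have hM0 : 0 < M := by omega
  constructor
  · obtain ⟨hb, hMb⟩ := le_mul_sq_pairwiseSize hM
    exact_mod_cast cost_bound_of_block (C := 181) hM0 hn hMb
      ((wordsMoved_pairwise_mul_le hb).trans (Nat.mul_le_mul_right _ (by norm_num)))
  · obtain ⟨hb₁, hMb₁⟩ := le_mul_sq_sqrt_div (c := 6) (by norm_num) (by norm_num) hM
    obtain ⟨hb₂, hMb₂⟩ := le_mul_sq_sqrt_div (c := 12) (by norm_num) (by norm_num) hM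
    have hmin : M ≤ 48 * min (Nat.sqrt (M / 6)) (Nat.sqrt (M / 12)) ^ 2 := by
      rcases min_choice (Nat.sqrt (M / 6)) (Nat.sqrt (M / 12)) with h | h <;> rw [h] <;> assumption
    exact_mod_cast cost_bound_of_block (C := 181) hM0 hn hmin (wordsMoved_triplet_mul_le hb₁ hb₂)

/-! ### Execution from an arbitrary state -/

noncomputable def run {n : ℕ} (s : State n) (P : List (Instr n)) : State n := P.foldl Instr.exec s

theorem run_append {n : ℕ} (s : State n) (P Q : List (Instr n)) :
    run s (P ++ Q) = run (run s P) Q := List.foldl_append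

theorem run_cons {n : ℕ} (s : State n) (I : Instr n) (P : List (Instr n)) :
    run s (I :: P) = run (I.exec s) P := rfl

/-- Some moment of the execution of `P` from `s` satisfies `Q`. -/
def Visits {n : ℕ} (s : State n) (P : List (Instr n)) (Q : State n → Prop) : Prop :=
  ∃ t ≤ P.length, Q (run s (P.take t))

theorem Visits.start {n : ℕ} {s : State n} {P : List (Instr n)} {Q : State n → Prop} (h : Q s) :
    Visits s P Q := ⟨0, Nat.zero_le _, by simpa [run] using h⟩

theorem Visits.append_right {n : ℕ} {s : State n} {P : List (Instr n)} {Q : State n → Prop}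
    (h : Visits s P Q) (P' : List (Instr n)) : Visits s (P ++ P') Q := by
  obtain ⟨t, ht, hQ⟩ := h
  refine ⟨t, by simp; omega, ?_⟩
  rwa [List.take_append_of_le_length ht]

theorem Visits.append_left {n : ℕ} {s : State n} {P P' : List (Instr n)} {Q : State n → Prop}
    (h : Visits (run s P) P' Q) : Visits s (P ++ P') Q := by
  obtain ⟨t, ht, hQ⟩ := h
  refine ⟨P.length + t, by simpa using ht, ?_⟩
  rwa [List.take_length_add_append, run_append]

/-- To reach a moment inside the body for `x`, it suffices that an invariant survives the bodies
executed before it. -/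
theorem Visits.flatMap {n : ℕ} {ε : Type*} {l : List ε} {g : ε → List (Instr n)}
    {Q Inv : State n → Prop} {x : ε} (hx : x ∈ l)
    (hinv : ∀ y ∈ l, ∀ s, Inv s → Inv (run s (g y))) (hQ : ∀ s, Inv s → Visits s (g x) Q)
    {s : State n} (hs : Inv s) : Visits s (l.flatMap g) Q := by
  induction l generalizing s with
  | nil => simp at hx
  | cons y l ih =>
    rw [List.flatMap_cons]
    rcases List.mem_cons.mp hx with rfl | hx'
    · exact (hQ s hs).append_right _
    · exact Visits.append_left (ih hx' (fun y' hy' => hinv y' (List.mem_cons_of_mem _ hy'))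
        (hinv y List.mem_cons_self s hs))

/-! ### Cached contents

The words `w a` are the current contents of the addresses `a`. `K r a` says that the cell `r` of
fast memory caches the address `a`, and slow memory is up to date except on the addresses `S`. -/

structure Caches {n : ℕ} (w : Addr n → Word n) (K : ℕ → Addr n → Prop) (S : Set (Addr n))
    (s : State n) : Prop where
  fast : ∀ r a, K r a → s.fast r = w a
  slow : ∀ a, a ∉ S → s.slow a = w a

/-- Besides forgetting cells or declaring more addresses stale, this allows `w` to be redefined at
every address that is stale and no longer cached. -/
theorem Caches.mono {n : ℕ} {w w' : Addr n → Word n} {K K' : ℕ → Addr n → Prop}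
    {S S' : Set (Addr n)} {s : State n} (h : Caches w K S s)
    (hK : ∀ r a, K' r a → K r a ∧ w a = w' a) (hS : ∀ a, a ∉ S' → a ∉ S ∧ w a = w' a) :
    Caches w' K' S' s where
  fast r a hra := (h.fast r a (hK r a hra).1).trans (hK r a hra).2
  slow a ha := (h.slow a (hS a ha).1).trans (hS a ha).2

/-- This covers reading a block and also setting cells to a constant, if `w` has that constant
there. Two items may share a cell provided that they share the address. -/
theorem run_fill {n : ℕ} {ε : Type*} {w : Addr n → Word n} {S : Set (Addr n)} {s : State n}
    (hs : ∀ a, a ∉ S → s.slow a = w a) (l : List ε) (c : ε → ℕ) (A : ε → Addr n)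
    (I : ε → Instr n)
    (hI : ∀ p ∈ l, ∀ s' : State n, (∀ a, a ∉ S → s'.slow a = w a) →
      (I p).exec s' = { s' with fast := Function.update s'.fast (c p) (w (A p)) })
    (hc : ∀ p ∈ l, ∀ q ∈ l, c p = c q → A p = A q) :
    (run s (l.map I)).slow = s.slow ∧ (∀ p ∈ l, (run s (l.map I)).fast (c p) = w (A p)) ∧
      ∀ r, (∀ p ∈ l, c p ≠ r) → (run s (l.map I)).fast r = s.fast r := by
  induction l generalizing s with
  | nil => simp [run]
  | cons p l ih =>
    rw [List.map_cons, run_cons, hI p List.mem_cons_self s hs]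
    obtain ⟨h1, h2, h3⟩ := ih
      (s := { s with fast := Function.update s.fast (c p) (w (A p)) }) hs
      (fun q hq => hI q (List.mem_cons_of_mem _ hq))
      (fun q hq q' hq' => hc q (List.mem_cons_of_mem _ hq) q' (List.mem_cons_of_mem _ hq'))
    refine ⟨h1, fun q hq => ?_, fun r hr => ?_⟩
    · by_cases hex : ∃ q' ∈ l, c q' = c q
      · obtain ⟨q', hq', hcc⟩ := hex
        rw [← hcc, h2 q' hq', hc q' (List.mem_cons_of_mem _ hq') q hq hcc]
      · push Not at hex
        have hqp : q = p := by
          rcases List.mem_cons.mp hq with h | h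
          · exact h
          · exact absurd rfl (hex q h)
        subst hqp
        rw [h3 _ hex]
        simp
    · rw [h3 r fun q hq => hr q (List.mem_cons_of_mem _ hq)]
      simp [(hr p List.mem_cons_self).symm]

theorem Caches.fill {n : ℕ} {ε : Type*} {w : Addr n → Word n} {K K' : ℕ → Addr n → Prop}
    {S : Set (Addr n)} {s : State n} (h : Caches w K S s) (l : List ε) (c : ε → ℕ)
    (A : ε → Addr n) (I : ε → Instr n)
    (hI : ∀ p ∈ l, ∀ s' : State n, (∀ a, a ∉ S → s'.slow a = w a) →
      (I p).exec s' = { s' with fast := Function.update s'.fast (c p) (w (A p)) })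
    (hc : ∀ p ∈ l, ∀ q ∈ l, c p = c q → A p = A q)
    (hK : ∀ r a, K' r a → (∃ p ∈ l, r = c p ∧ a = A p) ∨ (K r a ∧ ∀ p ∈ l, c p ≠ r)) :
    Caches w K' S (run s (l.map I)) := by
  obtain ⟨h1, h2, h3⟩ := run_fill h.slow l c A I hI hc
  refine ⟨fun r a hra => ?_, fun a ha => ?_⟩
  · rcases hK r a hra with ⟨p, hp, rfl, rfl⟩ | ⟨hra', hr⟩
    · exact h2 p hp
    · rw [h3 r hr, h.fast r a hra']
  · rw [h1, h.slow a ha]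

theorem Caches.reads {n : ℕ} {ε : Type*} {w : Addr n → Word n} {K K' : ℕ → Addr n → Prop}
    {S : Set (Addr n)} {s : State n} (h : Caches w K S s) (l : List ε) (c : ε → ℕ)
    (A : ε → Addr n) (hA : ∀ p ∈ l, A p ∉ S)
    (hc : ∀ p ∈ l, ∀ q ∈ l, c p = c q → A p = A q)
    (hK : ∀ r a, K' r a → (∃ p ∈ l, r = c p ∧ a = A p) ∨ (K r a ∧ ∀ p ∈ l, c p ≠ r)) :
    Caches w K' S (run s (l.map fun p => .read (A p) (c p))) := by
  refine h.fill l c A _ (fun p hp s' hs' => ?_) hc hK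
  simp [Instr.exec, hs' (A p) (hA p hp)]

theorem Caches.writes {n : ℕ} {ε : Type*} {w : Addr n → Word n} {K : ℕ → Addr n → Prop}
    {S S' : Set (Addr n)} {s : State n} (h : Caches w K S s) (l : List ε) (c : ε → ℕ)
    (A : ε → Addr n) (hK : ∀ p ∈ l, K (c p) (A p))
    (hS : ∀ a, a ∉ S' → a ∉ S ∨ ∃ p ∈ l, a = A p) :
    Caches w K S' (run s (l.map fun p => .write (c p) (A p))) := by
  classical
  induction l generalizing s S with
  | nil => exact h.mono (fun r a hra => ⟨hra, rfl⟩) (fun a ha => ⟨by simpa using hS a ha, rfl⟩)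
  | cons p l ih =>
    rw [List.map_cons, run_cons]
    -- Writing back a cached address removes it from the stale set.
    refine ih (S := S \ {A p}) ⟨fun r a hra => h.fast r a hra, fun a ha => ?_⟩
      (fun q hq => hK q (List.mem_cons_of_mem _ hq)) (fun a ha => ?_)
    · simp only [Instr.exec]
      by_cases hap : a = A p
      · subst hap
        simp [h.fast _ _ (hK p List.mem_cons_self)]
      · rw [Function.update_of_ne hap]
        exact h.slow a fun haS => ha ⟨haS, hap⟩
    · rcases hS a ha with h' | ⟨q, hq, rfl⟩
      · exact Or.inl fun h'' => h' h''.1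
      · rcases List.mem_cons.mp hq with rfl | hq'
        · exact Or.inl fun h'' => h''.2 rfl
        · exact Or.inr ⟨q, hq', rfl⟩

open Classical in
/-- The contents `w` outside `T`, and the values `f` on `T`. -/
noncomputable def accum {n : ℕ} (w : Addr n → Word n) (T : Set (Addr n)) (f : Addr n → ℝ)
    (a : Addr n) : Word n :=
  if a ∈ T then ⟨f a, none⟩ else w a

theorem accum_of_mem {n : ℕ} {w : Addr n → Word n} {T : Set (Addr n)} {f : Addr n → ℝ}
    {a : Addr n} (h : a ∈ T) : accum w T f a = ⟨f a, none⟩ := if_pos h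

theorem accum_of_notMem {n : ℕ} {w : Addr n → Word n} {T : Set (Addr n)} {f : Addr n → ℝ}
    {a : Addr n} (h : a ∉ T) : accum w T f a = w a := if_neg h

open Classical in
-- `hI` quantifies over all `f` and lets `v` depend on the item only: no increment looks at the
-- entries being accumulated, so increments just add up. `hK` excludes aliasing: among the cached
-- entries, the target cell and the target address determine each other.
theorem Caches.accumulate {n : ℕ} {ε : Type*} {w : Addr n → Word n} {T : Set (Addr n)}
    {K : ℕ → Addr n → Prop} {S : Set (Addr n)} (l : List ε) (I : ε → Instr n) (c : ε → ℕ)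
    (A : ε → Addr n) (v : ε → ℝ) (hT : ∀ e ∈ l, A e ∈ T) (hS : ∀ e ∈ l, A e ∈ S)
    (hK : ∀ e ∈ l, ∀ r a, K r a → (r = c e ↔ a = A e))
    (hI : ∀ e ∈ l, ∀ (f : Addr n → ℝ) (s : State n), Caches (accum w T f) K S s →
      (I e).exec s = { s with fast := Function.update s.fast (c e) ⟨f (A e) + v e, none⟩ })
    {f : Addr n → ℝ} {s : State n} (h : Caches (accum w T f) K S s) :
    Caches (accum w T fun a => f a + (l.map fun e => if a = A e then v e else 0).sum) K S
      (run s (l.map I)) := by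
  induction l generalizing f s with
  | nil => simpa [run] using h
  | cons e l ih =>
    have h' : Caches (accum w T fun a => f a + if a = A e then v e else 0) K S ((I e).exec s) := by
      rw [hI e List.mem_cons_self f s h]
      refine ⟨fun r a hra => ?_, fun a ha => ?_⟩
      · have hiff := hK e List.mem_cons_self r a hra
        by_cases hr : r = c e
        · obtain rfl := hiff.mp hr
          subst hr
          simp [accum_of_mem (hT e List.mem_cons_self)]
        · have ha : a ≠ A e := fun ha => hr (hiff.mpr ha)
          simp only [Function.update_of_ne hr, h.fast r a hra, accum, if_neg ha, add_zero]
      · have hae : a ≠ A e := fun h => ha (h ▸ hS e List.mem_cons_self)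
        simp only [h.slow a ha, accum, if_neg hae, add_zero]
    have h'' := ih (fun e' he' => hT e' (List.mem_cons_of_mem _ he'))
      (fun e' he' => hS e' (List.mem_cons_of_mem _ he'))
      (fun e' he' => hK e' (List.mem_cons_of_mem _ he'))
      (fun e' he' => hI e' (List.mem_cons_of_mem _ he')) h'
    simpa only [List.map_cons, List.sum_cons, run_cons, add_assoc] using h''

/-- The increment `δ x` is independent of `f`, hence the bodies compose by addition and nested loops
give nested sums. -/
theorem Caches.loop {n : ℕ} {ε : Type*} {w : Addr n → Word n} {T : Set (Addr n)}
    {K : ℕ → Addr n → Prop} {S : Set (Addr n)} (l : List ε) (g : ε → List (Instr n))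
    (δ : ε → Addr n → ℝ)
    (hg : ∀ x ∈ l, ∀ (f : Addr n → ℝ) (s : State n), Caches (accum w T f) K S s →
      Caches (accum w T fun a => f a + δ x a) K S (run s (g x)))
    {f : Addr n → ℝ} {s : State n} (h : Caches (accum w T f) K S s) :
    Caches (accum w T fun a => f a + (l.map fun x => δ x a).sum) K S (run s (l.flatMap g)) := by
  induction l generalizing f s with
  | nil => simpa [run] using h
  | cons e l ih =>
    have h' := ih (fun x hx => hg x (List.mem_cons_of_mem _ hx)) (hg e List.mem_cons_self f s h)
    simpa only [List.map_cons, List.sum_cons, List.flatMap_cons, run_append, add_assoc] using h'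

/-- `Caches.loop` for a body that is executed conditionally. -/
theorem Caches.loop_ite {n : ℕ} {ε : Type*} {w : Addr n → Word n} {T : Set (Addr n)}
    {K : ℕ → Addr n → Prop} {S : Set (Addr n)} (l : List ε) (q : ε → Prop) [DecidablePred q]
    (g : ε → List (Instr n)) (δ : ε → Addr n → ℝ)
    (hg : ∀ x ∈ l, q x → ∀ (f : Addr n → ℝ) (s : State n), Caches (accum w T f) K S s →
      Caches (accum w T fun a => f a + δ x a) K S (run s (g x)))
    {f : Addr n → ℝ} {s : State n} (h : Caches (accum w T f) K S s) :
    Caches (accum w T fun a => f a + (l.map fun x => if q x then δ x a else 0).sum) K S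
      (run s (l.flatMap fun x => if q x then g x else [])) := by
  refine Caches.loop l _ (fun x a => if q x then δ x a else 0) (fun x hx f s hs => ?_) h
  by_cases hq : q x
  · simpa [hq] using hg x hx hq f s hs
  · simpa [hq, run] using hs

/-- Slow memory with distances `D`, local focus sizes `u` and no cohesions. -/
def baseWord {n : ℕ} (D : Fin n → Fin n → ℝ) (u : ℕ → ℕ → ℝ) : Addr n → Word n
  | .dist x y => ⟨D x y, some s(x, y)⟩
  | .coh _ _ => ⟨0, none⟩
  | .aux i j => ⟨u i j, none⟩

def auxSet (n : ℕ) : Set (Addr n) := {a | ∃ i j, a = .aux i j}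

def cohSet (n : ℕ) : Set (Addr n) := {a | ∃ x z, a = .coh x z}

@[simp] theorem dist_notMem_auxSet {n : ℕ} (x y : Fin n) : Addr.dist x y ∉ auxSet n := by
  simp [auxSet]

@[simp] theorem coh_notMem_auxSet {n : ℕ} (x y : Fin n) : Addr.coh x y ∉ auxSet n := by
  simp [auxSet]

@[simp] theorem aux_mem_auxSet {n : ℕ} (i j : ℕ) : Addr.aux i j ∈ auxSet n := ⟨i, j, rfl⟩

@[simp] theorem dist_notMem_cohSet {n : ℕ} (x y : Fin n) : Addr.dist x y ∉ cohSet n := by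
  simp [cohSet]

@[simp] theorem coh_mem_cohSet {n : ℕ} (x y : Fin n) : Addr.coh x y ∈ cohSet n := ⟨x, y, rfl⟩

@[simp] theorem aux_notMem_cohSet {n : ℕ} (i j : ℕ) : Addr.aux i j ∉ cohSet n := by
  simp [cohSet]

theorem caches_initial {n : ℕ} (D : Fin n → Fin n → ℝ) :
    Caches (baseWord D 0) (fun _ _ => False) ∅ (initial D) where
  fast _ _ h := h.elim
  slow a _ := by cases a <;> rfl

/-! ### Sums over blocks -/

theorem sum_map_range {β : Type*} [AddCommMonoid β] (N : ℕ) (F : ℕ → β) :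
    ((List.range N).map F).sum = ∑ X ∈ Finset.range N, F X := rfl

theorem sum_map_finRange {β : Type*} [AddCommMonoid β] (n : ℕ) (F : Fin n → β) :
    ((List.finRange n).map F).sum = ∑ x, F x := by
  rw [← List.sum_toFinset F (List.nodup_finRange n)]
  simp

theorem nodup_pairsOf (n b X Y : ℕ) : (pairsOf n b X Y).Nodup :=
  ((nodup_blk n b X).product (nodup_blk n b Y)).filter _

theorem nodup_triplesOf (n b X Y Z : ℕ) : (triplesOf n b X Y Z).Nodup :=
  ((nodup_blk n b X).product ((nodup_blk n b Y).product (nodup_blk n b Z))).filter _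

theorem sum_map_pairsOf {β : Type*} [AddCommMonoid β] (n b X Y : ℕ) (F : Fin n × Fin n → β) :
    ((pairsOf n b X Y).map F).sum =
      ∑ p, if (p.1.val / b = X ∧ p.2.val / b = Y) ∧ p.1 < p.2 then F p else 0 := by
  rw [← List.sum_toFinset F (nodup_pairsOf n b X Y), ← Finset.sum_filter]
  refine Finset.sum_congr ?_ fun _ _ => rfl
  ext p
  simp [mem_pairsOf]

theorem sum_map_triplesOf {β : Type*} [AddCommMonoid β] (n b X Y Z : ℕ)
    (F : Fin n × Fin n × Fin n → β) :
    ((triplesOf n b X Y Z).map F).sum =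
      ∑ t, if (t.1.val / b = X ∧ t.2.1.val / b = Y ∧ t.2.2.val / b = Z) ∧
        t.1 < t.2.1 ∧ t.2.1 < t.2.2 then F t else 0 := by
  rw [← List.sum_toFinset F (nodup_triplesOf n b X Y Z), ← Finset.sum_filter]
  refine Finset.sum_congr ?_ fun _ _ => rfl
  ext p
  simp [mem_triplesOf]

/-- Every pair `x < y` lies in exactly one pair of blocks. -/
theorem sum_blocks_pairs {β : Type*} [AddCommMonoid β] {n b : ℕ} (hb : 0 < b)
    (F : Fin n × Fin n → β) :
    ((List.range (numBlocks n b)).map fun X => ((List.range (numBlocks n b)).map fun Y =>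
      if X ≤ Y then ((pairsOf n b X Y).map F).sum else 0).sum).sum =
      ∑ p, if p.1 < p.2 then F p else 0 := by
  have h : ∀ X Y : ℕ, (if X ≤ Y then ((pairsOf n b X Y).map F).sum else 0) =
      ∑ p, if p.1.val / b = X then if p.2.val / b = Y then
        if p.1 < p.2 then F p else 0 else 0 else 0 := by
    intro X Y
    rw [sum_map_pairsOf]
    split_ifs with hXY
    · refine Finset.sum_congr rfl fun p _ => ?_
      simp only [ite_and]
    · refine (Finset.sum_eq_zero fun p _ => ?_).symm
      split_ifs with h1 h2 h3
      -- Pairs of blocks with `X > Y` contain no `x < y`, so the loop condition loses nothing.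
      · exact absurd (h1 ▸ h2 ▸ Nat.div_le_div_right (Fin.lt_def.mp h3).le) hXY
      all_goals rfl
  simp only [h]
  simp only [sum_map_range]
  simp_rw [Finset.sum_comm (s := Finset.range (numBlocks n b)) (t := Finset.univ)]
  refine Finset.sum_congr rfl fun p _ => ?_
  simp [Finset.sum_ite_eq, div_lt_numBlocks hb]

theorem sum_blocks_triples {β : Type*} [AddCommMonoid β] {n b : ℕ} (hb : 0 < b)
    (F : Fin n × Fin n × Fin n → β) :
    ((List.range (numBlocks n b)).map fun X => ((List.range (numBlocks n b)).map fun Y =>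
      if X ≤ Y then ((List.range (numBlocks n b)).map fun Z =>
        if Y ≤ Z then ((triplesOf n b X Y Z).map F).sum else 0).sum else 0).sum).sum =
      ∑ t, if t.1 < t.2.1 ∧ t.2.1 < t.2.2 then F t else 0 := by
  have h : ∀ X Y : ℕ, (if X ≤ Y then ((List.range (numBlocks n b)).map fun Z =>
      if Y ≤ Z then ((triplesOf n b X Y Z).map F).sum else 0).sum else 0) =
      ∑ Z ∈ Finset.range (numBlocks n b), ∑ t, if t.1.val / b = X then if t.2.1.val / b = Y then
        if t.2.2.val / b = Z then
        if t.1 < t.2.1 ∧ t.2.1 < t.2.2 then F t else 0 else 0 else 0 else 0 := by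
    intro X Y
    split_ifs with hXY
    · rw [sum_map_range]
      refine Finset.sum_congr rfl fun Z _ => ?_
      rw [sum_map_triplesOf]
      split_ifs with hYZ
      · refine Finset.sum_congr rfl fun p _ => ?_
        simp only [ite_and]
      · refine (Finset.sum_eq_zero fun p _ => ?_).symm
        split_ifs with h1 h2 h3 h4
        · exact absurd (h2 ▸ h3 ▸ Nat.div_le_div_right (Fin.lt_def.mp h4.2).le) hYZ
        all_goals rfl
    · refine (Finset.sum_eq_zero fun Z _ => Finset.sum_eq_zero fun p _ => ?_).symm
      split_ifs with h1 h2 h3 h4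
      · exact absurd (h1 ▸ h2 ▸ Nat.div_le_div_right (Fin.lt_def.mp h4.1).le) hXY
      all_goals rfl
  simp only [h]
  simp only [sum_map_range]
  simp_rw [Finset.sum_comm (s := Finset.range (numBlocks n b)) (t := Finset.univ)]
  refine Finset.sum_congr rfl fun p _ => ?_
  simp [Finset.sum_ite_eq, div_lt_numBlocks hb]

/-! ### Cells of fast memory -/

theorem mul_add_inj {b a c i j : ℕ} (hi : i < b) (hj : j < b) (h : a * b + i = c * b + j) :
    a = c ∧ i = j := by
  have hb : 0 < b := by omega
  have h1 := congrArg (· / b) h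
  have h2 := congrArg (· % b) h
  simp only [add_comm _ i, add_comm _ j, Nat.add_mul_div_right _ _ hb, Nat.div_eq_of_lt hi,
    Nat.div_eq_of_lt hj, zero_add, Nat.add_mul_mod_self_right, Nat.mod_eq_of_lt hi,
    Nat.mod_eq_of_lt hj] at h1 h2
  exact ⟨h1, h2⟩

/-- The cell number is an expansion to base `b`, with the two remainders as lower digits and `k` on
top. -/
theorem cell_inj {n b k k' : ℕ} (hb : 0 < b) {x y x' y' : Fin n}
    (h : cell b k x y = cell b k' x' y') :
    k = k' ∧ x.val % b = x'.val % b ∧ y.val % b = y'.val % b := by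
  obtain ⟨h1, h2⟩ := mul_add_inj (Nat.mod_lt _ hb) (Nat.mod_lt _ hb) h
  obtain ⟨h3, h4⟩ := mul_add_inj (Nat.mod_lt _ hb) (Nat.mod_lt _ hb) h1
  exact ⟨h3, h4, h2⟩

theorem vec_inj {n b k k' : ℕ} (hb : 0 < b) {x x' : Fin n} (h : vec b k x = vec b k' x') :
    k = k' ∧ x.val % b = x'.val % b := by
  unfold vec at h
  exact mul_add_inj (Nat.mod_lt _ hb) (Nat.mod_lt _ hb) (by omega)

theorem cell_ne_vec {n b k k' : ℕ} (hb : 0 < b) (hk : k < 2) (x y z : Fin n) :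
    cell b k x y ≠ vec b k' z := by
  have := cell_lt hb hk x y
  unfold vec
  omega

theorem fin_eq_of_div_mod {n b : ℕ} {x y : Fin n} (h1 : x.val / b = y.val / b)
    (h2 : x.val % b = y.val % b) : x = y := by
  have e1 := Nat.div_add_mod x.val b
  have e2 := Nat.div_add_mod y.val b
  rw [h1, h2] at e1
  exact Fin.ext (e1.symm.trans e2)

theorem pairsOf_eq_of_mod {n b X Y : ℕ} {p q : Fin n × Fin n} (hp : p ∈ pairsOf n b X Y)
    (hq : q ∈ pairsOf n b X Y) (h1 : p.1.val % b = q.1.val % b)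
    (h2 : p.2.val % b = q.2.val % b) : p = q := by
  obtain ⟨⟨a1, a2⟩, -⟩ := mem_pairsOf.mp hp
  obtain ⟨⟨b1, b2⟩, -⟩ := mem_pairsOf.mp hq
  exact Prod.ext (fin_eq_of_div_mod (a1.trans b1.symm) h1)
    (fin_eq_of_div_mod (a2.trans b2.symm) h2)

/-! ### Values computed by the pairwise algorithm -/

theorem focusSize_comm {n : ℕ} {D : Fin n → Fin n → ℝ} (hD : IsDistance D) (x y : Fin n) :
    focusSize D x y = focusSize D y x := by
  unfold focusSize
  rw [hD.symm y x]
  simp only [or_comm]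

/-- Without ties, the strict comparisons select the local focus. -/
theorem inFocus_eq {n : ℕ} {D : Fin n → Fin n → ℝ} (hD : IsDistance D) (hT : TieFree D)
    {x y : Fin n} (hxy : x ≠ y) (z : Fin n) :
    inFocus (D x y) (D x z) (D y z) = if D x z ≤ D x y ∨ D y z ≤ D x y then 1 else 0 := by
  unfold inFocus
  have hpos := hD.pos x y hxy
  by_cases hzx : x = z
  · subst hzx
    simp [hD.self, hpos, hpos.le]
  by_cases hzy : y = z
  · subst hzy
    simp [hD.self, hpos]
  have h1 : D x z ≠ D x y := hT x z y hzx hxy (Ne.symm hzy)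
  have h2 : D y z ≠ D x y := by
    rw [hD.symm x y]
    exact hT y z x hzy hxy.symm (Ne.symm hzx)
  simp only [h1.le_iff_lt, h2.le_iff_lt]

theorem sum_inFocus {n : ℕ} {D : Fin n → Fin n → ℝ} (hD : IsDistance D) (hT : TieFree D)
    {x y : Fin n} (hxy : x ≠ y) :
    ∑ z, inFocus (D x y) (D x z) (D y z) = focusSize D x y := by
  simp only [inFocus_eq hD hT hxy, focusSize, Finset.sum_boole]

/-- If `d_xz < d_yz`, then `d_yz < d_xy` would also give `d_xz < d_xy`; so membership in the focus
reduces to the single comparison in `g_xyz`. For `z = y` both sides vanish. -/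
theorem inFocus_mul_closer {n : ℕ} {D : Fin n → Fin n → ℝ} (hD : IsDistance D) (hT : TieFree D)
    {x y z : Fin n} (hxy : x ≠ y) (hxz : x ≠ z) :
    inFocus (D x y) (D x z) (D y z) * closer (D x z) (D y z) * (1 / focusSize D x y) =
      gVal (D x y) (D y z) (D x z, focusSize D x y) := by
  have hpos := hD.pos x z hxz
  by_cases hzy : y = z
  · subst hzy
    simp [closer, gVal, hD.self, hpos.not_gt, hpos.not_ge]
  have h1 : D x z ≠ D x y := hT x z y hxz hxy (Ne.symm hzy)
  have h3 : D x z ≠ D y z := by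
    rw [hD.symm x z, hD.symm y z]
    exact hT z x y (Ne.symm hxz) (Ne.symm hzy) hxy
  simp only [inFocus, closer, gVal, h1.le_iff_lt, h3.le_iff_lt]
  by_cases c1 : D x z < D y z
  · by_cases c2 : D x z < D x y
    · simp [c1, c2]
    · have c3 : ¬ D y z < D x y := fun h => c2 (c1.trans h)
      simp [c1, c2, c3]
  · simp [c1]

/-- The algorithm visits a pair in increasing order only. When `x` is the larger point, its share
comes from the complementary update, since without ties "not closer to `y`" means "closer to `x`".
-/
theorem inFocus_mul_not_closer {n : ℕ} {D : Fin n → Fin n → ℝ} (hD : IsDistance D)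
    (hT : TieFree D) {x y z : Fin n} (hxy : x ≠ y) (hxz : x ≠ z) :
    inFocus (D y x) (D y z) (D x z) * (1 - closer (D y z) (D x z)) * (1 / focusSize D y x) =
      gVal (D x y) (D y z) (D x z, focusSize D x y) := by
  rw [← inFocus_mul_closer hD hT hxy hxz, focusSize_comm hD y x, hD.symm y x]
  have hpos := hD.pos x z hxz
  have h3 : D x z ≠ D y z := by
    by_cases hzy : y = z
    · subst hzy
      rw [hD.self]
      exact hpos.ne'
    · rw [hD.symm x z, hD.symm y z]
      exact hT z x y (Ne.symm hxz) (Ne.symm hzy) hxy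
  have h4 : 1 - closer (D y z) (D x z) = closer (D x z) (D y z) := by
    unfold closer
    rcases h3.lt_or_gt with h | h
    · simp [h, h.not_gt]
    · simp [h, h.not_gt]
  rw [h4]
  simp only [inFocus, or_comm]

theorem smul_cohesion {n : ℕ} (D : Fin n → Fin n → ℝ) {x z : Fin n} (hxz : x ≠ z) :
    ((n : ℝ) - 1) * cohesion D x z = ∑ y, gVal (D x y) (D y z) (D x z, focusSize D x y) := by
  have hn : (n : ℝ) - 1 ≠ 0 := by
    intro h
    have h1 : n = 1 := by exact_mod_cast sub_eq_zero.mp h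
    subst h1
    exact hxz (Subsingleton.elim _ _)
  rw [cohesion, ← mul_assoc, mul_one_div_cancel hn, one_mul]

/-- The local focus sizes as contents of the auxiliary space. -/
noncomputable def focusFun {n : ℕ} (D : Fin n → Fin n → ℝ) (i j : ℕ) : ℝ :=
  if h : i < n ∧ j < n then focusSize D ⟨i, h.1⟩ ⟨j, h.2⟩ else 0

@[simp] theorem focusFun_val {n : ℕ} (D : Fin n → Fin n → ℝ) (x y : Fin n) :
    focusFun D x.val y.val = focusSize D x y := by
  simp [focusFun]

theorem sum_map_sum {ε : Type*} (l : List ε) {n : ℕ} (F : ε → Fin n → ℝ) :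
    ((List.finRange n).map fun z => (l.map fun e => F e z).sum).sum =
      (l.map fun e => ∑ z, F e z).sum := by
  rw [sum_map_finRange]
  induction l with
  | nil => simp
  | cons e l ih => simp [Finset.sum_add_distrib, ih]

/-! ### Fast memory during the pairwise algorithm -/

/-- The points of the blocks `X`, `Y` with the numbers of their vectors. -/
def vecList (n b X Y : ℕ) : List (ℕ × Fin n) :=
  ((blk n b X).map fun x => (0, x)) ++ if X = Y then [] else (blk n b Y).map fun y => (1, y)

theorem mem_vecList {n b X Y : ℕ} {e : ℕ × Fin n} :
    e ∈ vecList n b X Y ↔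
      (e.1 = 0 ∧ e.2.val / b = X) ∨ (X ≠ Y ∧ e.1 = 1 ∧ e.2.val / b = Y) := by
  obtain ⟨k, x⟩ := e
  unfold vecList
  split_ifs with h
  · simp [h, mem_blk, eq_comm, and_comm]
  · simp [h, mem_blk, eq_comm, and_comm]

theorem vecList_eq_of_vec {n b k X Y : ℕ} (hb : 0 < b) {e e' : ℕ × Fin n}
    (he : e ∈ vecList n b X Y) (he' : e' ∈ vecList n b X Y)
    (h : vec b (k + e.1) e.2 = vec b (k + e'.1) e'.2) : e = e' := by
  obtain ⟨h1, h2⟩ := vec_inj hb h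
  have h1' : e.1 = e'.1 := by omega
  refine Prod.ext h1' (fin_eq_of_div_mod ?_ h2)
  rcases mem_vecList.mp he with h | h <;> rcases mem_vecList.mp he' with h' | h' <;> omega

/-- Distinct blocks are disjoint, and for `X = Y` only one vector is listed; so no cohesion is
cached twice. -/
theorem vecList_eq_of_snd {n b X Y : ℕ} {e e' : ℕ × Fin n}
    (he : e ∈ vecList n b X Y) (he' : e' ∈ vecList n b X Y) (h : e.2 = e'.2) : e = e' := by
  refine Prod.ext ?_ h
  rw [mem_vecList, h] at he
  rw [mem_vecList] at he'
  omega

theorem fst_mem_vecList {n b X Y : ℕ} {p : Fin n × Fin n} (hp : p ∈ pairsOf n b X Y) :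
    (0, p.1) ∈ vecList n b X Y :=
  mem_vecList.mpr (Or.inl ⟨rfl, (mem_pairsOf.mp hp).1.1⟩)

theorem snd_mem_vecList {n b X Y : ℕ} {p : Fin n × Fin n} (hp : p ∈ pairsOf n b X Y) :
    (if X = Y then 0 else 1, p.2) ∈ vecList n b X Y := by
  have := (mem_pairsOf.mp hp).1.2
  rw [mem_vecList]
  split_ifs with h
  · exact Or.inl ⟨rfl, this.trans h.symm⟩
  · exact Or.inr ⟨h, rfl, this⟩

theorem readVecs_eq {n : ℕ} (A : Fin n → Fin n → Addr n) (b k X Y : ℕ) (z : Fin n) :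
    readVecs A b k (k + 1) X Y z =
      (vecList n b X Y).map fun e => .read (A e.2 z) (vec b (k + e.1) e.2) := by
  unfold readVecs vecList
  split_ifs <;> simp [Function.comp_def]

theorem writeVecs_eq {n : ℕ} (A : Fin n → Fin n → Addr n) (b k X Y : ℕ) (z : Fin n) :
    writeVecs A b k (k + 1) X Y z =
      (vecList n b X Y).map fun e => .write (vec b (k + e.1) e.2) (A e.2 z) := by
  unfold writeVecs vecList
  split_ifs <;> simp [Function.comp_def]

/-- Fast memory holds `D_XY` and `U_XY`. -/
def pairCells (n b X Y r : ℕ) (a : Addr n) : Prop :=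
  ∃ p ∈ pairsOf n b X Y, (r = cell b 0 p.1 p.2 ∧ a = .dist p.1 p.2) ∨
    (r = cell b 1 p.1 p.2 ∧ a = focusAddr p.1 p.2)

/-- In addition, fast memory holds `D_Xz` and `D_Yz`. -/
def distCells (n b X Y : ℕ) (z : Fin n) (r : ℕ) (a : Addr n) : Prop :=
  pairCells n b X Y r a ∨ ∃ e ∈ vecList n b X Y, r = vec b (0 + e.1) e.2 ∧ a = .dist e.2 z

/-- In addition, fast memory holds `C_Xz` and `C_Yz`. -/
def cohCells (n b X Y : ℕ) (z : Fin n) (r : ℕ) (a : Addr n) : Prop :=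
  distCells n b X Y z r a ∨ ∃ e ∈ vecList n b X Y, r = vec b (2 + e.1) e.2 ∧ a = .coh e.2 z

theorem pairCells_ne_vec {n b X Y k r : ℕ} {a : Addr n} (hb : 0 < b)
    (h : pairCells n b X Y r a) (x : Fin n) : vec b k x ≠ r := by
  obtain ⟨p, -, ⟨rfl, -⟩ | ⟨rfl, -⟩⟩ := h
  · exact (cell_ne_vec hb (by norm_num) _ _ _).symm
  · exact (cell_ne_vec hb (by norm_num) _ _ _).symm

theorem caches_readVecs_dist {n b X Y : ℕ} (hb : 0 < b) (z : Fin n) {w : Addr n → Word n}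
    {s : State n} (h : Caches w (pairCells n b X Y) (auxSet n) s) :
    Caches w (distCells n b X Y z) (auxSet n) (run s (readVecs .dist b 0 1 X Y z)) := by
  rw [readVecs_eq .dist b 0 X Y z]
  refine h.reads (vecList n b X Y) (fun e => vec b (0 + e.1) e.2) (fun e => .dist e.2 z)
    (by simp) ?_ ?_
  · intro e he e' he' hee
    rw [vecList_eq_of_vec hb he he' hee]
  · rintro r a (h | h)
    · exact Or.inr ⟨h, fun e _ => pairCells_ne_vec hb h e.2⟩
    · exact Or.inl h

theorem caches_readVecs_coh {n b X Y : ℕ} (hb : 0 < b) (z : Fin n) {w : Addr n → Word n}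
    {s : State n} (h : Caches w (distCells n b X Y z) (auxSet n) s) :
    Caches w (cohCells n b X Y z) (auxSet n) (run s (readVecs .coh b 2 3 X Y z)) := by
  rw [readVecs_eq .coh b 2 X Y z]
  refine h.reads (vecList n b X Y) (fun e => vec b (2 + e.1) e.2) (fun e => .coh e.2 z)
    (by simp) ?_ ?_
  · intro e he e' he' hee
    rw [vecList_eq_of_vec hb he he' hee]
  · rintro r a ((h | ⟨e', he', rfl, rfl⟩) | h)
    · exact Or.inr ⟨Or.inl h, fun e _ => pairCells_ne_vec hb h e.2⟩
    · refine Or.inr ⟨Or.inr ⟨e', he', rfl, rfl⟩, fun e he hee => ?_⟩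
      have h1 := (vec_inj hb hee).1
      rcases mem_vecList.mp he' with h' | h' <;> omega
    · exact Or.inl h

@[simp] theorem focusAddr_mem_auxSet {n : ℕ} (x y : Fin n) : focusAddr x y ∈ auxSet n :=
  aux_mem_auxSet _ _

/-- The contribution of a point `z` to the focus size of the pair `p`. -/
noncomputable def focusContrib {n : ℕ} (D : Fin n → Fin n → ℝ) (p : Fin n × Fin n) (z : Fin n) :
    ℝ :=
  inFocus (D p.1 p.2) (D p.1 z) (D p.2 z)

open Classical in
-- The focus sizes live in fast memory only. They are treated as caches of auxiliary addresses, all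
-- of which are declared stale for the whole algorithm.
theorem caches_focusLoop {n b X Y : ℕ} (hb : 0 < b) {D : Fin n → Fin n → ℝ} {w : Addr n → Word n}
    (hw : ∀ x y, w (.dist x y) = ⟨D x y, some s(x, y)⟩) (z : Fin n) {f : Addr n → ℝ} {s : State n}
    (h : Caches (accum w (auxSet n) f) (pairCells n b X Y) (auxSet n) s) :
    Caches (accum w (auxSet n) fun a => f a + ((pairsOf n b X Y).map fun p =>
        if a = focusAddr p.1 p.2 then focusContrib D p z else 0).sum)
      (pairCells n b X Y) (auxSet n)
      (run s (readVecs .dist b 0 1 X Y z ++ (pairsOf n b X Y).map fun p =>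
        .op 4 ![cell b 1 p.1 p.2, cell b 0 p.1 p.2, vec b 0 p.1,
            vec b (if X = Y then 0 else 1) p.2]
          (fun v => v 0 + inFocus (v 1) (v 2) (v 3)) (cell b 1 p.1 p.2))) := by
  rw [run_append]
  refine Caches.mono (Caches.accumulate (K := distCells n b X Y z) (pairsOf n b X Y) _
    (fun p => cell b 1 p.1 p.2) (fun p => focusAddr p.1 p.2) (fun p => focusContrib D p z)
    (fun _ _ => aux_mem_auxSet _ _) (fun _ _ => aux_mem_auxSet _ _) ?_ ?_
    (caches_readVecs_dist hb z h)) (fun r a hra => ⟨Or.inl hra, rfl⟩) (fun a ha => ⟨ha, rfl⟩)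
  · rintro p hp r a (⟨q, hq, ⟨rfl, rfl⟩ | ⟨rfl, rfl⟩⟩ | ⟨e, he, rfl, rfl⟩)
    · refine ⟨fun h => ?_, fun h => by simp [focusAddr] at h⟩
      have := (cell_inj hb h).1
      omega
    · constructor
      · intro h
        obtain ⟨-, h1, h2⟩ := cell_inj hb h
        rw [pairsOf_eq_of_mod hq hp h1 h2]
      · intro h
        simp only [focusAddr, Addr.aux.injEq, Fin.val_inj] at h
        rw [h.1, h.2]
    · refine ⟨fun h => absurd h.symm (cell_ne_vec hb (by norm_num) _ _ _), fun h => ?_⟩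
      simp [focusAddr] at h
  · intro p hp f' s' hs'
    have e1 := hs'.fast (cell b 1 p.1 p.2) (focusAddr p.1 p.2)
      (Or.inl ⟨p, hp, Or.inr ⟨rfl, rfl⟩⟩)
    have e2 := hs'.fast (cell b 0 p.1 p.2) (.dist p.1 p.2) (Or.inl ⟨p, hp, Or.inl ⟨rfl, rfl⟩⟩)
    have e3 := hs'.fast (vec b (0 + 0) p.1) (.dist p.1 z) (Or.inr ⟨_, fst_mem_vecList hp, rfl, rfl⟩)
    have e4 := hs'.fast (vec b (0 + if X = Y then 0 else 1) p.2) (.dist p.2 z)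
      (Or.inr ⟨_, snd_mem_vecList hp, rfl, rfl⟩)
    rw [accum_of_mem (focusAddr_mem_auxSet _ _)] at e1
    rw [accum_of_notMem (dist_notMem_auxSet _ _), hw] at e2 e3 e4
    rw [zero_add] at e3 e4
    simp [Instr.exec, e1, e2, e3, e4, focusContrib]

/-- The two updates of cohesions by a pair. -/
noncomputable def pairInstr {n : ℕ} (b sY : ℕ) (e : Bool × Fin n × Fin n) : Instr n :=
  match e with
  | (true, p) =>
    .op 5 ![vec b 2 p.1, cell b 1 p.1 p.2, cell b 0 p.1 p.2, vec b 0 p.1, vec b sY p.2]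
        (fun v => v 0 + inFocus (v 2) (v 3) (v 4) * closer (v 3) (v 4) * (1 / v 1))
        (vec b 2 p.1)
  | (false, p) =>
    .op 5 ![vec b (2 + sY) p.2, cell b 1 p.1 p.2, cell b 0 p.1 p.2, vec b 0 p.1, vec b sY p.2]
        (fun v => v 0 + inFocus (v 2) (v 3) (v 4) * (1 - closer (v 3) (v 4)) * (1 / v 1))
        (vec b (2 + sY) p.2)

def pairItems (n b X Y : ℕ) : List (Bool × Fin n × Fin n) :=
  (pairsOf n b X Y).flatMap fun p => [(true, p), (false, p)]

theorem mem_pairItems {n b X Y : ℕ} {e : Bool × Fin n × Fin n} :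
    e ∈ pairItems n b X Y ↔ e.2 ∈ pairsOf n b X Y := by
  obtain ⟨i, p⟩ := e
  cases i <;> simp [pairItems]

/-- The updated vector and point. -/
def pairTarget {n : ℕ} (sY : ℕ) (e : Bool × Fin n × Fin n) : ℕ × Fin n :=
  match e with
  | (true, p) => (0, p.1)
  | (false, p) => (sY, p.2)

theorem pairTarget_mem {n b X Y : ℕ} {e : Bool × Fin n × Fin n} (he : e ∈ pairItems n b X Y) :
    pairTarget (if X = Y then 0 else 1) e ∈ vecList n b X Y := by
  obtain ⟨i, p⟩ := e
  have hp := mem_pairItems.mp he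
  cases i
  · exact snd_mem_vecList hp
  · exact fst_mem_vecList hp

noncomputable def pairContrib {n : ℕ} (D : Fin n → Fin n → ℝ) (e : Bool × Fin n × Fin n)
    (z : Fin n) : ℝ :=
  match e with
  | (true, p) => inFocus (D p.1 p.2) (D p.1 z) (D p.2 z) * closer (D p.1 z) (D p.2 z) *
      (1 / focusSize D p.1 p.2)
  | (false, p) => inFocus (D p.1 p.2) (D p.1 z) (D p.2 z) * (1 - closer (D p.1 z) (D p.2 z)) *
      (1 / focusSize D p.1 p.2)

open Classical in
theorem caches_cohesionLoop {n b X Y : ℕ} (hb : 0 < b) {D : Fin n → Fin n → ℝ} (z : Fin n)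
    {f : Addr n → ℝ} {s : State n}
    (h : Caches (accum (baseWord D (focusFun D)) (cohSet n) f) (pairCells n b X Y) (auxSet n) s) :
    Caches (accum (baseWord D (focusFun D)) (cohSet n) fun a => f a +
        ((pairItems n b X Y).map fun e =>
          if a = .coh (pairTarget (if X = Y then 0 else 1) e).2 z then pairContrib D e z
          else 0).sum)
      (pairCells n b X Y) (auxSet n)
      (run s (readVecs .dist b 0 1 X Y z ++ readVecs .coh b 2 3 X Y z ++
        (pairItems n b X Y).map (pairInstr b (if X = Y then 0 else 1)) ++
        writeVecs .coh b 2 3 X Y z)) := by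
  set sY := if X = Y then 0 else 1 with hsY
  -- While the pairs are processed, the cohesions in the loaded vectors are stale as well; the final
  -- writes repair exactly these.
  let S : Set (Addr n) := auxSet n ∪ {a | ∃ e ∈ vecList n b X Y, a = .coh e.2 z}
  rw [run_append, run_append, run_append, writeVecs_eq .coh b 2 X Y z]
  have h1 := (caches_readVecs_coh hb z (caches_readVecs_dist hb z h)).mono (S' := S)
    (fun r a hra => ⟨hra, rfl⟩) (fun a ha => ⟨fun ha' => ha (Or.inl ha'), rfl⟩)
  have h2 := Caches.accumulate (pairItems n b X Y) (pairInstr b sY)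
    (fun e => vec b (2 + (pairTarget sY e).1) (pairTarget sY e).2)
    (fun e => .coh (pairTarget sY e).2 z) (fun e => pairContrib D e z)
    (fun _ _ => coh_mem_cohSet _ _) (fun e he => Or.inr ⟨_, pairTarget_mem he, rfl⟩) ?_ ?_ h1
  · have h3 := h2.writes (S' := auxSet n) (vecList n b X Y) (fun e => vec b (2 + e.1) e.2)
      (fun e => .coh e.2 z) (fun e he => Or.inr ⟨e, he, rfl, rfl⟩) (fun a ha => ?_)
    · exact h3.mono (fun r a hra => ⟨Or.inl (Or.inl hra), rfl⟩) (fun a ha => ⟨ha, rfl⟩)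
    · by_cases haS : a ∈ S
      · rcases haS with h' | h'
        · exact absurd h' ha
        · exact Or.inr h'
      · exact Or.inl haS
  · intro e he r a hra
    have ht := pairTarget_mem he
    rw [← hsY] at ht
    rcases hra with (hra | ⟨e', he', rfl, rfl⟩) | ⟨e', he', rfl, rfl⟩
    · refine ⟨fun h => absurd h.symm (pairCells_ne_vec hb hra _), fun h => ?_⟩
      obtain ⟨p, -, ⟨-, rfl⟩ | ⟨-, rfl⟩⟩ := hra
      · simp at h
      · simp [focusAddr] at h
    · refine ⟨fun h => ?_, fun h => by simp at h⟩
      have h1 := (vec_inj hb h).1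
      rcases mem_vecList.mp he' with h' | h' <;> omega
    · constructor
      · intro h
        rw [vecList_eq_of_vec hb he' ht h]
      · intro h
        rw [vecList_eq_of_snd he' ht (by simpa using h)]
  · rintro ⟨i, p⟩ he f' s' hs'
    have hp : p ∈ pairsOf n b X Y := mem_pairItems.mp he
    have e1 := hs'.fast (cell b 1 p.1 p.2) (focusAddr p.1 p.2)
      (Or.inl (Or.inl ⟨p, hp, Or.inr ⟨rfl, rfl⟩⟩))
    have e2 := hs'.fast (cell b 0 p.1 p.2) (.dist p.1 p.2)
      (Or.inl (Or.inl ⟨p, hp, Or.inl ⟨rfl, rfl⟩⟩))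
    have e3 := hs'.fast (vec b (0 + 0) p.1) (.dist p.1 z)
      (Or.inl (Or.inr ⟨_, fst_mem_vecList hp, rfl, rfl⟩))
    have e4 := hs'.fast (vec b (0 + sY) p.2) (.dist p.2 z)
      (Or.inl (Or.inr ⟨_, snd_mem_vecList hp, rfl, rfl⟩))
    have e5 := hs'.fast _ (.coh (pairTarget sY (i, p)).2 z)
      (Or.inr ⟨_, pairTarget_mem he, rfl, rfl⟩)
    rw [accum_of_notMem (by simp [focusAddr])] at e1
    rw [accum_of_notMem (dist_notMem_cohSet _ _)] at e2 e3 e4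
    rw [accum_of_mem (coh_mem_cohSet _ _), ← hsY] at e5
    rw [zero_add] at e3 e4
    cases i <;> simp only [pairTarget, add_zero] at e5 <;>
      simp [Instr.exec, pairInstr, pairTarget, pairContrib, e1, e2, e3, e4, e5, baseWord, focusAddr]

/-! ### Correctness of the pairwise algorithm -/

theorem pairwiseBlock_eq (n b X Y : ℕ) :
    pairwiseBlock n b X Y =
      ((pairsOf n b X Y).map fun p => .read (.dist p.1 p.2) (cell b 0 p.1 p.2)) ++
      ((pairsOf n b X Y).map fun p => .op 0 ![] (fun _ => 0) (cell b 1 p.1 p.2)) ++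
      ((List.finRange n).flatMap fun z =>
        readVecs .dist b 0 1 X Y z ++ (pairsOf n b X Y).map fun p =>
          .op 4 ![cell b 1 p.1 p.2, cell b 0 p.1 p.2, vec b 0 p.1,
              vec b (if X = Y then 0 else 1) p.2]
            (fun v => v 0 + inFocus (v 1) (v 2) (v 3)) (cell b 1 p.1 p.2)) ++
      ((List.finRange n).flatMap fun z =>
        readVecs .dist b 0 1 X Y z ++ readVecs .coh b 2 3 X Y z ++
        (pairItems n b X Y).map (pairInstr b (if X = Y then 0 else 1)) ++
        writeVecs .coh b 2 3 X Y z) := by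
  simp only [pairItems, List.map_flatMap, List.map_cons, List.map_nil]
  rfl

/-- Zeroing the focus sizes counts as loading them, because the fictitious auxiliary contents are
zero. -/
theorem caches_pairInit {n b X Y : ℕ} (hb : 0 < b) {D : Fin n → Fin n → ℝ} {f : Addr n → ℝ}
    {s : State n}
    (h : Caches (accum (baseWord D 0) (cohSet n) f) (fun _ _ => False) (auxSet n) s) :
    Caches (accum (accum (baseWord D 0) (cohSet n) f) (auxSet n) fun _ => 0) (pairCells n b X Y)
      (auxSet n)
      (run s (((pairsOf n b X Y).map fun p => .read (.dist p.1 p.2) (cell b 0 p.1 p.2)) ++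
        ((pairsOf n b X Y).map fun p => .op 0 ![] (fun _ => 0) (cell b 1 p.1 p.2)))) := by
  have hw : ∀ a, accum (baseWord D 0) (cohSet n) f a =
      accum (accum (baseWord D 0) (cohSet n) f) (auxSet n) (fun _ => 0) a := by
    intro a
    by_cases ha : a ∈ auxSet n
    · obtain ⟨i, j, rfl⟩ := ha
      rw [accum_of_mem (aux_mem_auxSet _ _), accum_of_notMem (aux_notMem_cohSet _ _)]
      rfl
    · rw [accum_of_notMem ha]
  rw [run_append]
  have h1 := h.reads
    (K' := fun r a => ∃ p ∈ pairsOf n b X Y, r = cell b 0 p.1 p.2 ∧ a = .dist p.1 p.2)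
    (pairsOf n b X Y) (fun p => cell b 0 p.1 p.2) (fun p => .dist p.1 p.2)
    (by simp) (fun p hp q hq hpq => by
      obtain ⟨-, e1, e2⟩ := cell_inj hb hpq
      rw [pairsOf_eq_of_mod hp hq e1 e2]) (fun r a hra => Or.inl hra)
  refine Caches.mono (h1.fill (K' := pairCells n b X Y) (pairsOf n b X Y)
    (fun p => cell b 1 p.1 p.2) (fun p => focusAddr p.1 p.2) _ ?_ ?_ ?_)
    (fun r a hra => ⟨hra, hw a⟩) (fun a ha => ⟨ha, hw a⟩)
  · intro p _ s' _
    rw [accum_of_notMem (by simp [focusAddr])]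
    rfl
  · intro p hp q hq hpq
    obtain ⟨-, e1, e2⟩ := cell_inj hb hpq
    rw [pairsOf_eq_of_mod hp hq e1 e2]
  · rintro r a ⟨p, hp, ⟨rfl, rfl⟩ | ⟨rfl, rfl⟩⟩
    · refine Or.inr ⟨⟨p, hp, rfl, rfl⟩, fun q _ hq => ?_⟩
      have := (cell_inj hb hq).1
      omega
    · exact Or.inl ⟨p, hp, rfl, rfl⟩

open Classical in
theorem sum_focusContrib {n b X Y : ℕ} {D : Fin n → Fin n → ℝ} (hD : IsDistance D)
    (hT : TieFree D) {p : Fin n × Fin n} (hp : p ∈ pairsOf n b X Y) :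
    ((List.finRange n).map fun z => ((pairsOf n b X Y).map fun q =>
      if focusAddr p.1 p.2 = focusAddr q.1 q.2 then focusContrib D q z else 0).sum).sum =
      focusSize D p.1 p.2 := by
  rw [sum_map_sum, sum_map_pairsOf, Finset.sum_eq_single p]
  · rw [if_pos (mem_pairsOf.mp hp), ← sum_inFocus hD hT (mem_pairsOf.mp hp).2.ne]
    simp [focusContrib]
  · intro q _ hq
    rw [ite_eq_right_iff]
    refine fun _ => Finset.sum_eq_zero fun z _ => if_neg fun h => hq ?_
    simp only [focusAddr, Addr.aux.injEq, Fin.val_inj] at h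
    exact Prod.ext h.1.symm h.2.symm
  · simp

/-- The point whose cohesion is updated. -/
def pairPoint {n : ℕ} (e : Bool × Fin n × Fin n) : Fin n :=
  match e with
  | (true, p) => p.1
  | (false, p) => p.2

theorem pairTarget_snd {n : ℕ} (k : ℕ) (e : Bool × Fin n × Fin n) :
    (pairTarget k e).2 = pairPoint e := by
  obtain ⟨i, p⟩ := e
  cases i <;> rfl

open Classical in
-- Nothing is cached before or after the block, so the local focus sizes can be forgotten and only
-- the increments of the cohesions survive.
theorem caches_pairwiseBlock {n b X Y : ℕ} (hb : 0 < b) {D : Fin n → Fin n → ℝ}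
    (hD : IsDistance D) (hT : TieFree D) {f : Addr n → ℝ} {s : State n}
    (h : Caches (accum (baseWord D 0) (cohSet n) f) (fun _ _ => False) (auxSet n) s) :
    Caches (accum (baseWord D 0) (cohSet n) fun a => f a + ((pairItems n b X Y).map fun e =>
        ∑ z, if a = .coh (pairPoint e) z then pairContrib D e z else 0).sum)
      (fun _ _ => False) (auxSet n) (run s (pairwiseBlock n b X Y)) := by
  rw [pairwiseBlock_eq, run_append, run_append]
  have h1 := Caches.loop (List.finRange n) _ _
    (fun z _ f' s' hs' => caches_focusLoop hb (D := D)
      (fun x y => accum_of_notMem (dist_notMem_cohSet _ _)) z hs')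
    (caches_pairInit (X := X) (Y := Y) hb h)
  -- After the first loop the cached focus sizes are correct. The auxiliary contents may therefore
  -- be replaced by the true ones everywhere, since the uncached ones are stale anyway.
  have h2 := Caches.mono (w' := accum (baseWord D (focusFun D)) (cohSet n) f)
    (K' := pairCells n b X Y) (S' := auxSet n) h1 (fun r a hra => ⟨hra, ?_⟩)
    (fun a ha => ⟨ha, ?_⟩)
  · have h3 := Caches.loop (List.finRange n) _ _
      (fun z _ f' s' hs' => caches_cohesionLoop hb z hs') h2
    refine h3.mono (fun r a hra => hra.elim) (fun a ha => ⟨ha, ?_⟩)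
    simp only [pairTarget_snd, sum_map_sum]
    cases a with
    | dist x y => rfl
    | coh x y => rw [accum_of_mem (coh_mem_cohSet _ _), accum_of_mem (coh_mem_cohSet _ _)]
    | aux i j => exact absurd (aux_mem_auxSet i j) ha
  · obtain ⟨p, hp, ⟨-, rfl⟩ | ⟨-, rfl⟩⟩ := hra
    · rw [accum_of_notMem (dist_notMem_auxSet _ _), accum_of_notMem (dist_notMem_cohSet _ _),
        accum_of_notMem (dist_notMem_cohSet _ _)]
      rfl
    · rw [accum_of_mem (focusAddr_mem_auxSet _ _), sum_focusContrib hD hT hp, zero_add,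
        accum_of_notMem (by simp [focusAddr])]
      simp [focusAddr, baseWord]
  · rw [accum_of_notMem ha]
    cases a with
    | dist x y => rfl
    | coh x y => rw [accum_of_mem (coh_mem_cohSet _ _), accum_of_mem (coh_mem_cohSet _ _)]
    | aux i j => exact absurd (aux_mem_auxSet i j) ha

open Classical in
-- The pairs that update `c_xz` contain `x` either as smaller or as larger point; together they run
-- through all `y ≠ x`, and the term `y = x` of the definition is zero.
theorem sum_pairContrib {n : ℕ} {D : Fin n → Fin n → ℝ}
    (hD : IsDistance D) (hT : TieFree D) {x z : Fin n} (hxz : x ≠ z) :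
    (∑ p : Fin n × Fin n, if p.1 < p.2 then
      ∑ z', ((if Addr.coh x z = .coh p.1 z' then pairContrib D (true, p) z' else 0) +
        (if Addr.coh x z = .coh p.2 z' then pairContrib D (false, p) z' else 0)) else 0) =
      ((n : ℝ) - 1) * cohesion D x z := by
  have h : ∀ p : Fin n × Fin n, (if p.1 < p.2 then
      ∑ z', ((if Addr.coh x z = .coh p.1 z' then pairContrib D (true, p) z' else 0) +
        (if Addr.coh x z = .coh p.2 z' then pairContrib D (false, p) z' else 0)) else 0) =
      (if x = p.1 then if x < p.2 then pairContrib D (true, x, p.2) z else 0 else 0) +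
      (if x = p.2 then if p.1 < x then pairContrib D (false, p.1, x) z else 0 else 0) := by
    rintro ⟨p, q⟩
    by_cases h1 : x = p <;> by_cases h2 : x = q
    · subst h1 h2
      simp
    · subst h1
      simp [h2]
    · subst h2
      simp [h1]
    · simp [h1, h2]
  rw [smul_cohesion D hxz, Finset.sum_congr rfl fun p _ => h p, Finset.sum_add_distrib,
    Fintype.sum_prod_type, Fintype.sum_prod_type_right]
  simp only [Finset.sum_ite_irrel, Finset.sum_const_zero, Finset.sum_ite_eq, Finset.mem_univ,
    if_true]
  rw [← Finset.sum_add_distrib]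
  refine Finset.sum_congr rfl fun y _ => ?_
  rcases lt_trichotomy x y with hxy | rfl | hxy
  · simp [hxy, hxy.not_gt, pairContrib, ← inFocus_mul_closer hD hT hxy.ne hxz]
  · simp [gVal_self_left hD hxz]
  · simp [hxy, hxy.not_gt, pairContrib, ← inFocus_mul_not_closer hD hT hxy.ne' hxz]

theorem caches_accum_initial {n : ℕ} (D : Fin n → Fin n → ℝ) :
    Caches (accum (baseWord D 0) (cohSet n) fun _ => 0) (fun _ _ => False) (auxSet n)
      (initial D) := by
  refine (caches_initial D).mono (fun r a h => h.elim) (fun a _ => ⟨id, ?_⟩)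
  cases a with
  | dist x y => rw [accum_of_notMem (dist_notMem_cohSet _ _)]
  | coh x y => rw [accum_of_mem (coh_mem_cohSet _ _)]; rfl
  | aux i j => rw [accum_of_notMem (aux_notMem_cohSet _ _)]

theorem pairwise_output {n b : ℕ} (hb : 0 < b) {D : Fin n → Fin n → ℝ}
    (hD : IsDistance D) (hT : TieFree D) {x z : Fin n} (hxz : x ≠ z) :
    ((exec D (pairwise n b)).slow (.coh x z)).val = ((n : ℝ) - 1) * cohesion D x z := by
  classical
  have h := Caches.loop (List.range (numBlocks n b)) _ _ (fun X _ f s hs =>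
    Caches.loop_ite (List.range (numBlocks n b)) (fun Y => X ≤ Y) (pairwiseBlock n b X) _
      (fun Y _ _ f s hs => caches_pairwiseBlock hb hD hT hs) hs) (caches_accum_initial D)
  have h' := h.slow (.coh x z) (coh_notMem_auxSet _ _)
  rw [accum_of_mem (coh_mem_cohSet _ _), zero_add] at h'
  change ((run (initial D) (pairwise n b)).slow (.coh x z)).val = _
  unfold pairwise
  rw [h', ← sum_pairContrib hD hT hxz, ← sum_blocks_pairs hb]
  refine congrArg List.sum (List.map_congr_left fun X _ => congrArg List.sum
    (List.map_congr_left fun Y _ => ?_))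
  split_ifs
  · simp only [pairItems]
    induction pairsOf n b X Y with
    | nil => rfl
    | cons p l ih =>
      simp only [List.flatMap_cons, List.map_append, List.sum_append, ih, List.map_cons,
        List.map_nil, List.sum_cons, List.sum_nil, add_zero, Finset.sum_add_distrib]
      rfl
  · rfl

theorem Caches.holds {n M r : ℕ} {w : Addr n → Word n} {K : ℕ → Addr n → Prop} {S : Set (Addr n)}
    {s : State n} (h : Caches w K S s) {x y : Fin n} (hr : r < M) (hK : K r (.dist x y))
    (hw : (w (.dist x y)).mark = some s(x, y)) : s.Holds M x y :=
  ⟨r, hr, by rw [h.fast _ _ hK, hw]⟩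

theorem State.Holds.symm {n M : ℕ} {s : State n} {x y : Fin n} (h : s.Holds M x y) :
    s.Holds M y x := by
  obtain ⟨r, hr, h⟩ := h
  exact ⟨r, hr, by rw [h, Sym2.eq_swap]⟩

/-- The moment is in the first loop, right after the vectors for `z` have been read: `d_xy` is in
the resident block, `d_xz` and `d_yz` are in the vectors. -/
theorem pairwise_visits {n M b : ℕ} (hb : 0 < b) (hM : 2 * b * b + 4 * b ≤ M)
    {D : Fin n → Fin n → ℝ} (hD : IsDistance D) (hT : TieFree D) {x y : Fin n} (hxy : x < y)
    (z : Fin n) :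
    Visits (initial D) (pairwise n b) fun s =>
      s.Holds M x y ∧ s.Holds M x z ∧ s.Holds M y z := by
  classical
  let Inv : State n → Prop := fun s => ∃ f,
    Caches (accum (baseWord D 0) (cohSet n) f) (fun _ _ => False) (auxSet n) s
  have hbody : ∀ X Y s, Inv s → Inv (run s (if X ≤ Y then pairwiseBlock n b X Y else [])) := by
    rintro X Y s ⟨f, hs⟩
    split_ifs
    · exact ⟨_, caches_pairwiseBlock hb hD hT hs⟩
    · exact ⟨f, hs⟩
  have hX : x.val / b ∈ List.range (numBlocks n b) := List.mem_range.mpr (div_lt_numBlocks hb x)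
  have hY : y.val / b ∈ List.range (numBlocks n b) := List.mem_range.mpr (div_lt_numBlocks hb y)
  refine Visits.flatMap (Inv := Inv) hX ?_ (fun s hs => ?_) ⟨_, caches_accum_initial D⟩
  · rintro X _ s ⟨f, hs⟩
    exact ⟨_, Caches.loop_ite (List.range (numBlocks n b)) (fun Y => X ≤ Y) (pairwiseBlock n b X) _
      (fun Y _ _ f s hs => caches_pairwiseBlock hb hD hT hs) hs⟩
  refine Visits.flatMap (Inv := Inv) hY (fun Y _ s hs => hbody _ _ s hs) ?_ hs
  rintro s ⟨f, hs⟩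
  rw [if_pos (Nat.div_le_div_right (Fin.lt_def.mp hxy).le), pairwiseBlock_eq]
  set X := x.val / b with hXdef
  set Y := y.val / b with hYdef
  have hp : (x, y) ∈ pairsOf n b X Y := mem_pairsOf.mpr ⟨⟨rfl, rfl⟩, hxy⟩
  refine Visits.append_right (Visits.append_left ?_) _
  refine Visits.flatMap (Inv := fun s => ∃ g, Caches (accum (accum (baseWord D 0) (cohSet n) f)
    (auxSet n) g) (pairCells n b X Y) (auxSet n) s) (List.mem_finRange z) ?_ ?_
    ⟨_, caches_pairInit hb hs⟩
  · rintro z' _ s' ⟨g, hs'⟩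
    exact ⟨_, caches_focusLoop hb (D := D) (fun x y => accum_of_notMem (dist_notMem_cohSet _ _)) z'
      hs'⟩
  · rintro s' ⟨g, hs'⟩
    refine Visits.append_left (Visits.start ?_)
    have h1 := caches_readVecs_dist hb z hs'
    have hw : ∀ x' y', (accum (accum (baseWord D 0) (cohSet n) f) (auxSet n) g
        (.dist x' y')).mark = some s(x', y') := by
      intro x' y'
      rw [accum_of_notMem (dist_notMem_auxSet _ _), accum_of_notMem (dist_notMem_cohSet _ _)]
      rfl
    have hvec : ∀ e ∈ vecList n b X Y, vec b (0 + e.1) e.2 < M := by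
      intro e he
      have h2 : 0 + e.1 < 4 := by rcases mem_vecList.mp he with h | h <;> omega
      exact (vec_lt hb h2 e.2).trans_le hM
    refine ⟨h1.holds ?_ (Or.inl ⟨(x, y), hp, Or.inl ⟨rfl, rfl⟩⟩) (hw _ _),
      h1.holds (hvec _ (fst_mem_vecList hp)) (Or.inr ⟨_, fst_mem_vecList hp, rfl, rfl⟩) (hw _ _),
      h1.holds (hvec _ (snd_mem_vecList hp)) (Or.inr ⟨_, snd_mem_vecList hp, rfl, rfl⟩) (hw _ _)⟩
    have := cell_lt (n := n) hb (show 0 < 2 by norm_num) x y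
    dsimp only
    omega

theorem pairwise_fits {n M b : ℕ} (hb : 0 < b) (hM : 2 * b * b + 4 * b ≤ M) :
    ∀ I ∈ pairwise n b, I.FitsIn M := by
  have hc : ∀ k < 2, ∀ x y : Fin n, cell b k x y < M := fun k hk x y =>
    (cell_lt hb hk x y).trans_le (by omega)
  have hv : ∀ k < 4, ∀ x : Fin n, vec b k x < M := fun k hk x => (vec_lt hb hk x).trans_le hM
  have hR : ∀ (A : Fin n → Fin n → Addr n) (k X Y : ℕ) (z : Fin n), k < 3 →
      ∀ I ∈ readVecs A b k (k + 1) X Y z, I.FitsIn M := by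
    intro A k X Y z hk
    rw [readVecs_eq, List.forall_mem_map]
    intro e he
    refine hv _ ?_ _
    rcases mem_vecList.mp he with h | h <;> omega
  have hW : ∀ (A : Fin n → Fin n → Addr n) (k X Y : ℕ) (z : Fin n), k < 3 →
      ∀ I ∈ writeVecs A b k (k + 1) X Y z, I.FitsIn M := by
    intro A k X Y z hk
    rw [writeVecs_eq, List.forall_mem_map]
    intro e he
    refine hv _ ?_ _
    rcases mem_vecList.mp he with h | h <;> omega
  intro I hI
  simp only [pairwise, List.mem_flatMap] at hI
  obtain ⟨X, -, Y, -, hI⟩ := hI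
  split_ifs at hI
  swap
  · simp at hI
  have hsY : (if X = Y then 0 else 1) < 2 := by split_ifs <;> norm_num
  rw [pairwiseBlock_eq] at hI
  generalize (if X = Y then 0 else 1) = sY at hI hsY
  have c0 := hc 0 (by norm_num)
  have c1 := hc 1 (by norm_num)
  have v0 := hv 0 (by norm_num)
  have v2 := hv 2 (by norm_num)
  have vs := hv sY (by omega)
  have vs2 := hv (2 + sY) (by omega)
  simp only [List.mem_append, List.mem_flatMap, List.mem_map] at hI
  rcases hI with ((⟨p, -, rfl⟩ | ⟨p, -, rfl⟩) | ⟨z, -, hI | ⟨p, -, rfl⟩⟩) |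
    ⟨z, -, ((hI | hI) | ⟨⟨i, p⟩, -, rfl⟩) | hI⟩
  · exact c0 _ _
  · exact ⟨fun i => i.elim0, c1 _ _⟩
  · exact hR _ 0 X Y z (by norm_num) I hI
  · simp [Instr.FitsIn, Fin.forall_fin_succ, c0, c1, v0, vs]
  · exact hR _ 0 X Y z (by norm_num) I hI
  · exact hR _ 2 X Y z (by norm_num) I hI
  · cases i <;> simp [pairInstr, Instr.FitsIn, Fin.forall_fin_succ, c0, c1, v0, vs, v2, vs2]
  · exact hW _ 2 X Y z (by norm_num) I hI

theorem pairwiseFor_isRun {n M : ℕ} (hM : 12 ≤ M) {D : Fin n → Fin n → ℝ} (hD : IsDistance D)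
    (hT : TieFree D) : IsRun M D ((n : ℝ) - 1) (pairwiseFor n M) := by
  have hb := (le_mul_sq_pairwiseSize hM).1
  -- With `(b + 1) ^ 2 ≤ M / 2 + 1`, because `2 b² + 4 b = 2 (b + 1)² - 2`.
  have hfit : 2 * pairwiseSize M * pairwiseSize M + 4 * pairwiseSize M ≤ M := by
    have h1 := Nat.sqrt_le' (M / 2 + 1)
    unfold pairwiseSize at hb ⊢
    obtain ⟨t, ht⟩ : ∃ t, Nat.sqrt (M / 2 + 1) = t + 1 :=
      ⟨_, (Nat.sub_add_cancel (show 1 ≤ Nat.sqrt (M / 2 + 1) by omega)).symm⟩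
    rw [ht] at h1 ⊢
    have h2 : 2 * (M / 2) ≤ M := Nat.mul_div_le M 2
    rw [Nat.add_sub_cancel]
    nlinarith
  refine ⟨pairwise_fits hb hfit, fun x y z hxy _ _ => ?_,
    fun x z hxz => pairwise_output hb hD hT hxz⟩
  rcases lt_or_gt_of_ne hxy with h | h
  · obtain ⟨t, ht, h1, h2, h3⟩ := pairwise_visits hb hfit hD hT h z
    exact ⟨t, ht, h1, h3, h2⟩
  · obtain ⟨t, ht, h1, h2, h3⟩ := pairwise_visits hb hfit hD hT h z
    exact ⟨t, ht, h1.symm, h2, h3⟩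

/-! ### Fast memory during a triplet pass -/

/-- The order `x < y` is essential: it separates the upper from the lower triangle of `C`, which
share one family of addresses. -/
theorem kindAddr_inj {n k k' : ℕ} (hk : k < 4) (hk' : k' < 4) {x y x' y' : Fin n} (hxy : x < y)
    (hxy' : x' < y') (h : kindAddr k x y = kindAddr k' x' y') : k = k' ∧ x = x' ∧ y = y' := by
  interval_cases k <;> interval_cases k' <;>
    simp [kindAddr, focusAddr, cohT, Fin.val_inj] at h ⊢ <;>
    first
      | exact h
      | exact h.symm
      | (obtain ⟨rfl, rfl⟩ := h; exact absurd hxy' hxy.not_gt)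

/-- The pair lies in one of the three blocks. -/
def InTriple {n : ℕ} (b X Y Z : ℕ) (p : Fin n × Fin n) : Prop :=
  p.1 < p.2 ∧ ((p.1.val / b = X ∧ p.2.val / b = Y) ∨ (p.1.val / b = X ∧ p.2.val / b = Z) ∨
    (p.1.val / b = Y ∧ p.2.val / b = Z))

def tripleSlot {n : ℕ} (b X Y : ℕ) (p : Fin n × Fin n) : ℕ :=
  if p.1.val / b = X then if p.2.val / b = Y then 0 else 1 else 2

theorem tripleSlot_lt {n : ℕ} (b X Y : ℕ) (p : Fin n × Fin n) : tripleSlot b X Y p < 3 := by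
  unfold tripleSlot
  split_ifs <;> norm_num

/-- When blocks coincide, a pair could be attributed to several of them. The slot singles out one,
in agreement with the blocks that are actually loaded and written back. -/
theorem inTriple_iff {n b X Y Z : ℕ} {p : Fin n × Fin n} :
    InTriple b X Y Z p ↔ (p ∈ pairsOf n b X Y ∧ tripleSlot b X Y p = 0) ∨
      (Y ≠ Z ∧ p ∈ pairsOf n b X Z ∧ tripleSlot b X Y p = 1) ∨
      (X ≠ Y ∧ p ∈ pairsOf n b Y Z ∧ tripleSlot b X Y p = 2) := by
  simp only [InTriple, mem_pairsOf, tripleSlot]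
  generalize p.1.val / b = i
  generalize p.2.val / b = j
  by_cases h : p.1 < p.2
  · simp only [h, true_and, and_true]
    split_ifs <;> omega
  · simp [h]

theorem inTriple_eq {n b X Y Z : ℕ} {p q : Fin n × Fin n} (hp : InTriple b X Y Z p)
    (hq : InTriple b X Y Z q) (hs : tripleSlot b X Y p = tripleSlot b X Y q)
    (h1 : p.1.val % b = q.1.val % b) (h2 : p.2.val % b = q.2.val % b) : p = q := by
  rcases inTriple_iff.mp hp with ⟨hp, e⟩ | ⟨-, hp, e⟩ | ⟨-, hp, e⟩ <;>
  rcases inTriple_iff.mp hq with ⟨hq, e'⟩ | ⟨-, hq, e'⟩ | ⟨-, hq, e'⟩ <;>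
  first
    | exact pairsOf_eq_of_mod hp hq h1 h2
    | (exfalso; omega)

/-- Fast memory holds the blocks `X`, `Y` of the kinds `R`. -/
def kindPairCells (n b : ℕ) (R : List ℕ) (X Y r : ℕ) (a : Addr n) : Prop :=
  ∃ k ∈ R, ∃ p ∈ pairsOf n b X Y, r = cell b (3 * k + 0) p.1 p.2 ∧ a = kindAddr k p.1 p.2

/-- Fast memory holds the three blocks of the kinds `R`. -/
def kindTripleCells (n b : ℕ) (R : List ℕ) (X Y Z r : ℕ) (a : Addr n) : Prop :=
  ∃ k ∈ R, ∃ p : Fin n × Fin n, InTriple b X Y Z p ∧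
    r = cell b (3 * k + tripleSlot b X Y p) p.1 p.2 ∧ a = kindAddr k p.1 p.2

def kindPairSet (n b : ℕ) (W : List ℕ) (X Y : ℕ) : Set (Addr n) :=
  {a | ∃ k ∈ W, ∃ p ∈ pairsOf n b X Y, a = kindAddr k p.1 p.2}

def kindTripleSet (n b : ℕ) (W : List ℕ) (X Y Z : ℕ) : Set (Addr n) :=
  {a | ∃ k ∈ W, ∃ p : Fin n × Fin n, InTriple b X Y Z p ∧ a = kindAddr k p.1 p.2}

theorem kindPairCells_le {n b : ℕ} {R : List ℕ} {X Y Z r : ℕ} {a : Addr n}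
    (h : kindPairCells n b R X Y r a) : kindTripleCells n b R X Y Z r a := by
  obtain ⟨k, hk, p, hp, rfl, rfl⟩ := h
  obtain ⟨⟨h1, h2⟩, h3⟩ := mem_pairsOf.mp hp
  exact ⟨k, hk, p, ⟨h3, Or.inl ⟨h1, h2⟩⟩, by simp [tripleSlot, h1, h2], rfl⟩

theorem kindPairSet_le {n b : ℕ} {W : List ℕ} {X Y Z : ℕ} {a : Addr n}
    (h : a ∈ kindPairSet n b W X Y) : a ∈ kindTripleSet n b W X Y Z := by
  obtain ⟨k, hk, p, hp, rfl⟩ := h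
  obtain ⟨⟨h1, h2⟩, h3⟩ := mem_pairsOf.mp hp
  exact ⟨k, hk, p, ⟨h3, Or.inl ⟨h1, h2⟩⟩, rfl⟩

/-- While `Z` varies, slow memory is stale only on the resident block; any other block can thus be
read safely. -/
theorem kindAddr_notMem_kindPairSet {n b : ℕ} {W : List ℕ} (hW : ∀ k ∈ W, k < 4)
    {X Y X' Y' k : ℕ} (hk : k < 4) {p : Fin n × Fin n} (hp : p ∈ pairsOf n b X' Y')
    (hne : X ≠ X' ∨ Y ≠ Y') : kindAddr k p.1 p.2 ∉ kindPairSet n b W X Y := by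
  rintro ⟨k', hk', q, hq, h⟩
  rw [mem_pairsOf] at hp hq
  obtain ⟨-, h1, h2⟩ := kindAddr_inj hk (hW k' hk') hp.2 hq.2 h
  rw [h1, h2] at hp
  omega

theorem readKinds_eq (n b : ℕ) (R : List ℕ) (s X Y : ℕ) :
    readKinds n b R s X Y = (R ×ˢ pairsOf n b X Y).map fun e =>
      .read (kindAddr e.1 e.2.1 e.2.2) (cell b (3 * e.1 + s) e.2.1 e.2.2) := by
  simp [readKinds, readBlock, SProd.sprod, List.product, List.map_flatMap, Function.comp_def]

theorem writeKinds_eq (n b : ℕ) (W : List ℕ) (s X Y : ℕ) :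
    writeKinds n b W s X Y = (W ×ˢ pairsOf n b X Y).map fun e =>
      .write (cell b (3 * e.1 + s) e.2.1 e.2.2) (kindAddr e.1 e.2.1 e.2.2) := by
  simp [writeKinds, writeBlock, SProd.sprod, List.product, List.map_flatMap, Function.comp_def]

theorem caches_readKinds {n b : ℕ} (hb : 0 < b) {R : List ℕ} {sl X Y : ℕ} {w : Addr n → Word n}
    {K K' : ℕ → Addr n → Prop} {S : Set (Addr n)} {s : State n} (h : Caches w K S s)
    (hA : ∀ k ∈ R, ∀ p ∈ pairsOf n b X Y, kindAddr k p.1 p.2 ∉ S)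
    (hK : ∀ r a, K' r a → (∃ k ∈ R, ∃ p ∈ pairsOf n b X Y,
      r = cell b (3 * k + sl) p.1 p.2 ∧ a = kindAddr k p.1 p.2) ∨
      (K r a ∧ ∀ k, ∀ p : Fin n × Fin n, cell b (3 * k + sl) p.1 p.2 ≠ r)) :
    Caches w K' S (run s (readKinds n b R sl X Y)) := by
  rw [readKinds_eq]
  refine h.reads (R ×ˢ pairsOf n b X Y) (fun e => cell b (3 * e.1 + sl) e.2.1 e.2.2)
    (fun e => kindAddr e.1 e.2.1 e.2.2) ?_ ?_ ?_
  · rintro ⟨k, p⟩ he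
    obtain ⟨hk, hp⟩ := List.pair_mem_product.mp he
    exact hA k hk p hp
  · rintro ⟨k, p⟩ he ⟨k', p'⟩ he' hee
    obtain ⟨hk, hp⟩ := List.pair_mem_product.mp he
    obtain ⟨hk', hp'⟩ := List.pair_mem_product.mp he'
    obtain ⟨h0, h1, h2⟩ := cell_inj hb hee
    obtain rfl : k = k' := by simpa using h0
    obtain rfl := pairsOf_eq_of_mod hp hp' h1 h2
    rfl
  · intro r a hra
    rcases hK r a hra with ⟨k, hk, p, hp, h1, h2⟩ | ⟨h1, h2⟩
    · exact Or.inl ⟨(k, p), List.pair_mem_product.mpr ⟨hk, hp⟩, h1, h2⟩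
    · exact Or.inr ⟨h1, fun e _ => h2 e.1 e.2⟩

theorem caches_writeKinds {n b : ℕ} {W : List ℕ} {sl X Y : ℕ} {w : Addr n → Word n}
    {K : ℕ → Addr n → Prop} {S S' : Set (Addr n)} {s : State n} (h : Caches w K S s)
    (hK : ∀ k ∈ W, ∀ p ∈ pairsOf n b X Y, K (cell b (3 * k + sl) p.1 p.2) (kindAddr k p.1 p.2))
    (hS : ∀ a, a ∉ S' → a ∉ S ∨ a ∈ kindPairSet n b W X Y) :
    Caches w K S' (run s (writeKinds n b W sl X Y)) := by
  rw [writeKinds_eq]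
  refine h.writes (W ×ˢ pairsOf n b X Y) (fun e => cell b (3 * e.1 + sl) e.2.1 e.2.2)
    (fun e => kindAddr e.1 e.2.1 e.2.2) ?_ ?_
  · rintro ⟨k, p⟩ he
    obtain ⟨hk, hp⟩ := List.pair_mem_product.mp he
    exact hK k hk p hp
  · intro a ha
    rcases hS a ha with h | ⟨k, hk, p, hp, h⟩
    · exact Or.inl h
    · exact Or.inr ⟨(k, p), List.pair_mem_product.mpr ⟨hk, hp⟩, h⟩

/-- The three blocks are in fast memory after the blocks `X`, `Z` and `Y`, `Z` have been read. -/
theorem caches_tripleLoad {n b : ℕ} (hb : 0 < b) {R W : List ℕ} (hR : ∀ k ∈ R, k < 4)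
    (hW : ∀ k ∈ W, k < 4) {X Y Z : ℕ} {w : Addr n → Word n} {s : State n}
    (h : Caches w (kindPairCells n b R X Y) (kindPairSet n b W X Y) s) :
    Caches w (kindTripleCells n b R X Y Z) (kindPairSet n b W X Y)
      (run s ((if Y = Z then [] else readKinds n b R 1 X Z) ++
        (if X = Y then [] else readKinds n b R 2 Y Z))) := by
  rw [run_append]
  let K : ℕ → Addr n → Prop := fun r a => kindPairCells n b R X Y r a ∨
    (Y ≠ Z ∧ ∃ k ∈ R, ∃ p ∈ pairsOf n b X Z,
      r = cell b (3 * k + 1) p.1 p.2 ∧ a = kindAddr k p.1 p.2)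
  have h1 : Caches w K (kindPairSet n b W X Y)
      (run s (if Y = Z then [] else readKinds n b R 1 X Z)) := by
    split_ifs with hYZ
    · refine h.mono (fun r a hra => ⟨?_, rfl⟩) (fun a ha => ⟨ha, rfl⟩)
      exact hra.resolve_right fun h => h.1 hYZ
    · refine caches_readKinds hb h
        (fun k hk p hp => kindAddr_notMem_kindPairSet hW (hR k hk) hp (Or.inr hYZ)) ?_
      rintro r a (hra | ⟨-, hra⟩)
      · refine Or.inr ⟨hra, fun k p hr => ?_⟩
        obtain ⟨k', -, q, -, rfl, -⟩ := hra
        have := (cell_inj hb hr).1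
        omega
      · exact Or.inl hra
  have hcases : ∀ r a, kindTripleCells n b R X Y Z r a → K r a ∨ (X ≠ Y ∧ ∃ k ∈ R,
      ∃ p ∈ pairsOf n b Y Z, r = cell b (3 * k + 2) p.1 p.2 ∧ a = kindAddr k p.1 p.2) := by
    rintro r a ⟨k, hk, p, hp, rfl, rfl⟩
    rcases inTriple_iff.mp hp with ⟨hp, e⟩ | ⟨hne, hp, e⟩ | ⟨hne, hp, e⟩
    · exact Or.inl (Or.inl ⟨k, hk, p, hp, by rw [e], rfl⟩)
    · exact Or.inl (Or.inr ⟨hne, k, hk, p, hp, by rw [e], rfl⟩)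
    · exact Or.inr ⟨hne, k, hk, p, hp, by rw [e], rfl⟩
  generalize run s (if Y = Z then [] else readKinds n b R 1 X Z) = s₁ at h1 ⊢
  split_ifs with hXY
  · exact h1.mono (fun r a hra => ⟨(hcases r a hra).resolve_right fun h => h.1 hXY, rfl⟩)
      (fun a ha => ⟨ha, rfl⟩)
  · refine caches_readKinds hb h1
      (fun k hk p hp => kindAddr_notMem_kindPairSet hW (hR k hk) hp (Or.inl hXY)) ?_
    intro r a hra
    rcases hcases r a hra with hra | ⟨-, hra⟩
    · refine Or.inr ⟨hra, fun k p hr => ?_⟩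
      rcases hra with ⟨k', -, q, -, rfl, -⟩ | ⟨-, k', -, q, -, rfl, -⟩
      · have := (cell_inj hb hr).1
        omega
      · have := (cell_inj hb hr).1
        omega
    · exact Or.inl hra

/-- Between steps only the resident block is cached and possibly stale. Inside a step all three
blocks may be stale, and the write-backs restore the outer invariant. -/
theorem caches_tripleStep {n b : ℕ} (hb : 0 < b) {R W : List ℕ} (hR : ∀ k ∈ R, k < 4)
    (hWR : ∀ k ∈ W, k ∈ R) {X Y Z : ℕ} {ops : ℕ → ℕ → ℕ → List (Instr n)}
    {w w' : Addr n → Word n} {s : State n}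
    (hops : ∀ s, Caches w (kindTripleCells n b R X Y Z) (kindTripleSet n b W X Y Z) s →
      Caches w' (kindTripleCells n b R X Y Z) (kindTripleSet n b W X Y Z) (run s (ops X Y Z)))
    (h : Caches w (kindPairCells n b R X Y) (kindPairSet n b W X Y) s) :
    Caches w' (kindPairCells n b R X Y) (kindPairSet n b W X Y)
      (run s (tripleStep n b R W ops X Y Z)) := by
  have hW : ∀ k ∈ W, k < 4 := fun k hk => hR k (hWR k hk)
  unfold tripleStep
  rw [run_append, run_append, run_append]
  have h1 := hops _ ((caches_tripleLoad (Z := Z) hb hR hW h).mono (fun r a hra => ⟨hra, rfl⟩)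
    (fun a ha => ⟨fun ha' => ha (kindPairSet_le ha'), rfl⟩))
  set s₁ := run (run s _) (ops X Y Z)
  -- The addresses still stale after the block `XZ` has been written back but before `YZ` is.
  let S : Set (Addr n) := {a | a ∈ kindPairSet n b W X Y ∨ (X ≠ Y ∧ a ∈ kindPairSet n b W Y Z)}
  have hcases : ∀ a, a ∈ kindTripleSet n b W X Y Z →
      a ∈ S ∨ (Y ≠ Z ∧ a ∈ kindPairSet n b W X Z) := by
    rintro a ⟨k, hk, p, hp, rfl⟩
    rcases inTriple_iff.mp hp with ⟨hp, -⟩ | ⟨hne, hp, -⟩ | ⟨hne, hp, -⟩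
    · exact Or.inl (Or.inl ⟨k, hk, p, hp, rfl⟩)
    · exact Or.inr ⟨hne, k, hk, p, hp, rfl⟩
    · exact Or.inl (Or.inr ⟨hne, k, hk, p, hp, rfl⟩)
  have h2 : Caches w' (kindTripleCells n b R X Y Z) S
      (run s₁ (if Y = Z then [] else writeKinds n b W 1 X Z)) := by
    split_ifs with hYZ
    · exact h1.mono (fun r a hra => ⟨hra, rfl⟩) (fun a ha =>
        ⟨fun ha' => ((hcases a ha').resolve_left ha).1 hYZ, rfl⟩)
    · refine caches_writeKinds h1 (fun k hk p hp => ?_) (fun a ha => ?_)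
      · obtain ⟨⟨e1, e2⟩, e3⟩ := mem_pairsOf.mp hp
        have e4 : Z ≠ Y := Ne.symm hYZ
        exact ⟨k, hWR k hk, p, ⟨e3, Or.inr (Or.inl ⟨e1, e2⟩)⟩,
          by simp [tripleSlot, e1, e2, e4], rfl⟩
      · by_cases ha' : a ∈ kindTripleSet n b W X Y Z
        · exact Or.inr ((hcases a ha').resolve_left ha).2
        · exact Or.inl ha'
  generalize run s₁ (if Y = Z then [] else writeKinds n b W 1 X Z) = s₂ at h2 ⊢
  have h3 : Caches w' (kindTripleCells n b R X Y Z) (kindPairSet n b W X Y)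
      (run s₂ (if X = Y then [] else writeKinds n b W 2 Y Z)) := by
    split_ifs with hXY
    · exact h2.mono (fun r a hra => ⟨hra, rfl⟩) (fun a ha =>
        ⟨fun ha' => ha (ha'.resolve_right fun h => h.1 hXY), rfl⟩)
    · refine caches_writeKinds h2 (fun k hk p hp => ?_) (fun a ha => ?_)
      · obtain ⟨⟨e1, e2⟩, e3⟩ := mem_pairsOf.mp hp
        have e4 : Y ≠ X := Ne.symm hXY
        exact ⟨k, hWR k hk, p, ⟨e3, Or.inr (Or.inr ⟨e1, e2⟩)⟩, by simp [tripleSlot, e1, e4], rfl⟩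
      · by_cases ha' : a ∈ S
        · exact Or.inr (ha'.resolve_left ha).2
        · exact Or.inl ha'
  exact h3.mono (fun r a hra => ⟨kindPairCells_le hra, rfl⟩) (fun a ha => ⟨ha, rfl⟩)

theorem caches_pairLoad {n b : ℕ} (hb : 0 < b) {R W : List ℕ} {X Y : ℕ}
    {w : Addr n → Word n} {s : State n} (h : Caches w (fun _ _ => False) ∅ s) :
    Caches w (kindPairCells n b R X Y) (kindPairSet n b W X Y)
      (run s (readKinds n b R 0 X Y)) :=
  (caches_readKinds hb h (fun _ _ _ _ => Set.notMem_empty _) (fun _ _ hra => Or.inl hra)).mono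
    (fun _ _ hra => ⟨hra, rfl⟩) (fun _ _ => ⟨Set.notMem_empty _, rfl⟩)

theorem caches_triplePair {n b : ℕ} (hb : 0 < b) {R W : List ℕ} (hR : ∀ k ∈ R, k < 4)
    (hWR : ∀ k ∈ W, k ∈ R) {X Y : ℕ} {ops : ℕ → ℕ → ℕ → List (Instr n)}
    {w : Addr n → Word n} {T : Set (Addr n)} {δ : ℕ → ℕ → ℕ → Addr n → ℝ}
    (hops : ∀ Z, Y ≤ Z → ∀ (f : Addr n → ℝ) s,
      Caches (accum w T f) (kindTripleCells n b R X Y Z) (kindTripleSet n b W X Y Z) s →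
      Caches (accum w T fun a => f a + δ X Y Z a) (kindTripleCells n b R X Y Z)
        (kindTripleSet n b W X Y Z) (run s (ops X Y Z)))
    {f : Addr n → ℝ} {s : State n} (h : Caches (accum w T f) (fun _ _ => False) ∅ s) :
    Caches (accum w T fun a => f a + ((List.range (numBlocks n b)).map fun Z =>
        if Y ≤ Z then δ X Y Z a else 0).sum) (fun _ _ => False) ∅
      (run s (triplePair n b R W ops X Y)) := by
  unfold triplePair
  rw [run_append, run_append]
  have h2 := Caches.loop_ite (List.range (numBlocks n b)) (fun Z => Y ≤ Z)
    (tripleStep n b R W ops X Y) (fun Z a => δ X Y Z a)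
    (fun Z _ hZ f s hs => caches_tripleStep hb hR hWR (hops Z hZ f) hs)
    (caches_pairLoad (X := X) (Y := Y) (R := R) (W := W) hb h)
  refine (caches_writeKinds (S' := ∅) h2 (fun k hk p hp => ⟨k, hWR k hk, p, hp, rfl, rfl⟩)
    fun a _ => (em (a ∈ kindPairSet n b W X Y)).symm).mono
    (fun _ _ hra => hra.elim) (fun _ ha => ⟨ha, rfl⟩)

theorem caches_triplePass {n b : ℕ} (hb : 0 < b) {R W : List ℕ} (hR : ∀ k ∈ R, k < 4)
    (hWR : ∀ k ∈ W, k ∈ R) {ops : ℕ → ℕ → ℕ → List (Instr n)}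
    {w : Addr n → Word n} {T : Set (Addr n)} {δ : ℕ → ℕ → ℕ → Addr n → ℝ}
    (hops : ∀ X Y Z, ∀ (f : Addr n → ℝ) s,
      Caches (accum w T f) (kindTripleCells n b R X Y Z) (kindTripleSet n b W X Y Z) s →
      Caches (accum w T fun a => f a + δ X Y Z a) (kindTripleCells n b R X Y Z)
        (kindTripleSet n b W X Y Z) (run s (ops X Y Z)))
    {f : Addr n → ℝ} {s : State n} (h : Caches (accum w T f) (fun _ _ => False) ∅ s) :
    Caches (accum w T fun a => f a + ((List.range (numBlocks n b)).map fun X =>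
      ((List.range (numBlocks n b)).map fun Y => if X ≤ Y then
        ((List.range (numBlocks n b)).map fun Z =>
          if Y ≤ Z then δ X Y Z a else 0).sum else 0).sum).sum) (fun _ _ => False) ∅
      (run s (triplePass n b R W ops)) :=
  Caches.loop _ _ _ (fun X _ _ _ hs => Caches.loop_ite _ (fun Y => X ≤ Y)
    (triplePair n b R W ops X) _ (fun Y _ _ _ _ hs =>
      caches_triplePair hb hR hWR (fun Z _ => hops X Y Z) hs) hs) h

/-- Every triple of blocks is in fast memory at some moment of a pass. -/
theorem triplePass_visits {n b : ℕ} (hb : 0 < b) {R W : List ℕ} (hR : ∀ k ∈ R, k < 4)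
    (hWR : ∀ k ∈ W, k ∈ R) {ops : ℕ → ℕ → ℕ → List (Instr n)}
    {w : Addr n → Word n} {T : Set (Addr n)} {δ : ℕ → ℕ → ℕ → Addr n → ℝ}
    (hops : ∀ X Y Z, ∀ (f : Addr n → ℝ) s,
      Caches (accum w T f) (kindTripleCells n b R X Y Z) (kindTripleSet n b W X Y Z) s →
      Caches (accum w T fun a => f a + δ X Y Z a) (kindTripleCells n b R X Y Z)
        (kindTripleSet n b W X Y Z) (run s (ops X Y Z)))
    {x y z : Fin n} (hxy : x < y) (hyz : y < z) {Q : State n → Prop}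
    (hQ : ∀ (f : Addr n → ℝ) s, Caches (accum w T f)
      (kindTripleCells n b R (x.val / b) (y.val / b) (z.val / b))
      (kindPairSet n b W (x.val / b) (y.val / b)) s → Q s)
    {f : Addr n → ℝ} {s : State n} (h : Caches (accum w T f) (fun _ _ => False) ∅ s) :
    Visits s (triplePass n b R W ops) Q := by
  have hmem : ∀ x : Fin n, x.val / b ∈ List.range (numBlocks n b) := fun x =>
    List.mem_range.mpr (div_lt_numBlocks hb x)
  let Inv : State n → Prop := fun s => ∃ f, Caches (accum w T f) (fun _ _ => False) ∅ s
  refine Visits.flatMap (Inv := Inv) (hmem x) ?_ (fun s hs => ?_) ⟨f, h⟩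
  · rintro X _ s ⟨f, hs⟩
    exact ⟨_, Caches.loop_ite (List.range (numBlocks n b)) (fun Y => X ≤ Y)
      (triplePair n b R W ops X) _ (fun Y _ _ _ _ hs =>
        caches_triplePair hb hR hWR (fun Z _ => hops X Y Z) hs) hs⟩
  refine Visits.flatMap (Inv := Inv) (hmem y) ?_ ?_ hs
  · rintro Y _ s ⟨f, hs⟩
    split_ifs
    · exact ⟨_, caches_triplePair hb hR hWR (fun Z _ => hops _ Y Z) hs⟩
    · exact ⟨f, hs⟩
  rintro s ⟨f, hs⟩
  rw [if_pos (Nat.div_le_div_right (Fin.lt_def.mp hxy).le)]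
  refine Visits.append_right (Visits.append_left ?_) _
  refine Visits.flatMap (Inv := fun s => ∃ f, Caches (accum w T f)
    (kindPairCells n b R (x.val / b) (y.val / b)) (kindPairSet n b W (x.val / b) (y.val / b)) s)
    (hmem z) ?_ ?_ ⟨f, caches_pairLoad hb hs⟩
  · rintro Z _ s ⟨f, hs⟩
    split_ifs
    · exact ⟨_, caches_tripleStep hb hR hWR (hops _ _ Z f) hs⟩
    · exact ⟨f, hs⟩
  · rintro s ⟨f, hs⟩
    rw [if_pos (Nat.div_le_div_right (Fin.lt_def.mp hyz).le)]
    unfold tripleStep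
    refine Visits.append_right (Visits.append_right (Visits.append_right ?_ _) _) _
    have h1 := caches_tripleLoad (Z := z.val / b) hb hR (fun k hk => hR k (hWR k hk)) hs
    -- The desired moment is the end of the loading, that is, the start of an empty continuation.
    rw [← List.append_nil (_ ++ _)]
    exact Visits.append_left (Visits.start (hQ f _ h1))

/-! ### The operations of the triplet passes -/

theorem triplePart_inTriple {n b X Y Z : ℕ} {t : Fin n × Fin n × Fin n}
    (ht : t ∈ triplesOf n b X Y Z) (m : ℕ) :
    InTriple b X Y Z (triplePart m t) ∧
      tripleSlot b X Y (triplePart m t) = partSlot X Y Z m := by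
  obtain ⟨⟨h1, h2, h3⟩, h4, h5⟩ := mem_triplesOf.mp ht
  match m with
  | 0 => exact ⟨⟨h4, Or.inl ⟨h1, h2⟩⟩, by simp [tripleSlot, triplePart, partSlot, h1, h2]⟩
  | 1 => exact ⟨⟨h4.trans h5, Or.inr (Or.inl ⟨h1, h3⟩)⟩, by
      simp [tripleSlot, triplePart, partSlot, slotXZ, h1, h3, eq_comm]⟩
  | m + 2 => exact ⟨⟨h5, Or.inr (Or.inr ⟨h2, h3⟩)⟩, by
      simp [tripleSlot, triplePart, partSlot, slotXZ, slotYZ, h2, h3, eq_comm]⟩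

theorem kindTripleCells_part {n b X Y Z k : ℕ} {R : List ℕ} (hk : k ∈ R)
    {t : Fin n × Fin n × Fin n} (ht : t ∈ triplesOf n b X Y Z) (m : ℕ) :
    kindTripleCells n b R X Y Z
      (cell b (3 * k + partSlot X Y Z m) (triplePart m t).1 (triplePart m t).2)
      (kindAddr k (triplePart m t).1 (triplePart m t).2) := by
  obtain ⟨h1, h2⟩ := triplePart_inTriple ht m
  exact ⟨k, hk, _, h1, by rw [h2], rfl⟩

/-- This is the absence of aliasing required by `Caches.accumulate`, also when two of the three
blocks coincide and share a slot. -/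
theorem kindTripleCells_iff {n b X Y Z k : ℕ} (hb : 0 < b) {R : List ℕ} (hR : ∀ k ∈ R, k < 4)
    (hk : k ∈ R) {t : Fin n × Fin n × Fin n} (ht : t ∈ triplesOf n b X Y Z) (m : ℕ)
    {r : ℕ} {a : Addr n} (h : kindTripleCells n b R X Y Z r a) :
    r = cell b (3 * k + partSlot X Y Z m) (triplePart m t).1 (triplePart m t).2 ↔
      a = kindAddr k (triplePart m t).1 (triplePart m t).2 := by
  obtain ⟨h1, h2⟩ := triplePart_inTriple ht m
  obtain ⟨k', hk', p, hp, rfl, rfl⟩ := h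
  rw [← h2]
  constructor
  · intro h
    obtain ⟨e0, e1, e2⟩ := cell_inj hb h
    have l1 := tripleSlot_lt b X Y p
    have l2 := tripleSlot_lt b X Y (triplePart m t)
    obtain rfl : k' = k := by omega
    rw [inTriple_eq hp h1 (by omega) e1 e2]
  · intro h
    obtain ⟨rfl, e1, e2⟩ := kindAddr_inj (hR _ hk') (hR _ hk) hp.1 h1.1 h
    rw [Prod.ext e1 e2]

noncomputable def focusUpdate {n : ℕ} (D : Fin n → Fin n → ℝ) (e : ℕ × Fin n × Fin n × Fin n) :
    ℝ :=
  focusMask e.1 (D e.2.1 e.2.2.1) (D e.2.1 e.2.2.2) (D e.2.2.1 e.2.2.2)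

noncomputable def cohesionUpdate {n : ℕ} (D : Fin n → Fin n → ℝ)
    (e : (ℕ × ℕ) × Fin n × Fin n × Fin n) : ℝ :=
  cohesionMask e.1.2 (D e.2.1 e.2.2.1) (D e.2.1 e.2.2.2) (D e.2.2.1 e.2.2.2) *
    (1 / focusSize D (triplePart (otherPart e.1.1 e.1.2) e.2).1
      (triplePart (otherPart e.1.1 e.1.2) e.2).2)

theorem fast_dist {n b X Y Z : ℕ} {R : List ℕ} (h0 : 0 ∈ R) {D : Fin n → Fin n → ℝ}
    {w : Addr n → Word n} (hw : ∀ x y, w (.dist x y) = ⟨D x y, some s(x, y)⟩) {S : Set (Addr n)}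
    {s : State n} (h : Caches w (kindTripleCells n b R X Y Z) S s) {t : Fin n × Fin n × Fin n}
    (ht : t ∈ triplesOf n b X Y Z) (m : ℕ) :
    s.fast (cell b (partSlot X Y Z m) (triplePart m t).1 (triplePart m t).2) =
      ⟨D (triplePart m t).1 (triplePart m t).2, some s((triplePart m t).1, (triplePart m t).2)⟩ := by
  have := h.fast _ _ (kindTripleCells_part h0 ht m)
  rw [mul_zero, zero_add] at this
  rw [this]
  exact hw _ _

open Classical in
theorem caches_focusOps {n b X Y Z : ℕ} (hb : 0 < b) {D : Fin n → Fin n → ℝ} {w : Addr n → Word n}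
    (hw : ∀ x y, w (.dist x y) = ⟨D x y, some s(x, y)⟩) {f : Addr n → ℝ} {s : State n}
    (h : Caches (accum w (auxSet n) f) (kindTripleCells n b [0, 1] X Y Z)
      (kindTripleSet n b [1] X Y Z) s) :
    Caches (accum w (auxSet n) fun a => f a + ((triplesOf n b X Y Z).map fun t =>
        ∑ m ∈ Finset.range 3, if a = focusAddr (triplePart m t).1 (triplePart m t).2
          then focusUpdate D (m, t) else 0).sum)
      (kindTripleCells n b [0, 1] X Y Z) (kindTripleSet n b [1] X Y Z)
      (run s (focusOps n b X Y Z)) := by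
  have hmem : ∀ e ∈ ((triplesOf n b X Y Z).flatMap fun t => [(0, t), (1, t), (2, t)]),
      e.2 ∈ triplesOf n b X Y Z := by
    intro e he
    obtain ⟨t, ht, he⟩ := List.mem_flatMap.mp he
    simp only [List.mem_cons, List.not_mem_nil, or_false] at he
    rcases he with rfl | rfl | rfl <;> exact ht
  have hR : ∀ k ∈ [0, 1], k < 4 := by simp
  have key := Caches.accumulate (w := w) (T := auxSet n) (K := kindTripleCells n b [0, 1] X Y Z)
    (S := kindTripleSet n b [1] X Y Z)
    ((triplesOf n b X Y Z).flatMap fun t => [(0, t), (1, t), (2, t)])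
    (focusInstr b X Y Z)
    (fun e => cell b (3 * 1 + partSlot X Y Z e.1) (triplePart e.1 e.2).1 (triplePart e.1 e.2).2)
    (fun e => kindAddr 1 (triplePart e.1 e.2).1 (triplePart e.1 e.2).2)
    (focusUpdate D) (fun _ _ => focusAddr_mem_auxSet _ _)
    (fun e he => ⟨1, by simp, _, (triplePart_inTriple (hmem e he) e.1).1, rfl⟩)
    (fun e he r a hra => kindTripleCells_iff hb hR (by simp) (hmem e he) e.1 hra) ?_ h
  · refine key.mono (fun r a hra => ⟨hra, ?_⟩) (fun a ha => ⟨ha, ?_⟩)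
    all_goals
      congr 2
      funext a
      congr 1
      induction triplesOf n b X Y Z with
      | nil => rfl
      | cons t l ih =>
        simp only [List.flatMap_cons, List.map_append, List.sum_append, ih, List.map_cons,
          List.map_nil, List.sum_cons, List.sum_nil, add_zero, Finset.sum_range_succ,
          Finset.sum_range_zero, zero_add, add_assoc]
        rfl
  · rintro ⟨m, t⟩ he f' s' hs'
    have ht := hmem _ he
    have hw' : ∀ x y, accum w (auxSet n) f' (.dist x y) = ⟨D x y, some s(x, y)⟩ := fun x y => by
      rw [accum_of_notMem (dist_notMem_auxSet _ _), hw]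
    have e0 := fast_dist (by simp) hw' hs' ht 0
    have e1 := fast_dist (by simp) hw' hs' ht 1
    have e2 := fast_dist (by simp) hw' hs' ht 2
    have e3 := hs'.fast _ _ (kindTripleCells_part (k := 1) (by simp) ht m)
    rw [accum_of_mem (show kindAddr 1 _ _ ∈ auxSet n from focusAddr_mem_auxSet _ _)] at e3
    simp only [triplePart] at e0 e1 e2
    have e0' : partSlot X Y Z 0 = 0 := rfl
    rw [e0'] at e0
    simp only [focusInstr, addU, Instr.exec, focusUpdate]
    congr 2
    simp [e0, e1, e2, e3]

open Classical in
-- Only the upper triangle of `U` is assumed correct: all three pairs of a sorted triplet are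
-- increasing, so no other entry is used as a divisor.
theorem caches_cohesionOps {n b X Y Z : ℕ} (hb : 0 < b) {D : Fin n → Fin n → ℝ}
    {w : Addr n → Word n} (hw : ∀ x y, w (.dist x y) = ⟨D x y, some s(x, y)⟩)
    (hu : ∀ x y, x < y → w (focusAddr x y) = ⟨focusSize D x y, none⟩) {f : Addr n → ℝ}
    {s : State n}
    (h : Caches (accum w (cohSet n) f) (kindTripleCells n b [0, 1, 2, 3] X Y Z)
      (kindTripleSet n b [2, 3] X Y Z) s) :
    Caches (accum w (cohSet n) fun a => f a + ((triplesOf n b X Y Z).map fun t =>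
        ∑ m ∈ Finset.range 3,
          ((if a = .coh (triplePart m t).1 (triplePart m t).2
            then cohesionUpdate D ((2, m), t) else 0) +
          (if a = .coh (triplePart m t).2 (triplePart m t).1
            then cohesionUpdate D ((3, m), t) else 0))).sum)
      (kindTripleCells n b [0, 1, 2, 3] X Y Z) (kindTripleSet n b [2, 3] X Y Z)
      (run s (cohesionOps n b X Y Z)) := by
  let items : List ((ℕ × ℕ) × Fin n × Fin n × Fin n) := (triplesOf n b X Y Z).flatMap fun t =>
    [((2, 0), t), ((3, 0), t), ((2, 1), t), ((3, 1), t), ((2, 2), t), ((3, 2), t)]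
  have hmem : ∀ e ∈ items, (e.1.1 = 2 ∨ e.1.1 = 3) ∧ e.2 ∈ triplesOf n b X Y Z := by
    intro e he
    obtain ⟨t, ht, he⟩ := List.mem_flatMap.mp he
    simp only [List.mem_cons, List.not_mem_nil, or_false] at he
    rcases he with rfl | rfl | rfl | rfl | rfl | rfl <;> simp [ht]
  have hR : ∀ k ∈ [0, 1, 2, 3], k < 4 := by simp
  have hT : ∀ e ∈ items, ∀ x y : Fin n, kindAddr e.1.1 x y ∈ cohSet n := by
    intro e he x y
    rcases (hmem e he).1 with h | h <;> rw [h] <;> exact coh_mem_cohSet _ _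
  have hkR : ∀ e ∈ items, e.1.1 ∈ [0, 1, 2, 3] := fun e he => by
    rcases (hmem e he).1 with h | h <;> simp [h]
  have key := Caches.accumulate (w := w) (T := cohSet n)
    (K := kindTripleCells n b [0, 1, 2, 3] X Y Z) (S := kindTripleSet n b [2, 3] X Y Z) items
    (cohesionInstr b X Y Z)
    (fun e => cell b (3 * e.1.1 + partSlot X Y Z e.1.2) (triplePart e.1.2 e.2).1
      (triplePart e.1.2 e.2).2)
    (fun e => kindAddr e.1.1 (triplePart e.1.2 e.2).1 (triplePart e.1.2 e.2).2)
    (cohesionUpdate D) (fun e he => hT e he _ _)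
    (fun e he => ⟨e.1.1, by simpa using (hmem e he).1, _,
      (triplePart_inTriple (hmem e he).2 e.1.2).1, rfl⟩)
    (fun e he r a hra => kindTripleCells_iff hb hR (hkR e he) (hmem e he).2 e.1.2 hra) ?_ h
  · refine key.mono (fun r a hra => ⟨hra, ?_⟩) (fun a ha => ⟨ha, ?_⟩)
    all_goals
      congr 2
      funext a
      congr 1
      simp only [items]
      induction triplesOf n b X Y Z with
      | nil => rfl
      | cons t l ih =>
        simp only [List.flatMap_cons, List.map_append, List.sum_append, ih, List.map_cons,
          List.map_nil, List.sum_cons, List.sum_nil, add_zero, Finset.sum_range_succ,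
          Finset.sum_range_zero, zero_add, add_assoc]
        rfl
  · rintro ⟨⟨k, m⟩, t⟩ he f' s' hs'
    have ht := (hmem _ he).2
    have hw' : ∀ x y, accum w (cohSet n) f' (.dist x y) = ⟨D x y, some s(x, y)⟩ := fun x y => by
      rw [accum_of_notMem (dist_notMem_cohSet _ _), hw]
    have e0 := fast_dist (by simp) hw' hs' ht 0
    have e1 := fast_dist (by simp) hw' hs' ht 1
    have e2 := fast_dist (by simp) hw' hs' ht 2
    have e3 := hs'.fast _ _ (kindTripleCells_part (hkR _ he) ht m)
    have e4 := hs'.fast _ _ (kindTripleCells_part (k := 1) (by simp) ht (otherPart k m))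
    have e4' : accum w (cohSet n) f' (kindAddr 1 (triplePart (otherPart k m) t).1
        (triplePart (otherPart k m) t).2) =
        ⟨focusSize D (triplePart (otherPart k m) t).1 (triplePart (otherPart k m) t).2, none⟩ := by
      rw [accum_of_notMem (show kindAddr 1 _ _ ∉ cohSet n from aux_notMem_cohSet _ _)]
      exact hu _ _ (triplePart_inTriple ht _).1.1
    rw [e4'] at e4
    rw [accum_of_mem (hT _ he _ _)] at e3
    simp only [triplePart] at e0 e1 e2
    have e0' : partSlot X Y Z 0 = 0 := rfl
    rw [e0'] at e0
    simp only [cohesionInstr, addC, Instr.exec, cohesionUpdate]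
    congr 2
    simp [e0, e1, e2, e3, e4]

/-! ### Values computed by the triplet algorithm -/

/-- The six orders of a triplet. -/
theorem sum_sorted_perms {n : ℕ} (F : Fin n → Fin n → Fin n → ℝ) :
    (∑ t : Fin n × Fin n × Fin n, if t.1 < t.2.1 ∧ t.2.1 < t.2.2 then
      F t.1 t.2.1 t.2.2 + F t.2.1 t.1 t.2.2 + F t.1 t.2.2 t.2.1 + F t.2.2 t.1 t.2.1 +
        F t.2.1 t.2.2 t.1 + F t.2.2 t.2.1 t.1 else 0) =
      ∑ x, ∑ y, ∑ z, if x ≠ y ∧ x ≠ z ∧ y ≠ z then F x y z else 0 := by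
  -- Three distinct points are in exactly one of six strict orders; renaming the variables sends
  -- each order to the sorted one.
  have split : ∀ x y z : Fin n, (if x ≠ y ∧ x ≠ z ∧ y ≠ z then F x y z else 0) =
      (if x < y ∧ y < z then F x y z else 0) + (if y < x ∧ x < z then F x y z else 0) +
      (if x < z ∧ z < y then F x y z else 0) + (if y < z ∧ z < x then F x y z else 0) +
      (if z < x ∧ x < y then F x y z else 0) + (if z < y ∧ y < x then F x y z else 0) := by
    intro x y z
    grind
  simp only [split, Fintype.sum_prod_type, Finset.sum_add_distrib]
  have dist : ∀ x y z : Fin n, (if x < y ∧ y < z then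
      F x y z + F y x z + F x z y + F z x y + F y z x + F z y x else 0) =
      (if x < y ∧ y < z then F x y z else 0) + (if x < y ∧ y < z then F y x z else 0) +
      (if x < y ∧ y < z then F x z y else 0) + (if x < y ∧ y < z then F z x y else 0) +
      (if x < y ∧ y < z then F y z x else 0) + (if x < y ∧ y < z then F z y x else 0) := by
    intro x y z
    split_ifs <;> simp
  simp only [dist, Finset.sum_add_distrib]
  have c2 : (∑ x, ∑ y, ∑ z, if x < y ∧ y < z then F y x z else 0) =
      ∑ x, ∑ y, ∑ z, if y < x ∧ x < z then F x y z else 0 := Finset.sum_comm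
  have c3 : (∑ x, ∑ y, ∑ z, if x < y ∧ y < z then F x z y else 0) =
      ∑ x, ∑ y, ∑ z, if x < z ∧ z < y then F x y z else 0 :=
    Finset.sum_congr rfl fun x _ => Finset.sum_comm
  have c4 : (∑ x, ∑ y, ∑ z, if x < y ∧ y < z then F z x y else 0) =
      ∑ x, ∑ y, ∑ z, if y < z ∧ z < x then F x y z else 0 := by
    rw [Finset.sum_congr rfl fun x _ => Finset.sum_comm, Finset.sum_comm]
  have c5 : (∑ x, ∑ y, ∑ z, if x < y ∧ y < z then F y z x else 0) =
      ∑ x, ∑ y, ∑ z, if z < x ∧ x < y then F x y z else 0 := by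
    rw [Finset.sum_comm]
    exact Finset.sum_congr rfl fun x _ => Finset.sum_comm
  have c6 : (∑ x, ∑ y, ∑ z, if x < y ∧ y < z then F z y x else 0) =
      ∑ x, ∑ y, ∑ z, if z < y ∧ y < x then F x y z else 0 := by
    rw [Finset.sum_comm, Finset.sum_congr rfl fun x _ => Finset.sum_comm, Finset.sum_comm]
  rw [c2, c3, c4, c5, c6]

/-- The third point is outside the focus of a pair exactly when that pair is the closest one, so
each sum of two masks is a focus indicator. -/
theorem focusMask_eq {a b c : ℝ} (hab : a ≠ b) (hac : a ≠ c) (hbc : b ≠ c) :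
    focusMask 0 a b c = inFocus a b c ∧ focusMask 1 a b c = inFocus b a c ∧
      focusMask 2 a b c = inFocus c a b := by
  simp only [focusMask, sMask, tMask, rMask, inFocus]
  rcases hab.lt_or_gt with h1 | h1 <;> rcases hac.lt_or_gt with h2 | h2 <;>
    rcases hbc.lt_or_gt with h3 | h3 <;>
    first
      | (exfalso; linarith)
      | simp [h1, h2, h3, h1.not_gt, h2.not_gt, h3.not_gt]

theorem cohesionMask_eq {a b c : ℝ} (hab : a ≠ b) (hac : a ≠ c) (hbc : b ≠ c) :
    cohesionMask 0 a b c = (if a < b ∧ a < c then 1 else 0) ∧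
      cohesionMask 1 a b c = (if b < a ∧ b < c then 1 else 0) ∧
      cohesionMask 2 a b c = if c < a ∧ c < b then 1 else 0 := by
  simp only [cohesionMask, sMask, tMask, rMask]
  rcases hab.lt_or_gt with h1 | h1 <;> rcases hac.lt_or_gt with h2 | h2 <;>
    rcases hbc.lt_or_gt with h3 | h3 <;>
    first
      | (exfalso; linarith)
      | simp [h1, h2, h3, h1.not_gt, h2.not_gt, h3.not_gt]

/-- The three distances of a triplet are distinct. -/
theorem TieFree.triple {n : ℕ} {D : Fin n → Fin n → ℝ} (hD : IsDistance D) (hT : TieFree D)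
    {x y z : Fin n} (hxy : x ≠ y) (hxz : x ≠ z) (hyz : y ≠ z) :
    D x y ≠ D x z ∧ D x y ≠ D y z ∧ D x z ≠ D y z := by
  refine ⟨hT x y z hxy hxz hyz, ?_, ?_⟩
  · rw [hD.symm x y]
    exact hT y x z hxy.symm hyz hxz
  · rw [hD.symm x z, hD.symm y z]
    exact hT z x y hxz.symm hyz.symm hxy

open Classical in
-- Each third point is met in one sorted triplet; the initial `2` accounts for `p` and `q`, which
-- always lie in their own focus but form no triplet.
theorem sum_focusUpdate {n : ℕ} {D : Fin n → Fin n → ℝ} (hD : IsDistance D) (hT : TieFree D)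
    {p q : Fin n} (hpq : p < q) :
    2 + (∑ t : Fin n × Fin n × Fin n, if t.1 < t.2.1 ∧ t.2.1 < t.2.2 then
      ∑ m ∈ Finset.range 3, (if focusAddr p q = focusAddr (triplePart m t).1 (triplePart m t).2
        then focusUpdate D (m, t) else 0) else 0) = focusSize D p q := by
  have h := sum_sorted_perms fun x y z : Fin n =>
    if p = x ∧ q = y then inFocus (D x y) (D x z) (D y z) else 0
  rw [Finset.sum_congr rfl (g := fun t : Fin n × Fin n × Fin n =>
    if t.1 < t.2.1 ∧ t.2.1 < t.2.2 then
      ∑ m ∈ Finset.range 3, (if focusAddr p q = focusAddr (triplePart m t).1 (triplePart m t).2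
        then focusUpdate D (m, t) else 0) else 0)] at h
  · rw [h, ← sum_inFocus hD hT hpq.ne]
    have h1 : ∀ x y z : Fin n, (if x ≠ y ∧ x ≠ z ∧ y ≠ z then
        if p = x ∧ q = y then inFocus (D x y) (D x z) (D y z) else 0 else 0) =
        if p = x then if q = y then if p ≠ z ∧ q ≠ z then inFocus (D p q) (D p z) (D q z) else 0
          else 0 else 0 := by
      intro x y z
      by_cases hx : p = x
      · by_cases hy : q = y
        · subst hx hy
          simp [hpq.ne]
        · simp [hy]
      · simp [hx]
    simp only [h1, Finset.sum_ite_irrel, Finset.sum_const_zero, Finset.sum_ite_eq,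
      Finset.mem_univ, if_true]
    have h2 : ∀ z, inFocus (D p q) (D p z) (D q z) =
        (if p ≠ z ∧ q ≠ z then inFocus (D p q) (D p z) (D q z) else 0) +
        ((if p = z then 1 else 0) + (if q = z then 1 else 0)) := by
      intro z
      have hpos := hD.pos p q hpq.ne
      by_cases h3 : p = z
      · subst h3
        simp [inFocus, hD.self, hpos, hpq.ne']
      · by_cases h4 : q = z
        · subst h4
          simp [inFocus, hD.self, hpos, hpq.ne]
        · simp [h3, h4]
    rw [Finset.sum_congr rfl fun z _ => h2 z, Finset.sum_add_distrib, Finset.sum_add_distrib]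
    simp only [Finset.sum_ite_eq, Finset.mem_univ, if_true]
    ring
  · rintro ⟨x, y, z⟩ -
    dsimp only
    by_cases hs : x < y ∧ y < z
    swap
    · rw [if_neg hs, if_neg hs]
    obtain ⟨hxy, hyz⟩ := id hs
    have hxz := hxy.trans hyz
    obtain ⟨t1, t2, t3⟩ := TieFree.triple hD hT hxy.ne hxz.ne hyz.ne
    obtain ⟨m0, m1, m2⟩ := focusMask_eq t1 t2 t3
    -- Of the six orders, the three that reverse the pair drop out because only `p < q` is stored.
    have no : ∀ a b : Fin n, a < b → ¬ (p = b ∧ q = a) := by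
      rintro a b hab ⟨rfl, rfl⟩
      exact hab.not_gt hpq
    rw [if_pos hs, if_pos hs, if_neg (no x y hxy), if_neg (no x z hxz),
      if_neg (no y z hyz)]
    simp only [Finset.sum_range_succ, Finset.sum_range_zero, focusUpdate, m0, m1, m2, triplePart,
      focusAddr, Addr.aux.injEq, Fin.val_inj, hD.symm z y, hD.symm y x, hD.symm z x]
    ring

open Classical in
-- With `z` as third point, `c_pq` gains `1 / u_pz` exactly when `d_pq` is the smallest of the three
-- distances. In the definition of `c_pq` this `z` is the summation variable, and the terms `z = p`
-- and `z = q` vanish.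
theorem sum_cohesionUpdate {n : ℕ} {D : Fin n → Fin n → ℝ} (hD : IsDistance D) (hT : TieFree D)
    {p q : Fin n} (hpq : p ≠ q) :
    (∑ t : Fin n × Fin n × Fin n, if t.1 < t.2.1 ∧ t.2.1 < t.2.2 then
      ∑ m ∈ Finset.range 3,
        ((if Addr.coh p q = .coh (triplePart m t).1 (triplePart m t).2
          then cohesionUpdate D ((2, m), t) else 0) +
        (if Addr.coh p q = .coh (triplePart m t).2 (triplePart m t).1
          then cohesionUpdate D ((3, m), t) else 0)) else 0) =
      ((n : ℝ) - 1) * cohesion D p q := by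
  have h := sum_sorted_perms fun x y z : Fin n =>
    if p = x ∧ q = y then
      (if D x y < D x z ∧ D x y < D y z then 1 else 0) * (1 / focusSize D x z) else 0
  rw [Finset.sum_congr rfl (g := fun t : Fin n × Fin n × Fin n =>
    if t.1 < t.2.1 ∧ t.2.1 < t.2.2 then
      ∑ m ∈ Finset.range 3,
        ((if Addr.coh p q = .coh (triplePart m t).1 (triplePart m t).2
          then cohesionUpdate D ((2, m), t) else 0) +
        (if Addr.coh p q = .coh (triplePart m t).2 (triplePart m t).1
          then cohesionUpdate D ((3, m), t) else 0)) else 0)] at h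
  · rw [h, smul_cohesion D hpq]
    have h1 : ∀ x y z : Fin n, (if x ≠ y ∧ x ≠ z ∧ y ≠ z then
        if p = x ∧ q = y then
          (if D x y < D x z ∧ D x y < D y z then 1 else 0) * (1 / focusSize D x z) else 0 else 0) =
        if p = x then if q = y then gVal (D p z) (D z q) (D p q, focusSize D p z)
          else 0 else 0 := by
      intro x y z
      by_cases hx : p = x
      · by_cases hy : q = y
        · subst hx hy
          by_cases h3 : p = z
          · subst h3
            simp [gVal_self_left hD hpq]
          by_cases h4 : q = z
          · subst h4
            simp [gVal_self_right hD hpq]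
          obtain ⟨t1, t2, t3⟩ := TieFree.triple hD hT hpq h3 h4
          simp only [ne_eq, hpq, h3, h4, not_false_eq_true, and_self, if_true, gVal,
            hD.symm z q, t1.le_iff_lt, t2.le_iff_lt]
          by_cases c1 : D p q < D p z <;> by_cases c2 : D p q < D q z <;> simp [c1, c2]
        · simp [hy]
      · simp [hx]
    simp only [h1, Finset.sum_ite_irrel, Finset.sum_const_zero, Finset.sum_ite_eq,
      Finset.mem_univ, if_true]
  · rintro ⟨x, y, z⟩ -
    dsimp only
    by_cases hs : x < y ∧ y < z
    swap
    · rw [if_neg hs, if_neg hs]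
    obtain ⟨hxy, hyz⟩ := id hs
    have hxz := hxy.trans hyz
    obtain ⟨t1, t2, t3⟩ := TieFree.triple hD hT hxy.ne hxz.ne hyz.ne
    obtain ⟨m0, m1, m2⟩ := cohesionMask_eq t1 t2 t3
    rw [if_pos hs, if_pos hs]
    simp only [Finset.sum_range_succ, Finset.sum_range_zero, cohesionUpdate, m0, m1, m2, triplePart,
      otherPart, Addr.coh.injEq, hD.symm z y, hD.symm y x, hD.symm z x, focusSize_comm hD z y,
      focusSize_comm hD y x, focusSize_comm hD z x, if_true]
    simp only [and_comm (a := D x y < D y z), and_comm (a := D x z < D y z),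
      and_comm (a := D y z < D x z)]
    norm_num
    ring

/-! ### Correctness of the triplet algorithm -/

def initFocus (n i j : ℕ) : ℝ := if i < j ∧ j < n then 2 else 0

theorem caches_focusInit {n : ℕ} (D : Fin n → Fin n → ℝ) :
    Caches (baseWord D (initFocus n)) (fun _ _ => False) ∅ (run (initial D) (focusInit n)) := by
  let S : Set (Addr n) := {a | ∃ p : Fin n × Fin n, p.1 < p.2 ∧ a = focusAddr p.1 p.2}
  -- The single cell `0`, holding `2`, serves as cache for all focus sizes of the upper triangle;
  -- the writes then flush it to each of them.
  let K : ℕ → Addr n → Prop := fun r a => r = 0 ∧ a ∈ S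
  have h1 : Caches (baseWord D (initFocus n)) K S
      ((Instr.op 0 ![] (fun _ => 2) 0).exec (initial D)) := by
    refine ⟨?_, fun a ha => ?_⟩
    · rintro r a ⟨rfl, p, hp, rfl⟩
      have hp' : p.1.val < p.2.val := hp
      simp [Instr.exec, baseWord, focusAddr, initFocus, hp']
    · cases a with
      | dist x y => rfl
      | coh x y => rfl
      | aux i j =>
        have : initFocus n i j = 0 := if_neg fun h =>
          ha ⟨(⟨i, h.1.trans h.2⟩, ⟨j, h.2⟩), h.1, rfl⟩
        simp [Instr.exec, initial, baseWord, this]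
  have h2 := h1.writes (S' := ∅)
    ((List.finRange n ×ˢ List.finRange n).filter fun p => p.1 < p.2) (fun _ => 0)
    (fun p => focusAddr p.1 p.2)
    (fun p hp => ⟨rfl, p, by simpa using (List.mem_filter.mp hp).2, rfl⟩)
    (fun a _ => by
      by_cases ha : a ∈ S
      · obtain ⟨p, hp, rfl⟩ := ha
        exact Or.inr ⟨p, List.mem_filter.mpr ⟨List.pair_mem_product.mpr
          ⟨List.mem_finRange _, List.mem_finRange _⟩, by simpa using hp⟩, rfl⟩
      · exact Or.inl ha)
  exact h2.mono (fun r a hra => hra.elim) (fun a ha => ⟨ha, rfl⟩)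

theorem caches_accum_focusInit {n : ℕ} (D : Fin n → Fin n → ℝ) :
    Caches (accum (baseWord D 0) (auxSet n) fun a => (baseWord D (initFocus n) a).val)
      (fun _ _ => False) ∅ (run (initial D) (focusInit n)) := by
  refine (caches_focusInit D).mono (fun r a hra => hra.elim) (fun a ha => ⟨ha, ?_⟩)
  cases a with
  | dist x y => rw [accum_of_notMem (dist_notMem_auxSet _ _)]; rfl
  | coh x y => rw [accum_of_notMem (coh_notMem_auxSet _ _)]; rfl
  | aux i j => rw [accum_of_mem (aux_mem_auxSet _ _)]; rfl

theorem triplet_output {n b₁ b₂ : ℕ} (h₁ : 0 < b₁) (h₂ : 0 < b₂) {D : Fin n → Fin n → ℝ}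
    (hD : IsDistance D) (hT : TieFree D) {x z : Fin n} (hxz : x ≠ z) :
    ((exec D (triplet n b₁ b₂)).slow (.coh x z)).val = ((n : ℝ) - 1) * cohesion D x z := by
  classical
  change ((run (initial D) (triplet n b₁ b₂)).slow (.coh x z)).val = _
  rw [triplet, focusPass_eq, cohesionPass_eq, run_append, run_append]
  have p1 := caches_triplePass h₁ (R := [0, 1]) (W := [1]) (by simp) (by simp)
    (fun X Y Z f s hs => caches_focusOps h₁ (D := D) (fun _ _ => rfl) hs) (caches_accum_focusInit D)
  simp only [sum_blocks_triples h₁] at p1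
  generalize hs : run (run (initial D) (focusInit n)) _ = s at p1
  let f₁ : Addr n → ℝ := fun a => (baseWord D (initFocus n) a).val +
    ∑ t : Fin n × Fin n × Fin n, if t.1 < t.2.1 ∧ t.2.1 < t.2.2 then
      ∑ m ∈ Finset.range 3, (if a = focusAddr (triplePart m t).1 (triplePart m t).2
        then focusUpdate D (m, t) else 0) else 0
  have hu : ∀ x y, x < y → accum (baseWord D 0) (auxSet n) f₁ (focusAddr x y) =
      ⟨focusSize D x y, none⟩ := by
    intro x y hxy
    rw [accum_of_mem (focusAddr_mem_auxSet _ _), ← sum_focusUpdate hD hT hxy]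
    have hxy' : x.val < y.val := hxy
    simp [f₁, baseWord, focusAddr, initFocus, hxy']
  -- Between the passes the roles change: the computed focus sizes become fixed contents, and the
  -- still vanishing cohesions become the accumulated entries.
  have p2 : Caches (accum (accum (baseWord D 0) (auxSet n) f₁) (cohSet n) fun _ => 0)
      (fun _ _ => False) ∅ s := by
    refine p1.mono (fun r a hra => hra.elim) (fun a ha => ⟨ha, ?_⟩)
    cases a with
    | dist x y => rw [accum_of_notMem (dist_notMem_cohSet _ _)]
    | coh x y =>
      rw [accum_of_mem (coh_mem_cohSet _ _), accum_of_notMem (coh_notMem_auxSet _ _)]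
      rfl
    | aux i j => rw [accum_of_notMem (aux_notMem_cohSet _ _)]
  have p3 := caches_triplePass h₂ (R := [0, 1, 2, 3]) (W := [2, 3]) (by simp) (by simp)
    (fun X Y Z f s hs => caches_cohesionOps h₂ (D := D)
      (fun _ _ => by rw [accum_of_notMem (dist_notMem_auxSet _ _)]; rfl) hu hs) p2
  simp only [sum_blocks_triples h₂] at p3
  have h := p3.slow (.coh x z) (Set.notMem_empty _)
  rw [accum_of_mem (coh_mem_cohSet _ _), zero_add] at h
  rw [h, ← sum_cohesionUpdate hD hT hxz]

/-- The first pass suffices, as every triple of blocks of `D` is loaded there. -/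
theorem triplet_visits {n M b₁ b₂ : ℕ} (h₁ : 0 < b₁) (hM : 6 * b₁ * b₁ ≤ M)
    (D : Fin n → Fin n → ℝ) {x y z : Fin n} (hxy : x < y) (hyz : y < z) :
    Visits (initial D) (triplet n b₁ b₂) fun s =>
      s.Holds M x y ∧ s.Holds M x z ∧ s.Holds M y z := by
  classical
  rw [triplet, focusPass_eq]
  refine Visits.append_right (Visits.append_left ?_) _
  refine triplePass_visits h₁ (by simp) (by simp)
    (fun X Y Z f s hs => caches_focusOps h₁ (D := D) (fun _ _ => rfl) hs) hxy hyz (fun f s hs => ?_)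
    (caches_accum_focusInit D)
  have ht : (x, y, z) ∈ triplesOf n b₁ (x.val / b₁) (y.val / b₁) (z.val / b₁) :=
    mem_triplesOf.mpr ⟨⟨rfl, rfl, rfl⟩, hxy, hyz⟩
  have key : ∀ m, s.Holds M (triplePart m (x, y, z)).1 (triplePart m (x, y, z)).2 := by
    intro m
    refine hs.holds ?_ (kindTripleCells_part (k := 0) (by simp) ht m) ?_
    · have hlt : 3 * 0 + partSlot (x.val / b₁) (y.val / b₁) (z.val / b₁) m < 6 := by
        rw [← (triplePart_inTriple ht m).2]
        have := tripleSlot_lt b₁ (x.val / b₁) (y.val / b₁) (triplePart m (x, y, z))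
        omega
      exact (cell_lt h₁ hlt _ _).trans_le hM
    · rw [accum_of_notMem (dist_notMem_auxSet _ _)]
      rfl
  exact ⟨key 0, key 1, key 2⟩

theorem fits_triplePass {n M b N : ℕ} (hb : 0 < b) (hM : (3 * N) * b * b ≤ M) {R W : List ℕ}
    (hR : ∀ k ∈ R, k < N) (hWR : ∀ k ∈ W, k ∈ R) {ops : ℕ → ℕ → ℕ → List (Instr n)}
    (hops : ∀ X Y Z, ∀ I ∈ ops X Y Z, I.FitsIn M) :
    ∀ I ∈ triplePass n b R W ops, I.FitsIn M := by
  have hc : ∀ k ∈ R, ∀ s < 3, ∀ x y : Fin n, cell b (3 * k + s) x y < M := fun k hk s hs x y =>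
    (cell_lt hb (show 3 * k + s < 3 * N by have := hR k hk; omega) x y).trans_le hM
  have hread : ∀ s < 3, ∀ X Y, ∀ I ∈ readKinds n b R s X Y, I.FitsIn M := by
    intro s hs X Y
    rw [readKinds_eq, List.forall_mem_map]
    rintro ⟨k, p⟩ he
    exact hc k (List.pair_mem_product.mp he).1 s hs _ _
  have hwrite : ∀ s < 3, ∀ X Y, ∀ I ∈ writeKinds n b W s X Y, I.FitsIn M := by
    intro s hs X Y
    rw [writeKinds_eq, List.forall_mem_map]
    rintro ⟨k, p⟩ he
    exact hc k (hWR k (List.pair_mem_product.mp he).1) s hs _ _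
  have hite : ∀ (c : Prop) [Decidable c] (P : List (Instr n)), (∀ I ∈ P, I.FitsIn M) →
      ∀ I ∈ (if c then [] else P), I.FitsIn M := by
    intro c _ P hP
    split_ifs
    · simp
    · exact hP
  intro I hI
  simp only [triplePass, List.mem_flatMap] at hI
  obtain ⟨X, -, Y, -, hI⟩ := hI
  split_ifs at hI
  swap
  · simp at hI
  simp only [triplePair, List.mem_append, List.mem_flatMap] at hI
  rcases hI with (hI | ⟨Z, -, hI⟩) | hI
  · exact hread 0 (by norm_num) X Y I hI
  · split_ifs at hI
    swap
    · simp at hI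
    simp only [tripleStep, List.mem_append] at hI
    rcases hI with (((hI | hI) | hI) | hI) | hI
    · exact hite _ _ (hread 1 (by norm_num) X Z) I hI
    · exact hite _ _ (hread 2 (by norm_num) Y Z) I hI
    · exact hops X Y Z I hI
    · exact hite _ _ (hwrite 1 (by norm_num) X Z) I hI
    · exact hite _ _ (hwrite 2 (by norm_num) Y Z) I hI
  · exact hwrite 0 (by norm_num) X Y I hI

theorem partSlot_lt (X Y Z m : ℕ) : partSlot X Y Z m < 3 := by
  match m with
  | 0 => norm_num [partSlot]
  | 1 =>
    change slotXZ Y Z < 3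
    unfold slotXZ
    split_ifs <;> norm_num
  | m + 2 =>
    change slotYZ X Y Z < 3
    unfold slotYZ slotXZ
    split_ifs <;> norm_num

theorem triplet_fits {n M b₁ b₂ : ℕ} (h₁ : 0 < b₁) (h₂ : 0 < b₂) (hM₁ : 6 * b₁ * b₁ ≤ M)
    (hM₂ : 12 * b₂ * b₂ ≤ M) : ∀ I ∈ triplet n b₁ b₂, I.FitsIn M := by
  have hc₁ : ∀ k < 2, ∀ s < 3, ∀ x y : Fin n, cell b₁ (3 * k + s) x y < M := fun k hk s hs x y =>
    (cell_lt h₁ (show 3 * k + s < 6 by omega) x y).trans_le hM₁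
  have hc₂ : ∀ k < 4, ∀ s < 3, ∀ x y : Fin n, cell b₂ (3 * k + s) x y < M := fun k hk s hs x y =>
    (cell_lt h₂ (show 3 * k + s < 12 by omega) x y).trans_le hM₂
  have hM0 : 0 < M := lt_of_lt_of_le (by positivity) hM₁
  rw [triplet, focusPass_eq, cohesionPass_eq]
  intro I hI
  rcases List.mem_append.mp hI with hI | hI
  · rcases List.mem_append.mp hI with hI | hI
    · rcases List.mem_cons.mp hI with rfl | hI
      · exact ⟨fun i => i.elim0, hM0⟩
      · obtain ⟨p, -, rfl⟩ := List.mem_map.mp hI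
        exact hM0
    · refine fits_triplePass (N := 2) h₁ hM₁ (by simp) (by simp) (fun X Y Z I hI => ?_) I hI
      obtain ⟨e, -, rfl⟩ := List.mem_map.mp hI
      have c0 := hc₁ 0 (by norm_num)
      simp only [mul_zero, zero_add] at c0
      have c1 := hc₁ 1 (by norm_num) _ (partSlot_lt X Y Z e.1)
      have s1 := c0 _ (partSlot_lt X Y Z 1)
      have s2 := c0 _ (partSlot_lt X Y Z 2)
      simp only [mul_one] at c1
      simp [focusInstr, addU, Instr.FitsIn, Fin.forall_fin_succ, c0, c1, s1, s2]
  · refine fits_triplePass (N := 4) h₂ hM₂ (by simp) (by simp) (fun X Y Z I hI => ?_) I hI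
    obtain ⟨e, he, rfl⟩ := List.mem_map.mp hI
    have hk : e.1.1 < 4 := by
      obtain ⟨t, -, he⟩ := List.mem_flatMap.mp he
      simp only [List.mem_cons, List.not_mem_nil, or_false] at he
      rcases he with rfl | rfl | rfl | rfl | rfl | rfl <;> norm_num
    have c0 := hc₂ 0 (by norm_num)
    simp only [mul_zero, zero_add] at c0
    have c1 := hc₂ 1 (by norm_num) _ (partSlot_lt X Y Z (otherPart e.1.1 e.1.2))
    have c2 := hc₂ e.1.1 hk _ (partSlot_lt X Y Z e.1.2)
    have s1 := c0 _ (partSlot_lt X Y Z 1)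
    have s2 := c0 _ (partSlot_lt X Y Z 2)
    simp only [mul_one] at c1
    simp [cohesionInstr, addC, Instr.FitsIn, Fin.forall_fin_succ, c0, c1, c2, s1, s2]

theorem mul_sqrt_div_le (M c : ℕ) : c * Nat.sqrt (M / c) * Nat.sqrt (M / c) ≤ M := by
  rw [mul_assoc]
  exact (Nat.mul_le_mul_left c (Nat.sqrt_le _)).trans (Nat.mul_div_le M c)

theorem tripletFor_isRun {n M : ℕ} (hM : 12 ≤ M) {D : Fin n → Fin n → ℝ} (hD : IsDistance D)
    (hT : TieFree D) : IsRun M D ((n : ℝ) - 1) (tripletFor n M) := by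
  have h₁ := (le_mul_sq_sqrt_div (c := 6) (by norm_num) (by norm_num) hM).1
  have h₂ := (le_mul_sq_sqrt_div (c := 12) (by norm_num) (by norm_num) hM).1
  refine ⟨triplet_fits h₁ h₂ (mul_sqrt_div_le M 6) (mul_sqrt_div_le M 12),
    fun x y z hxy hxz hyz => ?_, fun x z hxz => triplet_output h₁ h₂ hD hT hxz⟩
  have key : ∀ {x y z : Fin n}, x < y → y < z → ∃ t ≤ (tripletFor n M).length,
      (exec D ((tripletFor n M).take t)).Holds M x y ∧
      (exec D ((tripletFor n M).take t)).Holds M x z ∧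
      (exec D ((tripletFor n M).take t)).Holds M y z := fun hxy hyz =>
    triplet_visits h₁ (mul_sqrt_div_le M 6) D hxy hyz
  -- The algorithm visits sorted triplets only; any other order follows by symmetry of the
  -- distances, and the two cyclic cases are impossible.
  rcases lt_or_gt_of_ne hxy with h1 | h1 <;> rcases lt_or_gt_of_ne hyz with h2 | h2 <;>
    rcases lt_or_gt_of_ne hxz with h3 | h3
  · obtain ⟨t, ht, a, b, c⟩ := key h1 h2
    exact ⟨t, ht, a, c, b⟩
  · exact absurd (h1.trans h2) h3.not_gt
  · obtain ⟨t, ht, a, b, c⟩ := key h3 h2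
    exact ⟨t, ht, b, c.symm, a⟩
  · obtain ⟨t, ht, a, b, c⟩ := key h3 h1
    exact ⟨t, ht, c, b.symm, a.symm⟩
  · obtain ⟨t, ht, a, b, c⟩ := key h1 h3
    exact ⟨t, ht, a.symm, b, c⟩
  · obtain ⟨t, ht, a, b, c⟩ := key h2 h3
    exact ⟨t, ht, b.symm, a, c.symm⟩
  · exact absurd (h2.trans h1) h3.not_gt
  · obtain ⟨t, ht, a, b, c⟩ := key h2 h1
    exact ⟨t, ht, c.symm, a.symm, b.symm⟩

/-! ### The cost bounds -/

/-- For `M ≤ n²` the term `n²` is at most `n³ / √M`, and `1448 = 181 * (7 + 1)`. -/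
theorem wordsMoved_blocked_le_of_sq {n M : ℕ} (hM : 12 ≤ M) (hMn : M ≤ n ^ 2) :
    (wordsMoved (pairwiseFor n M) : ℝ) ≤ 1448 * ((n : ℝ) ^ 3 / √(M : ℝ)) ∧
      (wordsMoved (tripletFor n M) : ℝ) ≤ 1448 * ((n : ℝ) ^ 3 / √(M : ℝ)) := by
  have hn : 0 < n := by
    rcases Nat.eq_zero_or_pos n with rfl | h
    · omega
    · exact h
  have hMR : (0 : ℝ) < M := by exact_mod_cast (show 0 < M by omega)
  have h2 : (n : ℝ) ^ 2 ≤ (n : ℝ) ^ 3 / √(M : ℝ) := by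
    rw [le_div_iff₀ (Real.sqrt_pos.mpr hMR), pow_succ (n : ℝ) 2]
    refine mul_le_mul_of_nonneg_left (Real.sqrt_le_iff.mpr ⟨Nat.cast_nonneg n, ?_⟩) (by positivity)
    exact_mod_cast hMn
  obtain ⟨e1, e2⟩ := wordsMoved_blocked_le hn hM
  constructor <;> linarith

/-- Each term of the cost is bounded by the given execution, `n³ / √M` by `72 W` and `n²` by `3 W`;
so large `M` needs no separate treatment. The constant is `181 * (7 * 72 + 3)`. -/
theorem wordsMoved_blocked_le_of_run {n M : ℕ} (hn : 3 ≤ n) (hM : 12 ≤ M) {D : Fin n → Fin n → ℝ}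
    {κ : ℝ} {P : List (Instr n)} (h : IsRun M D κ P) :
    (wordsMoved (pairwiseFor n M) : ℝ) ≤ 91767 * wordsMoved P ∧
      (wordsMoved (tripletFor n M) : ℝ) ≤ 91767 * wordsMoved P := by
  have h1 := h.lower_bound hn
  have h2 := h.sq_le hn
  obtain ⟨e1, e2⟩ := wordsMoved_blocked_le (show 0 < n by omega) hM
  constructor <;> linarith

end PaLD

theorem mainTheorem3 :
    -- the cohesion computation is 3NL, with `n (n - 1) (n - 2)` operations
    (∀ n : ℕ, (PaLD.paldThreeNL n).IsThreeNL ∧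
      (PaLD.paldThreeNL n).numOps = n * (n - 1) * (n - 2) ∧
      ∀ (D : Fin n → Fin n → ℝ), PaLD.IsDistance D →
        ∀ mem : PaLD.Addr n → ℝ, (∀ x y, mem (.dist x y) = D x y) →
          ((PaLD.paldThreeNL n).Computes mem (fun x z y => (D x z, PaLD.focusSize D x y)) ↔
            ∀ x z, x ≠ z → mem (.coh x z) = PaLD.cohesion D x z)) ∧
    -- every PaLD algorithm moves `Ω(n³ / √M)` words
    (∃ c : ℝ, 0 < c ∧ ∀ n M : ℕ, 3 ≤ n →
      ∀ (D : Fin n → Fin n → ℝ) (κ : ℝ) (P : List (PaLD.Instr n)), PaLD.IsRun M D κ P →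
        c * ((n : ℝ) ^ 3 / √(M : ℝ)) ≤ PaLD.wordsMoved P) ∧
    -- both blocked algorithms are PaLD algorithms
    (∀ n M : ℕ, 12 ≤ M → ∀ D : Fin n → Fin n → ℝ, PaLD.IsDistance D → PaLD.TieFree D →
      PaLD.IsRun M D ((n : ℝ) - 1) (PaLD.pairwiseFor n M) ∧
      PaLD.IsRun M D ((n : ℝ) - 1) (PaLD.tripletFor n M)) ∧
    -- both attain the lower bound
    (∃ K : ℝ, 0 < K ∧ ∀ n M : ℕ, 12 ≤ M → M ≤ n ^ 2 →
      (PaLD.wordsMoved (PaLD.pairwiseFor n M) : ℝ) ≤ K * ((n : ℝ) ^ 3 / √(M : ℝ)) ∧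
      (PaLD.wordsMoved (PaLD.tripletFor n M) : ℝ) ≤ K * ((n : ℝ) ^ 3 / √(M : ℝ))) ∧
    -- both are communication-optimal up to a constant factor
    (∃ K : ℝ, 0 < K ∧ ∀ n M : ℕ, 3 ≤ n → 12 ≤ M →
      ∀ (D : Fin n → Fin n → ℝ) (κ : ℝ) (P : List (PaLD.Instr n)), PaLD.IsRun M D κ P →
        (PaLD.wordsMoved (PaLD.pairwiseFor n M) : ℝ) ≤ K * PaLD.wordsMoved P ∧
        (PaLD.wordsMoved (PaLD.tripletFor n M) : ℝ) ≤ K * PaLD.wordsMoved P) := by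
  refine ⟨fun n => ⟨PaLD.paldThreeNL_isThreeNL n, PaLD.paldThreeNL_numOps n, fun D hD mem hmem =>
    PaLD.paldThreeNL_computes_iff hD hmem⟩, ⟨1 / 72, by norm_num, fun n M hn D κ P h =>
    h.lower_bound hn⟩, fun n M hM D hD hT => ⟨PaLD.pairwiseFor_isRun hM hD hT,
    PaLD.tripletFor_isRun hM hD hT⟩, ⟨1448, by norm_num, fun n M hM hMn =>
    PaLD.wordsMoved_blocked_le_of_sq hM hMn⟩, ⟨91767, by norm_num, fun n M hn hM D κ P h =>
    PaLD.wordsMoved_blocked_le_of_run hn hM h⟩⟩
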